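/- Let $F$ be a field. A *pre-Tannakian category over $F$* is an $F$-linear abelian category $\mathcal{T}$ in which every object has finite length and every endomorphism algebra is finite-dimensional over $F$, together with a right exact $F$-bilinear tensor product with associativity, commutativity and unit constraints (a symmetric monoidal structure) such that $F\to\operatorname{End}(\mathbf 1)$ is an isomorphism and every object has a dual. For a commutative $F$-algebra $R$, a *fibre functor of $\mathcal{T}$ over $R$* is a faithful exact $F$-linear tensor functor (compatible with the associativity, commutativity and unit constraints) from $\mathcal{T}$ to $R$-modules with values in finitely generated projective $R$-modules. A pre-Tannakian category over $F$ is *Tannakian over $F$* if it has a fibre functor over some field extension of $F$, and it is *neutral* if it has one over $F$ itself. Let $F'/F$ be a field extension and let $\mathcal{T}$ be a Tannakian category over $F$. Let $\mathcal{T}\otimes_F F'$ be the category of $F'$-modules of finite length in $\operatorname{Ind}\mathcal{T}$: its objects are the ind-objects $X$ of $\mathcal{T}$ with an $F$-algebra homomorphism $F'\to\operatorname{End}(X)$ which have finite length as such, and its morphisms are the morphisms of ind-objects that commute with the actions of $F'$. For $X\in\mathcal{T}$ let $t(X)=F'\otimes_F X$, the direct sum in $\operatorname{Ind}\mathcal{T}$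 of copies of $X$ indexed by an $F$-basis of $F'$, with $F'$ acting by multiplication on the first factor. Then every $t(X)$ has finite length, so that $t$ is a functor $\mathcal{T}\to\mathcal{T}\otimes_F F'$, and there is a right exact (in each variable) $F'$-bilinear symmetric monoidal structure on $\mathcal{T}\otimes_F F'$ that extends the one of $\mathcal{T}$, in the sense that $t$ can be made a (strong, symmetric) tensor functor. For every such structure: (a) $\mathcal{T}\otimes_F F'$ is a Tannakian category over $F'$. (b) If $\mathcal{T}$ has a fibre functor over $F'$, then $\mathcal{T}\otimes_F F'$ is neutral. -/

import Mathlib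

open CategoryTheory CategoryTheory.Limits

universe v u

noncomputable section

namespace ScalarExtension

/-! ### The `F`-linear structure on the category of ind-objects

`Ind T` is Mathlib's category of ind-objects of `T`, i.e. of filtered colimits, indexed by small
categories, of representable presheaves.  An ind-object is a left exact presheaf, so its values
are abelian groups in a canonical way; this gives the additive structure of `Ind T`. -/

theorem preservesFiniteLimits_of_isIndObject {T : Type u} [Category.{v} T] {A : Tᵒᵖ ⥤ Type v}
    (hA : IsIndObject A) : PreservesFiniteLimits A := by
  have P := hA.presentation
  have : PreservesFiniteLimits P.cocone.pt := by
    refine ObjectProperty.prop_of_isColimit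
      (P := (ObjectProperty.preservesFiniteLimits : ObjectProperty (Tᵒᵖ ⥤ Type v)))
      P.coconeIsColimit ?_
    intro i
    show PreservesFiniteLimits (yoneda.obj (P.F.obj i))
    infer_instance
  exact this

theorem indInclusion_leftExact (T : Type u) [Category.{v} T] (X : Ind T) :
    leftExactFunctor Tᵒᵖ (Type v) ((Ind.inclusion T).obj X) :=
  preservesFiniteLimits_of_isIndObject X.isIndObject_inclusion_obj

section IndLinear

variable (T : Type u) [Category.{v} T] [Abelian T]

/-- An ind-object, viewed as a left exact presheaf of sets. -/
def indToLeftExact : Ind T ⥤ (Tᵒᵖ ⥤ₗ Type v) :=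
  ObjectProperty.lift _ (Ind.inclusion T) (indInclusion_leftExact T)

instance indToLeftExact_full : (indToLeftExact T).Full :=
  inferInstanceAs (ObjectProperty.lift (leftExactFunctor Tᵒᵖ (Type v)) (Ind.inclusion T)
    (indInclusion_leftExact T)).Full

instance indToLeftExact_faithful : (indToLeftExact T).Faithful :=
  inferInstanceAs (ObjectProperty.lift (leftExactFunctor Tᵒᵖ (Type v)) (Ind.inclusion T)
    (indInclusion_leftExact T)).Faithful

attribute [local instance] HasFiniteBiproducts.of_hasFiniteProducts

/-- An ind-object, viewed as a presheaf of abelian groups. -/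
def indToAddCommGrp : Ind T ⥤ (Tᵒᵖ ⥤ AddCommGrpCat.{v}) :=
  indToLeftExact T ⋙ (AddCommGrpCat.leftExactFunctorForgetEquivalence Tᵒᵖ).inverse ⋙
    ObjectProperty.ι _

/-- Morphisms of ind-objects are the same as morphisms of the presheaves of abelian groups. -/
def indToAddCommGrpFullyFaithful : (indToAddCommGrp T).FullyFaithful :=
  (Functor.FullyFaithful.ofFullyFaithful (indToLeftExact T)).comp
    ((AddCommGrpCat.leftExactFunctorForgetEquivalence Tᵒᵖ).fullyFaithfulInverse.comp
      (ObjectProperty.fullyFaithfulι _))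

/-- The additive structure on `Ind T`. -/
@[reducible]
def indPreadditive : Preadditive (Ind T) :=
  Preadditive.ofFullyFaithful (indToAddCommGrpFullyFaithful T)

attribute [local instance] indPreadditive

instance indToAddCommGrp_additive : (indToAddCommGrp T).Additive :=
  (indToAddCommGrpFullyFaithful T).additive_ofFullyFaithful

instance indToAddCommGrp_obj_additive (X : Ind T) : ((indToAddCommGrp T).obj X).Additive := by
  have : PreservesFiniteLimits ((indToAddCommGrp T).obj X) :=
    (((AddCommGrpCat.leftExactFunctorForgetEquivalence Tᵒᵖ).inverse.obj
      ((indToLeftExact T).obj X))).property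
  exact Functor.additive_of_preserves_binary_products _

variable {F : Type v} [Field F] [Linear F T]

variable {T} in
/-- The endomorphism of the presheaf of an ind-object by which a scalar acts: a section over `U`
is acted on by restriction along the endomorphism `a • 𝟙 U` of `U`. -/
def indScalarAux (a : F) (X : Ind T) : (indToAddCommGrp T).obj X ⟶ (indToAddCommGrp T).obj X where
  app U := ((indToAddCommGrp T).obj X).map (a • 𝟙 U.unop).op
  naturality U V f := by
    rw [← Functor.map_comp, ← Functor.map_comp]
    congr 1
    apply Quiver.Hom.unop_inj
    simp

variable {T} in
/-- The action of a scalar on an ind-object. -/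
def indScalar (a : F) (X : Ind T) : X ⟶ X :=
  (indToAddCommGrpFullyFaithful T).preimage (indScalarAux a X)

variable {T}

@[simp]
theorem map_indScalar (a : F) (X : Ind T) :
    (indToAddCommGrp T).map (indScalar a X) = indScalarAux a X :=
  (indToAddCommGrpFullyFaithful T).map_preimage _

theorem indScalar_comp (a : F) {X Y : Ind T} (f : X ⟶ Y) :
    indScalar a X ≫ f = f ≫ indScalar a Y := by
  apply (indToAddCommGrpFullyFaithful T).map_injective
  ext U : 2
  simp [indScalarAux]

theorem indScalar_one (X : Ind T) : indScalar (1 : F) X = 𝟙 X := by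
  apply (indToAddCommGrpFullyFaithful T).map_injective
  ext U : 2
  simp [indScalarAux]

theorem indScalar_zero (X : Ind T) : indScalar (0 : F) X = 0 := by
  apply (indToAddCommGrpFullyFaithful T).map_injective
  ext U : 2
  simp [indScalarAux]

theorem indScalar_mul (a b : F) (X : Ind T) :
    indScalar (a * b) X = indScalar b X ≫ indScalar a X := by
  apply (indToAddCommGrpFullyFaithful T).map_injective
  ext U : 2
  rw [Functor.map_comp, map_indScalar, map_indScalar, map_indScalar, NatTrans.comp_app]
  dsimp only [indScalarAux]
  rw [← Functor.map_comp, ← op_comp, Linear.smul_comp, Category.id_comp, smul_smul]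

theorem indScalar_add (a b : F) (X : Ind T) :
    indScalar (a + b) X = indScalar a X + indScalar b X := by
  apply (indToAddCommGrpFullyFaithful T).map_injective
  ext U : 2
  simp [indScalarAux, add_smul, Functor.map_add]

variable (T F) in
/-- The `F`-linear structure on `Ind T`. -/
@[reducible]
def indLinear : Linear F (Ind T) where
  homModule X Y :=
    { smul := fun a f => f ≫ indScalar a Y
      one_smul := fun f => by
        show f ≫ indScalar 1 Y = f
        rw [indScalar_one, Category.comp_id]
      mul_smul := fun a b f => by
        show f ≫ indScalar (a * b) Y = (f ≫ indScalar b Y) ≫ indScalar a Y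
        rw [indScalar_mul, Category.assoc]
      smul_zero := fun a => by
        show (0 : X ⟶ Y) ≫ indScalar a Y = 0
        exact zero_comp
      zero_smul := fun f => by
        show f ≫ indScalar (0 : F) Y = 0
        rw [indScalar_zero, comp_zero]
      smul_add := fun a f g => Preadditive.add_comp _ _ _ _ _ _
      add_smul := fun a b f => by
        show f ≫ indScalar (a + b) Y = f ≫ indScalar a Y + f ≫ indScalar b Y
        rw [indScalar_add, Preadditive.comp_add] }
  smul_comp X Y Z a f g := by
    show (f ≫ indScalar a Y) ≫ g = (f ≫ g) ≫ indScalar a Z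
    rw [Category.assoc, indScalar_comp, Category.assoc]
  comp_smul X Y Z f a g := by
    show f ≫ (g ≫ indScalar a Z) = (f ≫ g) ≫ indScalar a Z
    rw [Category.assoc]

end IndLinear

attribute [local instance] indPreadditive indLinear

/-! ### `F'`-modules in `Ind T` -/

section Modules

variable (F F' : Type v) [Field F] [Field F'] [Algebra F F']
variable (T : Type u) [Category.{v} T] [Abelian T] [Linear F T]

/-- An `F'`-module in `Ind T`: an ind-object with an `F`-linear action of `F'` on it. -/
structure IndModule where
  obj : Ind T
  act : F' →ₐ[F] End obj

namespace IndModule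

variable {F F' T}

/-- The action of an element of `F'`, as a morphism. -/
def smulHom (X : IndModule F F' T) (a : F') : X.obj ⟶ X.obj := X.act a

/-- A homomorphism of `F'`-modules. -/
@[ext]
structure Hom (X Y : IndModule F F' T) where
  hom : X.obj ⟶ Y.obj
  comm : ∀ a : F', X.smulHom a ≫ hom = hom ≫ Y.smulHom a

instance category : Category.{v} (IndModule F F' T) where
  Hom X Y := Hom X Y
  id X := ⟨𝟙 X.obj, fun a => by rw [Category.comp_id, Category.id_comp]⟩
  comp f g := ⟨f.hom ≫ g.hom, fun a => by
    rw [← Category.assoc, f.comm, Category.assoc, g.comm, Category.assoc]⟩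

@[ext]
theorem hom_ext {X Y : IndModule F F' T} {f g : X ⟶ Y} (h : f.hom = g.hom) : f = g :=
  Hom.ext h

@[simp]
theorem id_hom (X : IndModule F F' T) : Hom.hom (𝟙 X) = 𝟙 X.obj := rfl

@[simp]
theorem comp_hom {X Y Z : IndModule F F' T} (f : X ⟶ Y) (g : Y ⟶ Z) :
    Hom.hom (f ≫ g) = f.hom ≫ g.hom := rfl

theorem smulHom_one (X : IndModule F F' T) : X.smulHom 1 = 𝟙 X.obj := map_one X.act

theorem smulHom_zero (X : IndModule F F' T) : X.smulHom 0 = 0 := map_zero X.act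

theorem smulHom_add (X : IndModule F F' T) (a b : F') :
    X.smulHom (a + b) = X.smulHom a + X.smulHom b := map_add X.act a b

theorem smulHom_mul (X : IndModule F F' T) (a b : F') :
    X.smulHom (a * b) = X.smulHom b ≫ X.smulHom a := map_mul X.act a b

instance homZero (X Y : IndModule F F' T) : Zero (X ⟶ Y) :=
  ⟨⟨0, fun a => by rw [comp_zero, zero_comp]⟩⟩

instance homAdd (X Y : IndModule F F' T) : Add (X ⟶ Y) :=
  ⟨fun f g => ⟨f.hom + g.hom, fun a => by
    rw [Preadditive.comp_add, Preadditive.add_comp, f.comm, g.comm]⟩⟩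

instance homNeg (X Y : IndModule F F' T) : Neg (X ⟶ Y) :=
  ⟨fun f => ⟨-f.hom, fun a => by
    rw [Preadditive.comp_neg, Preadditive.neg_comp, f.comm]⟩⟩

theorem zero_hom (X Y : IndModule F F' T) : Hom.hom (0 : X ⟶ Y) = 0 := rfl

theorem add_hom {X Y : IndModule F F' T} (f g : X ⟶ Y) : Hom.hom (f + g) = f.hom + g.hom := rfl

theorem neg_hom {X Y : IndModule F F' T} (f : X ⟶ Y) : Hom.hom (-f) = -f.hom := rfl

instance homAddCommGroup (X Y : IndModule F F' T) : AddCommGroup (X ⟶ Y) where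
  add_assoc f g h := hom_ext (add_assoc _ _ _)
  zero_add f := hom_ext (zero_add _)
  add_zero f := hom_ext (add_zero _)
  nsmul := nsmulRec
  zsmul := zsmulRec
  neg_add_cancel f := hom_ext (neg_add_cancel f.hom)
  add_comm f g := hom_ext (add_comm _ _)

instance preadditive : Preadditive (IndModule F F' T) where
  add_comp _ _ _ _ _ _ := hom_ext (Preadditive.add_comp _ _ _ _ _ _)
  comp_add _ _ _ _ _ _ := hom_ext (Preadditive.comp_add _ _ _ _ _ _)

instance homSMul (X Y : IndModule F F' T) : SMul F' (X ⟶ Y) :=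
  ⟨fun a f => ⟨f.hom ≫ Y.smulHom a, fun b => by
    rw [← Category.assoc, f.comm, Category.assoc, Category.assoc, ← smulHom_mul, ← smulHom_mul,
      mul_comm]⟩⟩

theorem smul_hom {X Y : IndModule F F' T} (a : F') (f : X ⟶ Y) :
    Hom.hom (a • f) = f.hom ≫ Y.smulHom a := rfl

/-- The `F'`-linear structure on the category of `F'`-modules. -/
instance linear : Linear F' (IndModule F F' T) where
  homModule X Y :=
    { one_smul := fun f => hom_ext (by rw [smul_hom, smulHom_one, Category.comp_id])
      mul_smul := fun a b f => hom_ext (by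
        rw [smul_hom, smul_hom, smul_hom, smulHom_mul, Category.assoc])
      smul_zero := fun a => hom_ext (by rw [smul_hom, zero_hom, zero_comp])
      zero_smul := fun f => hom_ext (by rw [smul_hom, zero_hom, smulHom_zero, comp_zero])
      smul_add := fun a f g => hom_ext (by
        rw [smul_hom, add_hom, add_hom, smul_hom, smul_hom, Preadditive.add_comp])
      add_smul := fun a b f => hom_ext (by
        rw [smul_hom, add_hom, smul_hom, smul_hom, smulHom_add, Preadditive.comp_add]) }
  smul_comp X Y Z a f g := hom_ext (by
    rw [comp_hom, smul_hom, smul_hom, comp_hom, Category.assoc, Category.assoc, g.comm])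
  comp_smul X Y Z f a g := hom_ext (by
    rw [comp_hom, smul_hom, smul_hom, comp_hom, Category.assoc])

end IndModule

/-! ### Extension of scalars `X ↦ F' ⊗_F X` on ind-objects -/

section Extend

variable {T}

/-- The external tensor product `F' ⊗_F X`: a direct sum of copies of `X` indexed by a basis. -/
def tensorObj (X : Ind T) : Ind T :=
  ∐ fun _ : Module.Basis.ofVectorSpaceIndex F F' => X

variable {F F'}

/-- The inclusion of a summand. -/
def tensorι (X : Ind T) (i : Module.Basis.ofVectorSpaceIndex F F') : X ⟶ tensorObj F F' X :=
  Sigma.ι (fun _ : Module.Basis.ofVectorSpaceIndex F F' => X) i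

/-- The morphism `X ⟶ F' ⊗_F X`, `x ↦ a ⊗ x`. -/
def tmul (X : Ind T) : F' →ₗ[F] (X ⟶ tensorObj F F' X) :=
  (Module.Basis.ofVectorSpace F F').constr F (tensorι X)

theorem tmul_basis (X : Ind T) (i : Module.Basis.ofVectorSpaceIndex F F') :
    tmul X (Module.Basis.ofVectorSpace F F' i) = tensorι X i :=
  Module.Basis.constr_basis _ _ _ _

/-- The morphism `F' ⊗_F X ⟶ Y` defined by a linear map `F' → Hom(X, Y)`. -/
def tensorDesc {X Y : Ind T} (g : F' →ₗ[F] (X ⟶ Y)) : tensorObj F F' X ⟶ Y :=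
  Sigma.desc fun i => g (Module.Basis.ofVectorSpace F F' i)

theorem tmul_tensorDesc {X Y : Ind T} (g : F' →ₗ[F] (X ⟶ Y)) (a : F') :
    tmul X a ≫ tensorDesc g = g a := by
  have h : (Linear.rightComp F X (tensorDesc g)).comp (tmul X) = g := by
    refine (Module.Basis.ofVectorSpace F F').ext fun i => ?_
    rw [LinearMap.comp_apply, tmul_basis, Linear.rightComp_apply]
    exact Sigma.ι_desc _ _
  exact LinearMap.congr_fun h a

theorem tensor_hom_ext {X Y : Ind T} {f g : tensorObj F F' X ⟶ Y}
    (h : ∀ a : F', tmul X a ≫ f = tmul X a ≫ g) : f = g := by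
  refine Sigma.hom_ext _ _ fun i => ?_
  have := h (Module.Basis.ofVectorSpace F F' i)
  rwa [tmul_basis] at this

/-- Multiplication by `a` on the factor `F'` of `F' ⊗_F X`. -/
def tensorSMul (X : Ind T) (a : F') : tensorObj F F' X ⟶ tensorObj F F' X :=
  tensorDesc ((tmul X).comp (LinearMap.mulLeft F a))

theorem tmul_tensorSMul (X : Ind T) (a b : F') :
    tmul X b ≫ tensorSMul (F := F) X a = tmul X (a * b) :=
  tmul_tensorDesc _ _

/-- The morphism `id ⊗ f`. -/
def tensorMap {X Y : Ind T} (f : X ⟶ Y) : tensorObj F F' X ⟶ tensorObj F F' Y :=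
  tensorDesc ((Linear.leftComp F (tensorObj F F' Y) f).comp (tmul Y))

theorem tmul_tensorMap {X Y : Ind T} (f : X ⟶ Y) (a : F') :
    tmul (F := F) X a ≫ tensorMap f = f ≫ tmul Y a :=
  tmul_tensorDesc _ _

variable (F F')

/-- The `F'`-module `t(X) = (F' ⊗_F X, μ ⊗ id)`. -/
def extendObj (X : Ind T) : IndModule F F' T where
  obj := tensorObj F F' X
  act := AlgHom.ofLinearMap
    { toFun := fun a => tensorSMul X a
      map_add' := fun a b => tensor_hom_ext fun c => by
        rw [tmul_tensorSMul, add_mul, map_add]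
        refine Eq.trans ?_ (Preadditive.comp_add _ _ _ _ _ _).symm
        rw [tmul_tensorSMul, tmul_tensorSMul]
      map_smul' := fun r a => tensor_hom_ext fun c => by
        rw [tmul_tensorSMul, smul_mul_assoc, map_smul]
        refine Eq.trans ?_ (Linear.comp_smul _ _ _ _ _ _).symm
        rw [tmul_tensorSMul]; rfl }
    (tensor_hom_ext fun c => by
      refine (tmul_tensorSMul X 1 c).trans ?_
      rw [one_mul]
      exact (Category.comp_id _).symm)
    (fun a b => tensor_hom_ext fun c => by
      refine (tmul_tensorSMul X (a * b) c).trans ?_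
      refine Eq.trans ?_ (Category.assoc (tmul X c) (tensorSMul X b) (tensorSMul X a))
      rw [tmul_tensorSMul, tmul_tensorSMul, mul_assoc])

variable (T)

/-- The extension of scalars functor from `Ind T` to `F'`-modules in `Ind T`. -/
def extendScalars : Ind T ⥤ IndModule F F' T where
  obj X := extendObj F F' X
  map {X Y} f :=
    { hom := tensorMap f
      comm := fun a => by
        change tensorSMul X a ≫ tensorMap f = tensorMap f ≫ tensorSMul Y a
        refine tensor_hom_ext fun c => ?_
        rw [← Category.assoc, tmul_tensorSMul, tmul_tensorMap, ← Category.assoc, tmul_tensorMap,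
          Category.assoc, tmul_tensorSMul] }
  map_id X := IndModule.hom_ext (by
    change tensorMap (𝟙 X) = 𝟙 (tensorObj F F' X)
    refine tensor_hom_ext fun c => ?_
    rw [tmul_tensorMap, Category.id_comp, Category.comp_id])
  map_comp {X Y Z} f g := IndModule.hom_ext (by
    change tensorMap (f ≫ g) = tensorMap f ≫ tensorMap g
    refine tensor_hom_ext fun c => ?_
    rw [tmul_tensorMap, ← Category.assoc, tmul_tensorMap, Category.assoc, Category.assoc,
      tmul_tensorMap])

end Extend

end Modules

/-! ### Tannakian categories -/

section Tannakian

/-- An object of finite length: its subobjects satisfy both chain conditions. -/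
def isFiniteLength (C : Type u) [Category.{v} C] : ObjectProperty C :=
  fun X => IsNoetherianObject X ∧ IsArtinianObject X

/-- A category with a given additive structure is abelian. -/
class IsAbelian (C : Type u) [Category.{v} C] [Preadditive C] : Prop
    extends IsNormalMonoCategory C, IsNormalEpiCategory C where
  has_finite_products : HasFiniteProducts C
  has_kernels : HasKernels C
  has_cokernels : HasCokernels C

open MonoidalCategory

/-- A pre-Tannakian category over `F`: an `F`-finite rigid abelian tensor category over `F`. -/
class IsPreTannakian (F : Type v) [Field F] (C : Type u) [Category.{v} C] [Preadditive C]
    [Linear F C] [MonoidalCategory C] [SymmetricCategory C] : Prop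
    extends IsAbelian C, MonoidalPreadditive C, MonoidalLinear F C where
  tensorLeft_rightExact (X : C) : PreservesFiniteColimits (tensorLeft X)
  tensorRight_rightExact (X : C) : PreservesFiniteColimits (tensorRight X)
  /-- the structure map `F → End(𝟙)` is an isomorphism -/
  unit_bijective : Function.Bijective fun a : F => a • 𝟙 (𝟙_ C)
  dualisable (X : C) : ∃ Y : C, Nonempty (ExactPairing X Y)
  finite_length (X : C) : isFiniteLength C X
  finite_end (X : C) : Module.Finite F (End X)

/-- A fibre functor over a commutative `F`-algebra `R`: a faithful `F`-linear exact tensor functor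
to `R`-modules whose values are finitely generated and projective. -/
structure FibreFunctor (F : Type v) [Field F] (C : Type u) [Category.{v} C] [Preadditive C]
    [Linear F C] [MonoidalCategory C] [SymmetricCategory C]
    (R : Type v) [CommRing R] [Algebra F R] where
  functor : C ⥤ ModuleCat.{v} R
  /-- the tensor constraints, compatible with associativity, commutativity and units -/
  braided : functor.Braided
  faithful : functor.Faithful
  additive : functor.Additive
  map_smul : ∀ {X Y : C} (a : F) (f : X ⟶ Y),
    functor.map (a • f) = algebraMap F R a • functor.map f
  leftExact : PreservesFiniteLimits functor
  rightExact : PreservesFiniteColimits functor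
  finite : ∀ X : C, Module.Finite R (functor.obj X)
  projective : ∀ X : C, Module.Projective R (functor.obj X)

/-- A Tannakian category over `F`: a pre-Tannakian category which has a fibre functor over some
field extension of `F`. -/
structure IsTannakian (F : Type v) [Field F] (C : Type u) [Category.{v} C] [Preadditive C]
    [Linear F C] [MonoidalCategory C] [SymmetricCategory C] : Prop where
  preTannakian : IsPreTannakian F C
  exists_fibreFunctor : ∃ (L : Type v) (_ : Field L) (_ : Algebra F L),
    Nonempty (FibreFunctor F C L)

/-- A neutral Tannakian category over `F`: there is a fibre functor over `F` itself. -/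
structure IsNeutralTannakian (F : Type v) [Field F] (C : Type u) [Category.{v} C] [Preadditive C]
    [Linear F C] [MonoidalCategory C] [SymmetricCategory C] : Prop extends IsTannakian F C where
  exists_neutral : Nonempty (FibreFunctor F C F)

end Tannakian

/-! ### The scalar extension of a category and its tensor product -/

section ScalarExt

variable (F F' : Type v) [Field F] [Field F'] [Algebra F F']
variable (T : Type u) [Category.{v} T] [Abelian T] [Linear F T]

/-- The scalar extension `T ⊗_F F'`: the full subcategory of `F'`-modules of finite length. -/
abbrev ScalarExt : Type (max u (v + 1)) :=
  (isFiniteLength (IndModule F F' T)).FullSubcategory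

/-- The functor `t` from `T` to `F'`-modules in `Ind T`. -/
def toIndModule : T ⥤ IndModule F F' T :=
  Ind.yoneda ⋙ extendScalars F F' T

variable {F F' T}

/-- The functor `t : T ⥤ T ⊗_F F'`, once `t(X)` is known to be of finite length. -/
def toScalarExt (ht : ∀ X : T, isFiniteLength _ ((toIndModule F F' T).obj X)) :
    T ⥤ ScalarExt F F' T :=
  ObjectProperty.lift _ (toIndModule F F' T) ht

open MonoidalCategory

/-- A tensor product on `T ⊗_F F'` is the scalar extension of the one on `T`: it is right exact and
`F'`-bilinear and extends the tensor product of `T`, with its constraints, along `t`. -/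
class IsScalarExtTensor [MonoidalCategory T] [SymmetricCategory T]
    (ht : ∀ X : T, isFiniteLength _ ((toIndModule F F' T).obj X))
    [MonoidalCategory (ScalarExt F F' T)] [SymmetricCategory (ScalarExt F F' T)] : Prop
    extends MonoidalPreadditive (ScalarExt F F' T), MonoidalLinear F' (ScalarExt F F' T) where
  tensorLeft_rightExact (X : ScalarExt F F' T) : PreservesFiniteColimits (tensorLeft X)
  tensorRight_rightExact (X : ScalarExt F F' T) : PreservesFiniteColimits (tensorRight X)
  /-- `t` is a symmetric strong monoidal functor -/
  braided : Nonempty (toScalarExt ht).Braided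

end ScalarExt

end ScalarExtension

end

/-! The proof works with sections. An `F'`-module `M` in `Ind T` is determined by the presheaf `X ↦
Hom(X, M)` of `F'`-vector spaces on `T`. Such presheaves are separated and glue along epimorphisms
of `T` (`LexPresheaf`, `elems`). Morphisms of modules are the same as morphisms of these presheaves
(`elMap_injective`, `exists_hom_of_lexHom`), and epimorphisms are the locally surjective morphisms
(`locSurj_of_epi`, `epi_of_locSurj`). One has `t(X)(Z) = F' ⊗ Hom(Z, X)`, and a morphism from `t(X)`
to any such presheaf `H` is an element of `H(X)` (`tDesc`, `t_hom_ext`).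

Finite length. For `X` simple, a submodule of `t(X)` is determined by its sections over `X`, a
subspace of the finite-dimensional space `F' ⊗ End(X)`. The general case follows by dévissage, since
`t` is exact (`isFiniteLength_tObj`). Conversely, every module of finite length is the cokernel of
some `t(X₁) ⟶ t(X₀)` (`exists_presentation`).

Tensor product. `M ⊗ N` is the module that represents bimorphisms `M(X) × N(Y) → H(X ⊗ Y)`. For
`t(X)` and `t(Y)` it is `t(X ⊗ Y)`, and presentations give the general case (`exists_universal`).
All constraints and their axioms are read off from those of `T` on pure tensors. Conversely, in any
structure as in the theorem, right exactness and the compatibility with `t` force the tensor product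
to have this universal property (`tensorBimor_isUniversal`).

Rigidity is the main point. An object of `ScalarExt` is the cokernel of a morphism `f` between
dualisable objects. Let `Λⁿf` be the antisymmetrized power of `f`. The fibre functor of `T` embeds
the situation into vector spaces, where antisymmetrization kills high tensor powers in every
characteristic, so `Λⁿf = 0` for large `n`. If `Λᵏ⁺¹f = 0` and `Λᵏf ≠ 0`, then the cokernel of `f`
is flat (`flat_cokernel_of_altMap`; this uses that the unit is simple). A flat cokernel of
dualisable objects is dualisable, its dual being the kernel of the transpose of `f`
(`dualisable_cokernel`).

Fibre functors. A fibre functor `ω` of `T` over an extension `K` of `F'` extends to `ScalarExt`: the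
value at `M` is the vector space that represents `V ↦ Hom(M, Hom(ω(-), V))`. The extension is right
exact by construction and is a tensor functor by the universal property of `M ⊗ N`. Left exactness
and faithfulness then follow from rigidity (`preservesFiniteLimits_of_dualisable`,
`faithful_of_dualisable`). For (a), `K` is a field containing both `F'` and the field of a given
fibre functor; for (b), `K = F'`. -/

noncomputable section
namespace ScalarExtension

attribute [local instance] indPreadditive indLinear

/-! ### The category of ind-objects: abelian structure, compactness of representables, local
surjectivity of epimorphisms. -/

section IndCategory

variable {T : Type u} [Category.{v} T] [Abelian T]

instance indYoneda_additive : (Ind.yoneda : T ⥤ Ind T).Additive := by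
  have : PreservesLimitsOfShape (Discrete WalkingPair) (Ind.yoneda : T ⥤ Ind T) :=
    inferInstance
  exact Functor.additive_of_preserves_binary_products _

theorem inclusion_map_indScalar_app {F : Type v} [Field F] [Linear F T] (a : F) (M : Ind T)
    (V : Tᵒᵖ) (s : ((Ind.inclusion T).obj M).obj V) :
    ((Ind.inclusion T).map (indScalar a M)).app V s =
      ((Ind.inclusion T).obj M).map (a • 𝟙 V.unop).op s := by
  have h := congrArg (fun φ => (φ.app V).hom s) (map_indScalar a M)
  exact h

/-- On the presheaf `Hom(-, U)` the scalar acts by precomposition with `a • 𝟙 V`. By bilinearity of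
composition this equals postcomposition with `a • 𝟙 U`. -/
theorem indScalar_yoneda {F : Type v} [Field F] [Linear F T] (a : F) (U : T) :
    indScalar a (Ind.yoneda.obj U) = Ind.yoneda.map (a • 𝟙 U) := by
  apply (Ind.inclusion T).map_injective
  ext V s
  refine (inclusion_map_indScalar_app a _ V s).trans ?_
  let e := Ind.yonedaCompInclusion (C := T)
  obtain ⟨g, rfl⟩ : ∃ g, (e.inv.app U).app V g = s :=
    ⟨(e.hom.app U).app V s, by simp [← NatTrans.comp_app_apply]⟩
  have h1 := congrArg (fun φ => φ.app V g) (e.inv.naturality (a • 𝟙 U))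
  have h2 := NatTrans.naturality_apply (e.inv.app U) (a • 𝟙 V.unop).op g
  refine h2.symm.trans (Eq.trans ?_ h1)
  have h3 : (a • 𝟙 V.unop) ≫ g = g ≫ (a • 𝟙 U) := by simp
  exact congrArg (fun t => (e.inv.app U).app V t) h3

instance indYoneda_linear {F : Type v} [Field F] [Linear F T] :
    (Ind.yoneda : T ⥤ Ind T).Linear F where
  map_smul {X Y} f a := by
    show _ = Ind.yoneda.map f ≫ indScalar a _
    rw [indScalar_yoneda, ← Functor.map_comp]
    simp

instance ind_hasZeroObject : HasZeroObject (Ind T) := hasZeroObject_of_hasTerminal_object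

/-- The additive structure of `Ind T` extends to an abelian structure. -/
theorem ind_isIso_coimageImageComparison {X Y : Ind T} (f : X ⟶ Y) :
    IsIso (Abelian.coimageImageComparison f) := by
  -- Up to isomorphism `f` is a filtered colimit of morphisms of `T`. The comparison is an
  -- isomorphism in the abelian category `I ⥤ T`, and `Ind.lim I` preserves the kernels and
  -- cokernels involved.
  obtain ⟨I, _, _, F, G, ϕ, ⟨i⟩⟩ := Ind.exists_nonempty_arrow_mk_iso_ind_lim (f := f)
  let i' : Arrow.mk (Abelian.coimageImageComparison f) ≅
      Arrow.mk (Abelian.coimageImageComparison ((Ind.lim I).map ϕ)) :=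
    Abelian.coimageImageComparisonFunctor.mapIso i
  have : (Ind.lim I : (I ⥤ T) ⥤ Ind T).PreservesZeroMorphisms :=
    Functor.preservesZeroMorphisms_of_preserves_initial_object
  let j : Arrow.mk ((Ind.lim I).map (Abelian.coimageImageComparison ϕ)) ≅
      Arrow.mk (Abelian.coimageImageComparison ((Ind.lim I).map ϕ)) :=
    (Abelian.PreservesCoimageImageComparison.iso (Ind.lim I) ϕ)
  rw [Arrow.isIso_iff_isIso_of_isIso i'.hom, Arrow.isIso_iff_isIso_of_isIso j.inv]
  infer_instance

variable (T) in
/-- `Ind T` is abelian. -/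
@[reducible]
def indAbelian : Abelian (Ind T) :=
  haveI := fun (X Y : Ind T) (f : X ⟶ Y) => ind_isIso_coimageImageComparison f
  .ofCoimageImageComparisonIsIso

/-- Sections of an ind-object over `X` are the morphisms from `X` to it. -/
def indSectionsIso (X : T) : coyoneda.obj (Opposite.op (Ind.yoneda.obj X)) ≅
    Ind.inclusion T ⋙ (evaluation Tᵒᵖ (Type v)).obj (Opposite.op X) :=
  NatIso.ofComponents (fun M =>
    ((Ind.inclusion.fullyFaithful (C := T)).homEquiv.trans
      ((Iso.homFromEquiv (Ind.yonedaCompInclusion.app X)).trans yonedaEquiv)).toIso)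
    (fun {M N} f => by
      ext x
      simp [yonedaEquiv, Functor.FullyFaithful.homEquiv])

/-- Objects of `T` are compact in `Ind T`: the functor they corepresent is evaluation of presheaves,
and filtered colimits of ind-objects are computed as presheaves. -/
instance preservesColimitsOfShape_coyoneda_indYoneda (X : T) (J : Type v) [SmallCategory J]
    [IsFiltered J] :
    PreservesColimitsOfShape J (coyoneda.obj (Opposite.op (Ind.yoneda.obj X))) :=
  preservesColimitsOfShape_of_natIso (indSectionsIso X).symm

omit [Abelian T] in
theorem exists_factor_of_isColimit {J : Type v} [SmallCategory J] [IsFiltered J] {K : J ⥤ Ind T}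
    {c : Cocone K} (hc : IsColimit c) {X : T} (b : Ind.yoneda.obj X ⟶ c.pt) :
    ∃ (j : J) (b' : Ind.yoneda.obj X ⟶ K.obj j), b' ≫ c.ι.app j = b :=
  Types.jointly_surjective_of_isColimit
    (isColimitOfPreserves (coyoneda.obj (Opposite.op (Ind.yoneda.obj X))) hc) b

omit [Abelian T] in
theorem exists_eq_of_isColimit {J : Type v} [SmallCategory J] [IsFiltered J] {K : J ⥤ Ind T}
    {c : Cocone K} (hc : IsColimit c) {X : T} {j : J} (b b' : Ind.yoneda.obj X ⟶ K.obj j)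
    (h : b ≫ c.ι.app j = b' ≫ c.ι.app j) :
    ∃ (j' : J) (f : j ⟶ j'), b ≫ K.map f = b' ≫ K.map f :=
  (Types.FilteredColimit.isColimit_eq_iff'
    (isColimitOfPreserves (coyoneda.obj (Opposite.op (Ind.yoneda.obj X))) hc) b b').1 h

omit [Abelian T] in
-- Levelwise presentations reduce questions about one morphism of ind-objects to a natural
-- transformation of diagrams in `T`.
theorem exists_presentation_of_hom {A B : Ind T} (f : A ⟶ B) :
    ∃ (I : Type v) (_ : SmallCategory I) (_ : IsFiltered I) (F G : I ⥤ T) (φ : F ⟶ G)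
      (p : colimit (F ⋙ Ind.yoneda) ≅ A) (q : colimit (G ⋙ Ind.yoneda) ≅ B),
      colimMap (Functor.whiskerRight φ Ind.yoneda) ≫ q.hom = p.hom ≫ f := by
  obtain ⟨I, _, _, F, G, φ, ⟨i⟩⟩ := Ind.exists_nonempty_arrow_mk_iso_ind_lim (f := f)
  exact ⟨I, inferInstance, inferInstance, F, G, φ, (Arrow.leftFunc.mapIso i).symm,
    (Arrow.rightFunc.mapIso i).symm, i.inv.w.symm⟩

/-- Epimorphisms of ind-objects are locally surjective. -/
theorem exists_lift_of_epi {A B : Ind T} (f : A ⟶ B) [Epi f] {X : T} (b : Ind.yoneda.obj X ⟶ B) :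
    ∃ (Z : T) (e : Z ⟶ X) (_ : Epi e) (a : Ind.yoneda.obj Z ⟶ A),
      a ≫ f = Ind.yoneda.map e ≫ b := by
  obtain ⟨I, _, _, F, G, φ, p, q, hpq⟩ := exists_presentation_of_hom f
  have hz : (Ind.lim I : (I ⥤ T) ⥤ Ind T).PreservesZeroMorphisms :=
    Functor.preservesZeroMorphisms_of_preserves_initial_object
  have hepi : Epi ((Ind.lim I).map φ) := by
    have : (Ind.lim I).map φ = p.hom ≫ f ≫ q.inv := by
      rw [← reassoc_of% hpq, q.hom_inv_id, Category.comp_id]; rfl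
    rw [this]
    exact (inferInstance : Epi (p.hom ≫ f ≫ q.inv))
  -- The levelwise cokernel need not vanish at any stage; only its colimit does, because `f` is an
  -- epimorphism. Hence a section of the cokernel at one stage dies at a later one.
  have hcok : IsZero ((Ind.lim I).obj (cokernel φ)) :=
    (isZero_cokernel_of_epi _).of_iso (PreservesCokernel.iso (Ind.lim I) φ)
  -- By compactness `b` comes from some `G.obj j`. At a later stage `j'` its image in the cokernel
  -- of `φ` is zero, and exactness in `T` at `j'` lifts it to `F.obj j'` after an epimorphism `Z ⟶
  -- X`.
  obtain ⟨j, g, hg⟩ := exists_factor_of_isColimit (colimit.isColimit (G ⋙ Ind.yoneda)) (b ≫ q.inv)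
  obtain ⟨g, rfl⟩ := Ind.yoneda.map_surjective g
  obtain ⟨j', t, ht⟩ := exists_eq_of_isColimit (colimit.isColimit (cokernel φ ⋙ Ind.yoneda))
    (X := X) (Ind.yoneda.map (g ≫ (cokernel.π φ).app j)) 0 (hcok.eq_of_tgt _ _)
  have ht' : (g ≫ G.map t) ≫ (cokernel.π φ).app j' = 0 := by
    apply (Ind.yoneda (C := T)).map_injective
    rw [zero_comp] at ht
    rw [Functor.map_zero, Category.assoc, NatTrans.naturality, ← Category.assoc, Functor.map_comp]
    exact ht
  have hex : (ShortComplex.mk (φ.app j') ((cokernel.π φ).app j')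
      (by rw [← NatTrans.comp_app, cokernel.condition]; rfl)).Exact :=
    (ShortComplex.exact_cokernel φ).map ((evaluation I T).obj j')
  obtain ⟨Z, e, he, x, hx⟩ := (ShortComplex.exact_iff_exact_up_to_refinements _).1 hex _ ht'
  dsimp only at x hx
  refine ⟨Z, e, he, Ind.yoneda.map x ≫ colimit.ι (F ⋙ Ind.yoneda) j' ≫ p.hom, ?_⟩
  have hι : colimit.ι (F ⋙ Ind.yoneda) j' ≫ colimMap (Functor.whiskerRight φ Ind.yoneda) =
      Ind.yoneda.map (φ.app j') ≫ colimit.ι (G ⋙ Ind.yoneda) j' :=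
    ι_colimMap (Functor.whiskerRight φ Ind.yoneda) j'
  have hg' : Ind.yoneda.map g ≫ colimit.ι (G ⋙ Ind.yoneda) j = b ≫ q.inv := hg
  have ht2 : Ind.yoneda.map (G.map t) ≫ colimit.ι (G ⋙ Ind.yoneda) j' =
      colimit.ι (G ⋙ Ind.yoneda) j := colimit.w (G ⋙ Ind.yoneda) t
  rw [Category.assoc, Category.assoc, ← hpq, reassoc_of% hι, ← Functor.map_comp_assoc, ← hx,
    Functor.map_comp_assoc, Functor.map_comp_assoc, reassoc_of% ht2, reassoc_of% hg',
    q.inv_hom_id, Category.comp_id]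

/-- A coproduct is the filtered colimit of its finite subcoproducts, so by compactness a section
lives in one of them. There the identity is the sum of the projections followed by the inclusions.
-/
theorem exists_sum_of_hom_sigma {B : Type v} {M : Ind T} {Z : T}
    (b : Ind.yoneda.obj Z ⟶ ∐ fun _ : B => M) :
    ∃ (S : Finset B) (g : B → (Ind.yoneda.obj Z ⟶ M)),
      b = ∑ i ∈ S, g i ≫ Sigma.ι (fun _ : B => M) i := by
  classical
  obtain ⟨S, b', rfl⟩ := exists_factor_of_isColimit
    (CoproductsFromFiniteFiltered.isColimitFiniteSubproductsCocone (fun _ : B => M)) b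
  let ι' := fun x : S => Sigma.ι (fun _ : S => M) x
  let π' := fun x : S => Sigma.desc (fun y : S => if y = x then 𝟙 M else 0)
  have hid : (𝟙 (∐ fun _ : S => M)) = ∑ x : S, π' x ≫ ι' x := by
    refine Sigma.hom_ext _ _ fun y => ?_
    rw [Category.comp_id, Preadditive.comp_sum, Finset.sum_eq_single y]
    · simp [ι', π']
    · intro x _ hx
      simp [ι', π', hx.symm]
    · simp
  let b'' : Ind.yoneda.obj Z ⟶ ∐ fun _ : S => M := b'
  let d : (∐ fun _ : S => M) ⟶ ∐ fun _ : B => M :=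
    Sigma.desc fun s => Sigma.ι (fun _ : B => M) s.1.as
  have hb : b'' ≫ d = ∑ x : S, (b'' ≫ π' x) ≫ Sigma.ι (fun _ : B => M) x.1.as := by
    conv_lhs => rw [← Category.id_comp d, hid, Preadditive.sum_comp, Preadditive.comp_sum]
    refine Finset.sum_congr rfl fun x _ => ?_
    simp only [Category.assoc]
    congr 2
    exact Sigma.ι_desc _ _
  refine ⟨S.image Discrete.as, fun i => if h : Discrete.mk i ∈ S then b'' ≫ π' ⟨_, h⟩ else 0, ?_⟩
  refine hb.trans ?_
  rw [Finset.sum_image (fun x _ y _ h => Discrete.ext h), ← Finset.sum_coe_sort S]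
  refine Finset.sum_congr rfl fun x _ => ?_
  beta_reduce
  rw [dif_pos (show Discrete.mk x.1.as ∈ S from x.2)]

end IndCategory

/-! ### The abelian category of `F'`-modules in `Ind T`. -/

section IndModuleAbelian

variable {F F' : Type v} [Field F] [Field F'] [Algebra F F']
variable {T : Type u} [Category.{v} T] [Abelian T] [Linear F T]

namespace IndModule

/-- A morphism of ind-objects commuting with endomorphisms transports the action. -/
def ofAction (M : Ind T) (ρ : F' → (M ⟶ M)) (h1 : ρ 1 = 𝟙 M)
    (hmul : ∀ a b, ρ (a * b) = ρ b ≫ ρ a) (hadd : ∀ a b, ρ (a + b) = ρ a + ρ b)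
    (hsmul : ∀ (r : F) a, ρ (r • a) = r • ρ a) : IndModule F F' T where
  obj := M
  act := AlgHom.ofLinearMap
    { toFun := ρ
      map_add' := hadd
      map_smul' := hsmul } h1 hmul

theorem smulHom_smul (X : IndModule F F' T) (r : F) (a : F') :
    X.smulHom (r • a) = r • X.smulHom a := map_smul X.act r a

section Kernel

variable {M N : IndModule F F' T} (f : M ⟶ N)

theorem mono_of_mono_hom (h : Mono (Hom.hom f)) : Mono f :=
  ⟨fun _ _ hab => hom_ext ((cancel_mono (Hom.hom f)).1 (congrArg Hom.hom hab))⟩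

theorem epi_of_epi_hom (h : Epi (Hom.hom f)) : Epi f :=
  ⟨fun _ _ hab => hom_ext ((cancel_epi (Hom.hom f)).1 (congrArg Hom.hom hab))⟩

/-- The kernel of a homomorphism of `F'`-modules. -/
def kernelObj : IndModule F F' T :=
  ofAction (kernel (Hom.hom f))
    (fun a => kernel.map (Hom.hom f) (Hom.hom f) (M.smulHom a) (N.smulHom a) (f.comm a).symm)
    (by simp [smulHom_one])
    (fun _ _ => by simp [← cancel_mono (kernel.ι (Hom.hom f)), smulHom_mul])
    (fun _ _ => by simp [← cancel_mono (kernel.ι (Hom.hom f)), smulHom_add])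
    (fun _ _ => by simp [← cancel_mono (kernel.ι (Hom.hom f)), smulHom_smul])

/-- The inclusion of the kernel. -/
def kernelι : kernelObj f ⟶ M where
  hom := kernel.ι (Hom.hom f)
  comm a := by
    exact kernel.lift_ι _ _ _

theorem kernelι_comp : kernelι f ≫ f = 0 := hom_ext (kernel.condition (Hom.hom f))

instance mono_kernelι : Mono (kernelι f) :=
  mono_of_mono_hom _ (inferInstanceAs (Mono (kernel.ι (Hom.hom f))))

/-- The kernel is a kernel. -/
def kernelIsLimit : IsLimit (KernelFork.ofι (kernelι f) (kernelι_comp f)) :=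
  KernelFork.IsLimit.ofι' _ _ fun {W} g hg =>
    ⟨{ hom := kernel.lift (Hom.hom f) (Hom.hom g) (congrArg Hom.hom hg)
       comm := fun a => by
          have h : W.smulHom a ≫ kernel.lift (Hom.hom f) (Hom.hom g) (congrArg Hom.hom hg) =
              kernel.lift (Hom.hom f) (Hom.hom g) (congrArg Hom.hom hg) ≫
                kernel.map (Hom.hom f) (Hom.hom f) (M.smulHom a) (N.smulHom a) (f.comm a).symm := by
            simp [← cancel_mono (kernel.ι (Hom.hom f)), g.comm]
          exact h }, hom_ext (kernel.lift_ι _ _ _)⟩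

/-- The cokernel of a homomorphism of `F'`-modules. -/
def cokernelObj : IndModule F F' T :=
  ofAction (cokernel (Hom.hom f))
    (fun a => cokernel.map (Hom.hom f) (Hom.hom f) (M.smulHom a) (N.smulHom a) (f.comm a).symm)
    (by simp [smulHom_one])
    (fun _ _ => by simp [← cancel_epi (cokernel.π (Hom.hom f)), smulHom_mul])
    (fun _ _ => by simp [← cancel_epi (cokernel.π (Hom.hom f)), smulHom_add])
    (fun _ _ => by simp [← cancel_epi (cokernel.π (Hom.hom f)), smulHom_smul])

/-- The projection to the cokernel. -/
def cokernelπ : N ⟶ cokernelObj f where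
  hom := cokernel.π (Hom.hom f)
  comm a := by
    exact (cokernel.π_desc _ _ _).symm

theorem comp_cokernelπ : f ≫ cokernelπ f = 0 := hom_ext (cokernel.condition (Hom.hom f))

instance epi_cokernelπ : Epi (cokernelπ f) :=
  epi_of_epi_hom _ (inferInstanceAs (Epi (cokernel.π (Hom.hom f))))

/-- The cokernel is a cokernel. -/
def cokernelIsColimit : IsColimit (CokernelCofork.ofπ (cokernelπ f) (comp_cokernelπ f)) :=
  CokernelCofork.IsColimit.ofπ' _ _ fun {W} g hg =>
    ⟨{ hom := cokernel.desc (Hom.hom f) (Hom.hom g) (congrArg Hom.hom hg)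
       comm := fun a => by
          have h : cokernel.map (Hom.hom f) (Hom.hom f) (M.smulHom a) (N.smulHom a) (f.comm a).symm ≫
              cokernel.desc (Hom.hom f) (Hom.hom g) (congrArg Hom.hom hg) =
                cokernel.desc (Hom.hom f) (Hom.hom g) (congrArg Hom.hom hg) ≫ W.smulHom a := by
            simp [← cancel_epi (cokernel.π (Hom.hom f)), g.comm]
          exact h }, hom_ext (cokernel.π_desc _ _ _)⟩

instance hasKernels : HasKernels (IndModule F F' T) where
  has_limit f := ⟨⟨_, kernelIsLimit f⟩⟩

instance hasCokernels : HasCokernels (IndModule F F' T) where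
  has_colimit f := ⟨⟨_, cokernelIsColimit f⟩⟩

/-- Kernels and cokernels of modules have those of `Ind T` as underlying objects, so being mono or
epi can be tested on the underlying morphism. This lets normality be inherited from `Ind T`. -/
instance mono_hom [Mono f] : Mono (Hom.hom f) := by
  have : kernelι f = 0 := by
    rw [← cancel_mono f, kernelι_comp, zero_comp]
  exact Preadditive.mono_of_kernel_zero (congrArg Hom.hom this)

instance epi_hom [Epi f] : Epi (Hom.hom f) := by
  have : cokernelπ f = 0 := by
    rw [← cancel_epi f, comp_cokernelπ, comp_zero]
  exact Preadditive.epi_of_cokernel_zero (congrArg Hom.hom this)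

attribute [local instance] indAbelian

/-- A monomorphism is the kernel of its cokernel. -/
def isLimitOfMono [Mono f] : IsLimit (KernelFork.ofι f (comp_cokernelπ f)) :=
  KernelFork.IsLimit.ofι' f (comp_cokernelπ f) fun {W} g hg =>
    let l := KernelFork.IsLimit.lift' (Abelian.monoIsKernelOfCokernel _
      (cokernelIsCokernel (Hom.hom f))) (Hom.hom g) (congrArg Hom.hom hg)
    have hl : l.1 ≫ Hom.hom f = Hom.hom g := l.2
    ⟨⟨l.1, fun a => by
      rw [← cancel_mono (Hom.hom f), Category.assoc, Category.assoc, f.comm, hl,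
        reassoc_of% hl, g.comm]⟩, hom_ext hl⟩

/-- An epimorphism is the cokernel of its kernel. -/
def isColimitOfEpi [Epi f] : IsColimit (CokernelCofork.ofπ f (kernelι_comp f)) :=
  CokernelCofork.IsColimit.ofπ' f (kernelι_comp f) fun {W} g hg =>
    let l := CokernelCofork.IsColimit.desc' (Abelian.epiIsCokernelOfKernel _
      (kernelIsKernel (Hom.hom f))) (Hom.hom g) (congrArg Hom.hom hg)
    have hl : Hom.hom f ≫ l.1 = Hom.hom g := l.2
    ⟨⟨l.1, fun a => by
      rw [← cancel_epi (Hom.hom f), reassoc_of% hl, ← reassoc_of% (f.comm a), hl, g.comm]⟩,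
      hom_ext hl⟩

end Kernel

attribute [local instance] indAbelian in
open ZeroObject in
instance hasFiniteProducts : HasFiniteProducts (IndModule F F' T) := by
  have : HasBinaryBiproducts (IndModule F F' T) := ⟨fun M N => by
    let P : IndModule F F' T := ofAction (M.obj ⊞ N.obj)
      (fun a => biprod.map (M.smulHom a) (N.smulHom a))
      (by ext <;> simp [smulHom_one]) (fun _ _ => by ext <;> simp [smulHom_mul])
      (fun _ _ => by ext <;> simp [smulHom_add]) (fun _ _ => by ext <;> simp [smulHom_smul])
    have hfst (a : F') : biprod.map (M.smulHom a) (N.smulHom a) ≫ biprod.fst =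
      biprod.fst ≫ M.smulHom a := by simp
    have hsnd (a : F') : biprod.map (M.smulHom a) (N.smulHom a) ≫ biprod.snd =
      biprod.snd ≫ N.smulHom a := by simp
    have hinl (a : F') : M.smulHom a ≫ biprod.inl =
      biprod.inl ≫ biprod.map (M.smulHom a) (N.smulHom a) := by simp
    have hinr (a : F') : N.smulHom a ≫ biprod.inr =
      biprod.inr ≫ biprod.map (M.smulHom a) (N.smulHom a) := by simp
    let b : BinaryBicone M N :=
      { pt := P
        fst := ⟨biprod.fst, fun a => by exact hfst a⟩
        snd := ⟨biprod.snd, fun a => by exact hsnd a⟩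
        inl := ⟨biprod.inl, fun a => by exact hinl a⟩
        inr := ⟨biprod.inr, fun a => by exact hinr a⟩
        inl_fst := hom_ext biprod.inl_fst
        inl_snd := hom_ext biprod.inl_snd
        inr_fst := hom_ext biprod.inr_fst
        inr_snd := hom_ext biprod.inr_snd }
    exact hasBinaryBiproduct_of_total b (hom_ext biprod.total)⟩
  have : HasZeroObject (IndModule F F' T) := by
    let Z : IndModule F F' T := ofAction (0 : Ind T) (fun _ => 0) (by simp) (by simp) (by simp) (by simp)
    have h : 𝟙 (0 : Ind T) = 0 := (isZero_zero _).eq_of_src _ _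
    exact ⟨Z, (IsZero.iff_id_eq_zero _).2 (hom_ext h)⟩
  have : HasTerminal (IndModule F F' T) := HasZeroObject.hasTerminal
  exact hasFiniteProducts_of_has_binary_and_terminal

instance abelian : Abelian (IndModule F F' T) where
  normalMonoOfMono f := ⟨⟨_, _, _, isLimitOfMono f⟩⟩
  normalEpiOfEpi f := ⟨⟨_, _, _, isColimitOfEpi f⟩⟩

end IndModule

end IndModuleAbelian
end ScalarExtension

end

/-! ### Modules as presheaves on `T` that are sheaves for epimorphisms. -/

noncomputable section
namespace ScalarExtension

attribute [local instance] indPreadditive indLinear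

variable (F F' : Type v) [Field F] [Field F'] [Algebra F F']
variable (T : Type u) [Category.{v} T] [Abelian T] [Linear F T]

/-- An `F`-linear presheaf of `F'`-vector spaces on `T` which is a sheaf for epimorphisms. -/
structure LexPresheaf where
  obj : T → Type v
  [addCommGroup : ∀ X, AddCommGroup (obj X)]
  [module : ∀ X, Module F' (obj X)]
  map : ∀ {X Y : T}, (X ⟶ Y) → obj Y →ₗ[F'] obj X
  map_id : ∀ {X : T} (x : obj X), map (𝟙 X) x = x
  map_comp : ∀ {X Y Z : T} (f : X ⟶ Y) (g : Y ⟶ Z) (x : obj Z), map (f ≫ g) x = map f (map g x)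
  map_add : ∀ {X Y : T} (f g : X ⟶ Y) (x : obj Y), map (f + g) x = map f x + map g x
  map_smul : ∀ {X Y : T} (a : F) (f : X ⟶ Y) (x : obj Y),
    map (a • f) x = algebraMap F F' a • map f x
  sep : ∀ {X Y : T} (e : X ⟶ Y) [Epi e] (y : obj Y), map e y = 0 → y = 0
  glue : ∀ {X Y : T} (e : X ⟶ Y) [Epi e] (x : obj X),
    (∀ (W : T) (k : W ⟶ X), k ≫ e = 0 → map k x = 0) → ∃ y, map e y = x

attribute [instance] LexPresheaf.addCommGroup LexPresheaf.module

namespace LexPresheaf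

variable {F F' T}

/-- A morphism of presheaves. -/
@[ext]
structure Hom (M N : LexPresheaf F F' T) where
  app : ∀ X : T, M.obj X →ₗ[F'] N.obj X
  naturality : ∀ {X Y : T} (f : X ⟶ Y) (y : M.obj Y), app X (M.map f y) = N.map f (app Y y)

theorem Hom.ext_apply {M N : LexPresheaf F F' T} {α β : M.Hom N}
    (h : ∀ X x, α.app X x = β.app X x) : α = β :=
  Hom.ext (funext fun X => LinearMap.ext (h X))

/-- Composition. -/
def Hom.comp {M N P : LexPresheaf F F' T} (α : M.Hom N) (β : N.Hom P) : M.Hom P where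
  app X := (β.app X).comp (α.app X)
  naturality f y := by simp [α.naturality, β.naturality]

@[simp]
theorem Hom.comp_app {M N P : LexPresheaf F F' T} (α : M.Hom N) (β : N.Hom P) (X : T)
    (x : M.obj X) : (α.comp β).app X x = β.app X (α.app X x) := rfl

theorem map_zero_hom (M : LexPresheaf F F' T) {X Y : T} (x : M.obj Y) :
    M.map (0 : X ⟶ Y) x = 0 := by
  have := M.map_smul (0 : F) (0 : X ⟶ Y) x
  simpa using this

theorem sep' (M : LexPresheaf F F' T) {X Y : T} (e : X ⟶ Y) [Epi e] {y y' : M.obj Y}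
    (h : M.map e y = M.map e y') : y = y' := by
  rw [← sub_eq_zero]
  exact M.sep e _ (by rw [_root_.map_sub, h, sub_self])

/-- A morphism is locally surjective. -/
def Hom.LocSurj {M N : LexPresheaf F F' T} (α : M.Hom N) : Prop :=
  ∀ (X : T) (y : N.obj X), ∃ (Z : T) (e : Z ⟶ X) (_ : Epi e) (x : M.obj Z),
    α.app Z x = N.map e y

theorem exists_common_refinement {X Z Z' : T} (e : Z ⟶ X) (e' : Z' ⟶ X) [Epi e] [Epi e'] :
    ∃ (W : T) (p : W ⟶ Z) (p' : W ⟶ Z') (_ : Epi p) (_ : Epi p'), p ≫ e = p' ≫ e' :=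
  ⟨pullback e e', pullback.fst e e', pullback.snd e e', inferInstance, inferInstance,
    pullback.condition⟩

/-- Locally surjective morphisms are epimorphisms because the target is separated. -/
theorem Hom.eq_of_locSurj {M N P : LexPresheaf F F' T} {p : M.Hom N} (hp : p.LocSurj)
    {α β : N.Hom P} (h : p.comp α = p.comp β) : α = β := by
  refine ext_apply fun X y => ?_
  obtain ⟨Z, e, _, x, hx⟩ := hp X y
  refine P.sep' e ?_
  rw [← α.naturality, ← β.naturality, ← hx]
  exact LinearMap.congr_fun (congrFun (congrArg Hom.app h) Z) x

section Descent

variable {M N P : LexPresheaf F F' T} {p : M.Hom N} (hp : p.LocSurj) (α : M.Hom P)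
  (h : ∀ X x, p.app X x = 0 → α.app X x = 0)

include hp h in
-- Lift `y` through `p` after an epimorphism `e` and apply `α`. The result satisfies the gluing
-- condition because the restriction of the lift along any morphism killed by `e` lies in the kernel
-- of `p`, which `α` kills. Two local lifts are compared on a pullback, so the glued section works
-- for all of them.
theorem exists_descend (X : T) (y : N.obj X) : ∃ z : P.obj X, ∀ (Z : T) (e : Z ⟶ X) (x : M.obj Z),
    p.app Z x = N.map e y → α.app Z x = P.map e z := by
  obtain ⟨Z, e, _, x, hx⟩ := hp X y
  obtain ⟨z, hz⟩ := P.glue e (α.app Z x) fun W k hk => by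
    rw [← α.naturality]
    exact h _ _ (by rw [p.naturality, hx, ← N.map_comp, hk, N.map_zero_hom])
  refine ⟨z, fun Z' e' x' hx' => ?_⟩
  refine P.sep' (pullback.fst e' e) ?_
  rw [← P.map_comp, pullback.condition, P.map_comp, hz, ← α.naturality, ← α.naturality,
    ← sub_eq_zero, ← _root_.map_sub]
  refine h _ _ ?_
  rw [_root_.map_sub, p.naturality, p.naturality, hx, hx', ← N.map_comp, ← N.map_comp,
    pullback.condition, sub_self]

include hp h in
/-- A morphism which kills the kernel of a locally surjective morphism descends. -/
theorem exists_desc : ∃ β : N.Hom P, p.comp β = α := by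
  choose β hβ using exists_descend hp α h
  refine ⟨⟨fun X => { toFun := β X, map_add' := fun y y' => ?_, map_smul' := fun a y => ?_ },
    fun {X Y} f y => ?_⟩, Hom.ext_apply fun X x => ?_⟩
  · obtain ⟨Z, e, _, x, hx⟩ := hp X y
    obtain ⟨Z', e', _, x', hx'⟩ := hp X y'
    obtain ⟨W, q, q', _, _, hq⟩ := exists_common_refinement e e'
    have : Epi (q ≫ e) := epi_comp _ _
    refine P.sep' (q ≫ e) ?_
    have h1 : p.app W (M.map q x) = N.map (q ≫ e) y := by
      rw [p.naturality, hx, N.map_comp]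
    have h2 : p.app W (M.map q' x') = N.map (q ≫ e) y' := by
      rw [p.naturality, hx', hq, N.map_comp]
    rw [_root_.map_add, ← hβ _ _ _ _ _ h1, ← hβ _ _ _ _ _ h2, ← _root_.map_add]
    exact (hβ _ _ _ _ _ (by rw [_root_.map_add, h1, h2, _root_.map_add])).symm
  · obtain ⟨Z, e, _, x, hx⟩ := hp X y
    refine P.sep' e ?_
    rw [RingHom.id_apply, _root_.map_smul, ← hβ _ _ _ _ _ hx, ← _root_.map_smul]
    exact (hβ _ _ _ _ _ (by rw [_root_.map_smul, hx, _root_.map_smul])).symm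
  · obtain ⟨Z, e, _, x, hx⟩ := hp X (N.map f y)
    refine P.sep' e ?_
    change P.map e (β X _) = P.map e (P.map f (β Y y))
    rw [← hβ _ _ _ _ _ hx, ← P.map_comp]
    exact hβ _ _ _ _ _ (by rw [hx, N.map_comp])
  · have := hβ X (p.app X x) X (𝟙 X) x (N.map_id _).symm
    rw [P.map_id] at this
    exact this.symm

end Descent

end LexPresheaf

variable {F F' T}

/-- The sections of an `F'`-module over an object of `T`. -/
def Sections (M : IndModule F F' T) (X : T) : Type v := Ind.yoneda.obj X ⟶ M.obj

namespace Sections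

variable {M N P : IndModule F F' T}

/-- A morphism from a representable ind-object, as a section. -/
def mk {X : T} (x : Ind.yoneda.obj X ⟶ M.obj) : Sections M X := x

/-- A section, as a morphism of ind-objects. -/
def hom {X : T} (x : Sections M X) : Ind.yoneda.obj X ⟶ M.obj := x

@[ext] theorem hom_ext {X : T} {x y : Sections M X} (h : x.hom = y.hom) : x = y := h

@[simp] theorem hom_mk {X : T} (x : Ind.yoneda.obj X ⟶ M.obj) : (mk x : Sections M X).hom = x := rfl

instance (X : T) : AddCommGroup (Sections M X) :=
  inferInstanceAs (AddCommGroup (Ind.yoneda.obj X ⟶ M.obj))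

@[simp] theorem add_hom {X : T} (x y : Sections M X) : (x + y).hom = x.hom + y.hom := rfl
@[simp] theorem zero_hom {X : T} : (0 : Sections M X).hom = 0 := rfl

instance (X : T) : SMul F' (Sections M X) := ⟨fun a x => mk (x.hom ≫ M.smulHom a)⟩

@[simp] theorem smul_hom {X : T} (a : F') (x : Sections M X) : (a • x).hom = x.hom ≫ M.smulHom a := rfl

instance (X : T) : Module F' (Sections M X) where
  one_smul x := hom_ext (by rw [smul_hom, M.smulHom_one, Category.comp_id])
  mul_smul a b x := hom_ext (by
    rw [smul_hom, smul_hom, smul_hom, M.smulHom_mul, Category.assoc])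
  smul_zero a := hom_ext (by rw [smul_hom, zero_hom, zero_comp])
  zero_smul x := hom_ext (by rw [smul_hom, zero_hom, M.smulHom_zero, comp_zero])
  smul_add a x y := hom_ext (by
    rw [smul_hom, add_hom, add_hom, smul_hom, smul_hom, Preadditive.add_comp])
  add_smul a b x := hom_ext (by
    rw [smul_hom, add_hom, smul_hom, smul_hom, M.smulHom_add, Preadditive.comp_add])

theorem algebraMap_smul_hom {X : T} (a : F) (x : Sections M X) :
    (algebraMap F F' a • x).hom = a • x.hom := by
  rw [smul_hom]
  have : M.smulHom (algebraMap F F' a) = a • 𝟙 M.obj := by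
    rw [Algebra.algebraMap_eq_smul_one, M.smulHom_smul, M.smulHom_one]
  rw [this, Linear.comp_smul, Category.comp_id]

end Sections

/-- Epimorphisms of `T` are cokernels in `Ind T`. -/
theorem exists_desc_indYoneda {X Y : T} (e : X ⟶ Y) [Epi e] {M : Ind T}
    (x : Ind.yoneda.obj X ⟶ M) (h : ∀ (W : T) (k : W ⟶ X), k ≫ e = 0 → Ind.yoneda.map k ≫ x = 0) :
    ∃ y : Ind.yoneda.obj Y ⟶ M, Ind.yoneda.map e ≫ y = x := by
  have hc := isColimitCoforkMapOfIsColimit' Ind.yoneda _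
    (Abelian.epiIsCokernelOfKernel _ (kernelIsKernel e))
  obtain ⟨y, hy⟩ := CokernelCofork.IsColimit.desc' hc x (h _ _ (kernel.condition e))
  exact ⟨y, hy⟩

instance (X Y : T) (e : X ⟶ Y) [Epi e] : Epi (Ind.yoneda.map e) := inferInstance

/-- The presheaf of sections of an `F'`-module. -/
def elems (M : IndModule F F' T) : LexPresheaf F F' T where
  obj X := Sections M X
  map f :=
    { toFun := fun x => Sections.mk (Ind.yoneda.map f ≫ x.hom)
      map_add' := fun x y => Sections.hom_ext (Preadditive.comp_add _ _ _ _ _ _)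
      map_smul' := fun a x => Sections.hom_ext (Category.assoc _ _ _).symm }
  map_id x := Sections.hom_ext (by simp)
  map_comp f g x := Sections.hom_ext (by simp)
  map_add f g x := Sections.hom_ext (by simp)
  map_smul a f x := Sections.hom_ext (by
    refine Eq.trans ?_ (Sections.algebraMap_smul_hom a _).symm
    simp [Functor.map_smul])
  sep e _ y h := Sections.hom_ext (by
    rw [← cancel_epi (Ind.yoneda.map e), Sections.zero_hom, comp_zero]
    exact congrArg Sections.hom h)
  glue e _ x h := by
    obtain ⟨y, hy⟩ := exists_desc_indYoneda e x.hom fun W k hk => congrArg Sections.hom (h W k hk)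
    exact ⟨Sections.mk y, hy⟩

/-- The sections of an `F'`-module over an object of `T`. -/
abbrev El (M : IndModule F F' T) (X : T) : Type v := (elems M).obj X

namespace El

variable {M : IndModule F F' T} {X : T}

/-- A morphism from a representable ind-object, as a section. -/
def mk (x : Ind.yoneda.obj X ⟶ M.obj) : El M X := x

/-- A section, as a morphism of ind-objects. -/
def hom (x : El M X) : Ind.yoneda.obj X ⟶ M.obj := x

theorem hom_ext {x y : El M X} (h : x.hom = y.hom) : x = y := h

@[simp] theorem hom_mk (x : Ind.yoneda.obj X ⟶ M.obj) : (mk x : El M X).hom = x := rfl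
@[simp] theorem mk_hom (x : El M X) : mk x.hom = x := rfl
@[simp] theorem add_hom (x y : El M X) : (x + y).hom = x.hom + y.hom := rfl
@[simp] theorem zero_hom : (0 : El M X).hom = 0 := rfl
@[simp] theorem smul_hom (a : F') (x : El M X) : (a • x).hom = x.hom ≫ M.smulHom a := rfl

end El

theorem elems_map_hom {M : IndModule F F' T} {X Y : T} (f : X ⟶ Y) (x : El M Y) :
    El.hom ((elems M).map f x) = Ind.yoneda.map f ≫ x.hom := rfl

/-- The morphism on sections induced by a homomorphism. -/
def elMap {M N : IndModule F F' T} (f : M ⟶ N) : (elems M).Hom (elems N) where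
  app X :=
    { toFun := fun x => El.mk (El.hom x ≫ IndModule.Hom.hom f)
      map_add' := fun x y => El.hom_ext (Preadditive.add_comp _ _ _ _ _ _)
      map_smul' := fun a x => El.hom_ext (by
        simp only [El.smul_hom, El.hom_mk, Category.assoc, f.comm, RingHom.id_apply]) }
  naturality g y := El.hom_ext (by
    simp only [elems_map_hom, El.hom_mk, Category.assoc, LinearMap.coe_mk, AddHom.coe_mk])

theorem elMap_app_hom {M N : IndModule F F' T} (f : M ⟶ N) {X : T} (x : El M X) :
    El.hom ((elMap f).app X x) = x.hom ≫ IndModule.Hom.hom f := rfl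

theorem elMap_comp {M N P : IndModule F F' T} (f : M ⟶ N) (g : N ⟶ P) :
    elMap (f ≫ g) = (elMap f).comp (elMap g) :=
  LexPresheaf.Hom.ext_apply fun X x => El.hom_ext (by simp [elMap_app_hom])

theorem elMap_comp_app {M N P : IndModule F F' T} (f : M ⟶ N) (g : N ⟶ P) {X : T} (x : El M X) :
    (elMap (f ≫ g)).app X x = (elMap g).app X ((elMap f).app X x) := by
  rw [elMap_comp, LexPresheaf.Hom.comp_app]

theorem elMap_id_app {M : IndModule F F' T} {X : T} (x : El M X) :
    (elMap (𝟙 M)).app X x = x := El.hom_ext (by simp [elMap_app_hom])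

theorem elMap_zero_app {M N : IndModule F F' T} {X : T} (x : El M X) :
    (elMap (0 : M ⟶ N)).app X x = 0 :=
  El.hom_ext (by simp [elMap_app_hom, IndModule.zero_hom])

theorem elMap_add_app {M N : IndModule F F' T} (f g : M ⟶ N) {X : T} (x : El M X) :
    (elMap (f + g)).app X x = (elMap f).app X x + (elMap g).app X x :=
  El.hom_ext (by simp [elMap_app_hom, IndModule.add_hom])

theorem elMap_smul_app {M N : IndModule F F' T} (a : F') (f : M ⟶ N) {X : T} (x : El M X) :
    (elMap (a • f)).app X x = a • (elMap f).app X x :=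
  El.hom_ext (by simp [elMap_app_hom, IndModule.smul_hom])

omit [Abelian T] in
/-- Morphisms of ind-objects are determined by their effect on sections. -/
theorem ind_hom_ext {M N : Ind T} {f g : M ⟶ N}
    (h : ∀ (X : T) (x : Ind.yoneda.obj X ⟶ M), x ≫ f = x ≫ g) : f = g := by
  rw [← cancel_epi (Ind.colimitPresentationCompYoneda M).hom]
  refine colimit.hom_ext fun j => ?_
  have := h _ (colimit.ι (M.presentation.F ⋙ Ind.yoneda) j ≫
    (Ind.colimitPresentationCompYoneda M).hom)
  simpa using this

omit [Abelian T] in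
-- An ind-object is the filtered colimit of the representables of a presentation. A natural family
-- of maps on sections is a cocone on it, and every section factors through a stage, so the induced
-- morphism has the prescribed effect.
theorem exists_ind_hom {M N : Ind T} (α : ∀ X : T, (Ind.yoneda.obj X ⟶ M) → (Ind.yoneda.obj X ⟶ N))
    (hα : ∀ {X Y : T} (f : X ⟶ Y) x, α X (Ind.yoneda.map f ≫ x) = Ind.yoneda.map f ≫ α Y x) :
    ∃ g : M ⟶ N, ∀ X x, x ≫ g = α X x := by
  let e := Ind.colimitPresentationCompYoneda M
  let K := M.presentation.F ⋙ Ind.yoneda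
  let c : Cocone K :=
    { pt := N
      ι :=
        { app := fun i => α _ (colimit.ι K i ≫ e.hom)
          naturality := fun i j f => by
            have := hα (M.presentation.F.map f) (colimit.ι K j ≫ e.hom)
            have hw := colimit.w K f
            dsimp only [K, Functor.comp_map] at hw this ⊢
            rw [← this, reassoc_of% hw]
            exact (Category.comp_id _).symm } }
  refine ⟨e.inv ≫ colimit.desc K c, fun X x => ?_⟩
  obtain ⟨j, b, hb⟩ := exists_factor_of_isColimit (colimit.isColimit K) (x ≫ e.inv)
  obtain ⟨b, rfl⟩ := Ind.yoneda.map_surjective b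
  have hx : x = Ind.yoneda.map b ≫ colimit.ι K j ≫ e.hom := by
    have hb' : Ind.yoneda.map b ≫ colimit.ι K j = x ≫ e.inv := hb
    rw [reassoc_of% hb', e.inv_hom_id, Category.comp_id]
  rw [hx, hα, Category.assoc, Category.assoc, e.hom_inv_id_assoc, colimit.ι_desc]

theorem elMap_injective {M N : IndModule F F' T} {f g : M ⟶ N}
    (h : ∀ X x, (elMap f).app X x = (elMap g).app X x) : f = g :=
  IndModule.hom_ext (ind_hom_ext fun X x => congrArg El.hom (h X (El.mk x)))

/-- Together with `elMap_injective` this says that `elems` is fully faithful, so morphisms of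
modules may be constructed on sections. -/
theorem exists_hom_of_lexHom {M N : IndModule F F' T} (α : (elems M).Hom (elems N)) :
    ∃ f : M ⟶ N, elMap f = α := by
  obtain ⟨g, hg⟩ := exists_ind_hom (fun X x => El.hom (α.app X (El.mk x)))
    (fun f x => congrArg El.hom (α.naturality f (El.mk x)))
  refine ⟨⟨g, fun a => ind_hom_ext fun X x => ?_⟩,
    LexPresheaf.Hom.ext_apply fun X x => El.hom_ext (hg X x.hom)⟩
  rw [← Category.assoc, hg, ← Category.assoc, hg]
  exact congrArg El.hom ((α.app X).map_smul a (El.mk x))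

/-- The homomorphism with given effect on sections. -/
def homOfLexHom {M N : IndModule F F' T} (α : (elems M).Hom (elems N)) : M ⟶ N :=
  (exists_hom_of_lexHom α).choose

@[simp]
theorem elMap_homOfLexHom {M N : IndModule F F' T} (α : (elems M).Hom (elems N)) :
    elMap (homOfLexHom α) = α :=
  (exists_hom_of_lexHom α).choose_spec

/-- With `epi_of_locSurj`, this characterises epimorphisms on sections; it is the source of all the
refinements along epimorphisms below. -/
theorem locSurj_of_epi {M N : IndModule F F' T} (f : M ⟶ N) [Epi f] : (elMap f).LocSurj := by
  intro X y
  obtain ⟨Z, e, he, a, ha⟩ := exists_lift_of_epi (IndModule.Hom.hom f) y.hom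
  exact ⟨Z, e, he, El.mk a, El.hom_ext ha⟩

theorem epi_of_locSurj {M N : IndModule F F' T} (f : M ⟶ N) (h : (elMap f).LocSurj) : Epi f := by
  refine Preadditive.epi_of_cancel_zero _ fun {K} g hg => elMap_injective fun X x => ?_
  rw [elMap_zero_app]
  obtain ⟨Z, e, _, y, hy⟩ := h X x
  refine (elems K).sep e _ ?_
  rw [← LexPresheaf.Hom.naturality, ← hy, ← elMap_comp_app, hg, elMap_zero_app]

/-- Taking sections is left exact, because the kernel of a homomorphism is the kernel of the
underlying morphism of ind-objects. -/
theorem exists_of_elMap_eq_zero {M N : IndModule F F' T} (f : M ⟶ N) {X : T} (x : El M X)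
    (h : (elMap f).app X x = 0) : ∃ k : El (kernel f) X, (elMap (kernel.ι f)).app X k = x := by
  let e := (kernelIsKernel f).conePointUniqueUpToIso (IndModule.kernelIsLimit f)
  have he : e.inv ≫ kernel.ι f = IndModule.kernelι f :=
    (kernelIsKernel f).conePointUniqueUpToIso_inv_comp (IndModule.kernelIsLimit f)
      WalkingParallelPair.zero
  let k : El (IndModule.kernelObj f) X := El.mk (kernel.lift _ x.hom (congrArg El.hom h))
  refine ⟨(elMap e.inv).app X k, ?_⟩
  rw [← elMap_comp_app, he]
  exact El.hom_ext (kernel.lift_ι (IndModule.Hom.hom f) _ (congrArg El.hom h))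

end ScalarExtension

end

/-! ### The modules `t(X)`: their sections and their universal property. -/

noncomputable section
namespace ScalarExtension

attribute [local instance] indPreadditive indLinear

variable (F F' : Type v) [Field F] [Field F'] [Algebra F F']
variable {T : Type u} [Category.{v} T] [Abelian T] [Linear F T]

/-- The `F'`-module `t(X)`. -/
abbrev tObj (X : T) : IndModule F F' T := (toIndModule F F' T).obj X

/-- The tautological section of `t(X)` over `X`. -/
def gen (X : T) : El (tObj F F' X) X := El.mk (tmul (Ind.yoneda.obj X) 1)

variable {F F'}

theorem smul_gen_hom {X : T} (a : F') :
    El.hom (a • gen F F' X) = tmul (F := F) (Ind.yoneda.obj X) a :=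
  (tmul_tensorSMul (Ind.yoneda.obj X) a 1).trans (by rw [mul_one])

theorem elMap_toIndModule_gen {X Y : T} (f : X ⟶ Y) :
    (elMap ((toIndModule F F' T).map f)).app X (gen F F' X) =
      (elems (tObj F F' Y)).map f (gen F F' Y) :=
  El.hom_ext (tmul_tensorMap (Ind.yoneda.map f) 1)

/-- The sections of a presheaf, as an `F`-vector space. -/
@[reducible]
def LexPresheaf.baseModule (H : LexPresheaf F F' T) (X : T) : Module F (H.obj X) :=
  Module.compHom _ (algebraMap F F')

attribute [local instance] LexPresheaf.baseModule

instance (H : LexPresheaf F F' T) (X : T) : IsScalarTower F F' (H.obj X) where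
  smul_assoc r a x := by
    change _ = algebraMap F F' r • a • x
    rw [Algebra.smul_def, mul_smul]

/-- Restriction of a section along varying morphisms. -/
def LexPresheaf.restrict (H : LexPresheaf F F' T) {X : T} (h : H.obj X) (Z : T) :
    (Z ⟶ X) →ₗ[F] H.obj Z where
  toFun f := H.map f h
  map_add' f g := H.map_add f g h
  map_smul' a f := H.map_smul a f h

open TensorProduct in
/-- The comparison `F' ⊗_F Hom(Z, X) → t(X)(Z)`. -/
def tSections (X Z : T) : F' ⊗[F] (Z ⟶ X) →ₗ[F'] El (tObj F F' X) Z :=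
  ((elems (tObj F F' X)).restrict (gen F F' X) Z).liftBaseChange F'

theorem tSections_tmul {X Z : T} (a : F') (f : Z ⟶ X) :
    tSections X Z (a ⊗ₜ[F] f) = a • (elems (tObj F F' X)).map f (gen F F' X) := rfl

theorem tSections_basis_hom {X Z : T} (i : Module.Basis.ofVectorSpaceIndex F F') (f : Z ⟶ X) :
    El.hom (tSections X Z (Module.Basis.ofVectorSpace F F' i ⊗ₜ[F] f)) =
      Ind.yoneda.map f ≫ tensorι (Ind.yoneda.obj X) i := by
  rw [tSections_tmul, ← LinearMap.map_smul, elems_map_hom, smul_gen_hom, tmul_basis]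
  rfl

/-- A section of a direct sum of copies of `X` is a finite sum of sections of the summands, and the
summand with index `i` corresponds to the basis vector with index `i` of `F'`. -/
theorem tSections_surjective (X Z : T) : Function.Surjective (tSections (F := F) (F' := F') X Z) := by
  intro w
  obtain ⟨S, g, hg⟩ := exists_sum_of_hom_sigma (El.hom w)
  choose f hf using fun i => Ind.yoneda.map_surjective (g i)
  refine ⟨∑ i ∈ S, Module.Basis.ofVectorSpace F F' i ⊗ₜ[F] f i, El.hom_ext ?_⟩
  let homAdd : El (tObj F F' X) Z →+ (Ind.yoneda.obj Z ⟶ tensorObj F F' (Ind.yoneda.obj X)) :=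
    { toFun := El.hom, map_zero' := rfl, map_add' := fun _ _ => rfl }
  refine Eq.trans ?_ hg.symm
  rw [_root_.map_sum (tSections X Z)]
  refine (_root_.map_sum homAdd _ S).trans (Finset.sum_congr rfl fun i _ => ?_)
  refine (tSections_basis_hom i (f i)).trans ?_
  rw [hf]
  rfl

/-- A coordinate of a section of `t(X)`. -/
def tCoord (X Z : T) (j : Module.Basis.ofVectorSpaceIndex F F') :
    El (tObj F F' X) Z →+ (Ind.yoneda.obj Z ⟶ Ind.yoneda.obj X) :=
  open Classical in
  let π : tensorObj F F' (Ind.yoneda.obj X) ⟶ Ind.yoneda.obj X :=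
    Sigma.desc (fun i => if i = j then 𝟙 (Ind.yoneda.obj X) else 0)
  { toFun := fun w => (show Ind.yoneda.obj Z ⟶ tensorObj F F' (Ind.yoneda.obj X) from El.hom w) ≫ π
    map_zero' := zero_comp
    map_add' := fun _ _ => Preadditive.add_comp _ _ _ _ _ _ }

open Classical in
theorem tCoord_basis {X Z : T} (i j : Module.Basis.ofVectorSpaceIndex F F') (f : Z ⟶ X) :
    tCoord X Z j (tSections X Z (Module.Basis.ofVectorSpace F F' i ⊗ₜ[F] f)) =
      if i = j then Ind.yoneda.map f else 0 := by
  let π : tensorObj F F' (Ind.yoneda.obj X) ⟶ Ind.yoneda.obj X :=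
    Sigma.desc (fun i => if i = j then 𝟙 (Ind.yoneda.obj X) else 0)
  have h1 := tSections_basis_hom (F := F) (F' := F') i f
  have h3 : tensorι (F := F) (F' := F') (Ind.yoneda.obj X) i ≫ π =
        if i = j then 𝟙 (Ind.yoneda.obj X) else 0 := Sigma.ι_desc _ _
  refine (congrArg (fun w : Ind.yoneda.obj Z ⟶ tensorObj F F' (Ind.yoneda.obj X) =>
    w ≫ π) h1).trans ?_
  refine (Category.assoc _ _ _).trans ((congrArg (Ind.yoneda.map f ≫ ·) h3).trans ?_)
  split_ifs <;> simp

/-- An element of `F' ⊗ Hom(Z, X)` has unique coordinates in `Hom(Z, X)` with respect to the basis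
of `F'`, and `tCoord` recovers each of them from the section. -/
theorem tSections_injective (X Z : T) : Function.Injective (tSections (F := F) (F' := F') X Z) := by
  classical
  rw [injective_iff_map_eq_zero]
  intro u hu
  let b := Module.Basis.ofVectorSpace F F'
  let e := TensorProduct.equivFinsuppOfBasisLeft (N := (Z ⟶ X)) b
  obtain ⟨c, rfl⟩ := e.symm.surjective u
  suffices c = 0 by rw [this, _root_.map_zero]
  ext j
  apply (Ind.yoneda (C := T)).map_injective
  have hc : e.symm c = c.sum fun i f => b i ⊗ₜ[F] f := by
    exact TensorProduct.equivFinsuppOfBasisLeft_symm_apply b c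
  rw [hc, Finsupp.sum, _root_.map_sum] at hu
  have h2 := congrArg (tCoord X Z j) hu
  rw [_root_.map_sum, _root_.map_zero, Finset.sum_congr rfl fun i _ => tCoord_basis i j (c i),
    Finset.sum_ite_eq'] at h2
  rw [Finsupp.zero_apply, Functor.map_zero]
  split_ifs at h2 with h
  · exact h2
  · rw [Finsupp.notMem_support_iff.1 h, Functor.map_zero]

/-- The identification `F' ⊗_F Hom(Z, X) = t(X)(Z)`. -/
def tSectionsEquiv (X Z : T) : TensorProduct F F' (Z ⟶ X) ≃ₗ[F'] El (tObj F F' X) Z :=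
  LinearEquiv.ofBijective (tSections X Z) ⟨tSections_injective X Z, tSections_surjective X Z⟩

theorem tSectionsEquiv_tmul {X Z : T} (a : F') (f : Z ⟶ X) :
    tSectionsEquiv X Z (a ⊗ₜ[F] f) = a • (elems (tObj F F' X)).map f (gen F F' X) := rfl

@[elab_as_elim]
theorem tSections_induction {X Z : T} {p : El (tObj F F' X) Z → Prop} (w : El (tObj F F' X) Z)
    (zero : p 0) (add : ∀ x y, p x → p y → p (x + y))
    (smul_map : ∀ (a : F') (f : Z ⟶ X), p (a • (elems (tObj F F' X)).map f (gen F F' X))) : p w := by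
  obtain ⟨u, rfl⟩ := (tSectionsEquiv X Z).surjective w
  induction u using TensorProduct.induction_on with
  | zero => simpa using zero
  | tmul a f => exact smul_map a f
  | add x y hx hy => rw [_root_.map_add]; exact add _ _ hx hy

/-- The morphism `t(X) → H` determined by a section of `H` over `X`. -/
def tDesc {H : LexPresheaf F F' T} {X : T} (h : H.obj X) : (elems (tObj F F' X)).Hom H where
  app Z := ((H.restrict h Z).liftBaseChange F').comp (tSectionsEquiv X Z).symm.toLinearMap
  naturality {Z W} f w := by
    have key : ∀ {Z : T} (a : F') (f : Z ⟶ X),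
        (((H.restrict h Z).liftBaseChange F').comp (tSectionsEquiv X Z).symm.toLinearMap)
          (a • (elems (tObj F F' X)).map f (gen F F' X)) = a • H.map f h := by
      intro Z a f
      rw [← tSectionsEquiv_tmul, LinearMap.comp_apply, LinearEquiv.coe_coe,
        LinearEquiv.symm_apply_apply, LinearMap.liftBaseChange_tmul]
      rfl
    induction w using tSections_induction with
    | zero => simp
    | add x y hx hy => rw [_root_.map_add, _root_.map_add, _root_.map_add, _root_.map_add, hx, hy]
    | smul_map a g =>
      rw [_root_.map_smul, ← LexPresheaf.map_comp, key, key, _root_.map_smul, H.map_comp]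

theorem tDesc_gen {H : LexPresheaf F F' T} {X : T} (h : H.obj X) :
    (tDesc h).app X (gen F F' X) = h := by
  have : gen F F' X = tSectionsEquiv X X (1 ⊗ₜ[F] 𝟙 X) := by
    rw [tSectionsEquiv_tmul, one_smul, LexPresheaf.map_id]
  change ((H.restrict h X).liftBaseChange F') ((tSectionsEquiv X X).symm _) = h
  rw [this, LinearEquiv.symm_apply_apply, LinearMap.liftBaseChange_tmul, one_smul]
  exact H.map_id h

/-- With `tDesc` and `tDesc_gen`, this is the identification `Hom(t(X), H) = H(X)`. It is needed for
all presheaves `H`, not only for those of modules: it will be applied to shifts `H(- ⊗ Y)` and to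
`Hom(ω(-), V)`. -/
theorem t_hom_ext {H : LexPresheaf F F' T} {X : T} {α β : (elems (tObj F F' X)).Hom H}
    (h : α.app X (gen F F' X) = β.app X (gen F F' X)) : α = β := by
  refine LexPresheaf.Hom.ext_apply fun Z w => ?_
  induction w using tSections_induction with
  | zero => simp
  | add x y hx hy => rw [_root_.map_add, _root_.map_add, hx, hy]
  | smul_map a g => rw [_root_.map_smul, _root_.map_smul, α.naturality, β.naturality, h]

/-- The homomorphism `t(X) → M` determined by a section. -/
def tHom {M : IndModule F F' T} {X : T} (m : El M X) : tObj F F' X ⟶ M :=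
  homOfLexHom (tDesc m)

theorem elMap_tHom_gen {M : IndModule F F' T} {X : T} (m : El M X) :
    (elMap (tHom m)).app X (gen F F' X) = m := by
  rw [tHom, elMap_homOfLexHom, tDesc_gen]

theorem tObj_hom_ext {M : IndModule F F' T} {X : T} {f g : tObj F F' X ⟶ M}
    (h : (elMap f).app X (gen F F' X) = (elMap g).app X (gen F F' X)) : f = g :=
  elMap_injective fun Y y => by rw [t_hom_ext (α := elMap f) (β := elMap g) h]

end ScalarExtension

end

/-! ### Subobjects through their sections, and objects of finite length. -/

noncomputable section
namespace ScalarExtension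

open scoped ZeroObject

attribute [local instance] indPreadditive indLinear LexPresheaf.baseModule

variable {F F' : Type v} [Field F] [Field F'] [Algebra F F']
variable {T : Type u} [Category.{v} T] [Abelian T] [Linear F T]

section Membership

variable {M N : IndModule F F' T}

theorem exists_of_elMap_eq_zero_of_factors {K : IndModule F F' T} (i : K ⟶ M) (p : M ⟶ N)
    (h : ∀ {W : IndModule F F' T} (k : W ⟶ M), k ≫ p = 0 → ∃ l, l ≫ i = k) {X : T} (x : El M X)
    (hx : (elMap p).app X x = 0) : ∃ y, (elMap i).app X y = x := by
  obtain ⟨k, hk⟩ := exists_of_elMap_eq_zero p x hx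
  obtain ⟨l, hl⟩ := h (kernel.ι p) (kernel.condition p)
  exact ⟨(elMap l).app X k, by rw [← elMap_comp_app, hl, hk]⟩

/-- The sections of a subobject. -/
def memSub (K : Subobject M) (X : T) : Submodule F' (El M X) :=
  LinearMap.range ((elMap K.arrow).app X)

/-- Membership becomes a vanishing condition in a separated presheaf, so it can be checked after an
epimorphism; see `memSub_of_map`. -/
theorem mem_memSub_iff {K : Subobject M} {X : T} {x : El M X} :
    x ∈ memSub K X ↔ (elMap (cokernel.π K.arrow)).app X x = 0 := by
  constructor
  · rintro ⟨y, rfl⟩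
    rw [← elMap_comp_app, cokernel.condition, elMap_zero_app]
  · exact exists_of_elMap_eq_zero_of_factors K.arrow (cokernel.π K.arrow)
      (fun k hk => ⟨Abelian.monoLift K.arrow k hk, Abelian.monoLift_comp _ _ _⟩) x

theorem memSub_map {K : Subobject M} {X Y : T} (f : X ⟶ Y) {x : El M Y} (hx : x ∈ memSub K Y) :
    (elems M).map f x ∈ memSub K X := by
  obtain ⟨y, rfl⟩ := hx
  exact ⟨(elems _).map f y, (elMap K.arrow).naturality f y⟩

theorem memSub_of_map {K : Subobject M} {X Y : T} (f : X ⟶ Y) [Epi f] {x : El M Y}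
    (hx : (elems M).map f x ∈ memSub K X) : x ∈ memSub K Y := by
  rw [mem_memSub_iff] at hx ⊢
  rw [LexPresheaf.Hom.naturality] at hx
  exact (elems _).sep f _ hx

/-- If every section of `K` lies in `K'`, then `K` maps to zero in the quotient by `K'`, since
morphisms are determined on sections. -/
theorem le_iff_memSub {K K' : Subobject M} :
    K ≤ K' ↔ ∀ (X : T) (x : El M X), x ∈ memSub K X → x ∈ memSub K' X := by
  constructor
  · rintro h X x ⟨y, rfl⟩
    refine ⟨(elMap (K.ofLE K' h)).app X y, ?_⟩
    rw [← elMap_comp_app, Subobject.ofLE_arrow]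
  · intro h
    have h0 : K.arrow ≫ cokernel.π K'.arrow = 0 := elMap_injective fun X x => by
      rw [elMap_comp_app, elMap_zero_app, ← mem_memSub_iff]
      exact h _ _ ⟨x, rfl⟩
    exact Subobject.le_of_comm (Abelian.monoLift K'.arrow K.arrow h0) (Abelian.monoLift_comp _ _ _)

/-- The preimage of a subobject. -/
def subPreimage (f : M ⟶ N) (K : Subobject N) : Subobject M :=
  Subobject.mk (kernel.ι (f ≫ cokernel.π K.arrow))

theorem mem_memSub_mk {K : IndModule F F' T} (i : K ⟶ M) [Mono i] {X : T} {x : El M X} :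
    x ∈ memSub (Subobject.mk i) X ↔ ∃ y, (elMap i).app X y = x := by
  constructor
  · rintro ⟨y, rfl⟩
    exact ⟨(elMap (Subobject.underlyingIso i).hom).app X y, by
      rw [← elMap_comp_app, Subobject.underlyingIso_hom_comp_eq_mk]⟩
  · rintro ⟨y, rfl⟩
    exact ⟨(elMap (Subobject.underlyingIso i).inv).app X y, by
      rw [← elMap_comp_app, Subobject.underlyingIso_arrow]⟩

theorem mem_subPreimage {f : M ⟶ N} {K : Subobject N} {X : T} {x : El M X} :
    x ∈ memSub (subPreimage f K) X ↔ (elMap f).app X x ∈ memSub K X := by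
  rw [subPreimage, mem_memSub_mk, mem_memSub_iff, ← elMap_comp_app]
  constructor
  · rintro ⟨y, rfl⟩
    rw [← elMap_comp_app, kernel.condition, elMap_zero_app]
  · exact exists_of_elMap_eq_zero _ _

theorem map_mem_memSub_imageSubobject (f : M ⟶ N) {X : T} (x : El M X) :
    (elMap f).app X x ∈ memSub (imageSubobject f) X :=
  ⟨(elMap (factorThruImageSubobject f)).app X x, by
    rw [← elMap_comp_app, imageSubobject_arrow_comp]⟩

/-- The map onto the image is an epimorphism, hence only locally surjective on sections. -/
theorem exists_of_mem_imageSubobject (f : M ⟶ N) {X : T} {y : El N X}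
    (hy : y ∈ memSub (imageSubobject f) X) :
    ∃ (Z : T) (e : Z ⟶ X) (_ : Epi e) (x : El M Z), (elMap f).app Z x = (elems N).map e y := by
  obtain ⟨y, rfl⟩ := hy
  obtain ⟨Z, e, he, x, hx⟩ := locSurj_of_epi (factorThruImageSubobject f) X y
  refine ⟨Z, e, he, x, ?_⟩
  rw [← LexPresheaf.Hom.naturality, ← hx, ← elMap_comp_app, imageSubobject_arrow_comp]

theorem imageSubobject_le_iff {f : M ⟶ N} {K : Subobject N} :
    imageSubobject f ≤ K ↔ ∀ (X : T) (x : El M X), (elMap f).app X x ∈ memSub K X := by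
  rw [le_iff_memSub]
  refine ⟨fun h X x => h _ _ (map_mem_memSub_imageSubobject f x), fun h X y hy => ?_⟩
  obtain ⟨Z, e, _, x, hx⟩ := exists_of_mem_imageSubobject f hy
  exact memSub_of_map e (hx ▸ h Z x)

end Membership

theorem isFiniteLength_of_strictMono {C : Type*} [Category* C] {X : C} {α : Type*} [PartialOrder α]
    [WellFoundedGT α] [WellFoundedLT α] (f : Subobject X → α) (hf : StrictMono f) :
    isFiniteLength C X :=
  ⟨⟨hf.wellFoundedGT⟩, ⟨hf.wellFoundedLT⟩⟩

theorem wellFounded_of_isFiniteLength {C : Type*} [Category* C] {X : C} (h : isFiniteLength C X) :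
    WellFoundedGT (Subobject X) ∧ WellFoundedLT (Subobject X) :=
  ⟨h.1.prop, h.2.prop⟩

theorem isFiniteLength_of_mono {C : Type*} [Category* C] {X Y : C} (f : X ⟶ Y) [Mono f]
    (h : isFiniteLength C Y) : isFiniteLength C X := by
  have := h.1
  have := h.2
  exact ⟨isNoetherianObject_of_mono f, isArtinianObject_of_mono f⟩

section FiniteLength

variable {M N P : IndModule F F' T}

/-- Taking preimages embeds the subobjects of the quotient into those of `M`; injectivity holds
because sections of `N` lift locally. -/
theorem isFiniteLength_of_epi (p : M ⟶ N) [Epi p] (h : isFiniteLength _ M) :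
    isFiniteLength _ N := by
  obtain ⟨_, _⟩ := wellFounded_of_isFiniteLength h
  refine isFiniteLength_of_strictMono (subPreimage p) (Monotone.strictMono_of_injective ?_ ?_)
  · intro K K' hK
    rw [le_iff_memSub] at hK ⊢
    intro X x hx
    rw [mem_subPreimage] at hx ⊢
    exact hK _ _ hx
  · have key : ∀ K K', subPreimage p K ≤ subPreimage p K' → K ≤ K' := by
      intro K K' hK
      rw [le_iff_memSub] at hK ⊢
      intro X y hy
      obtain ⟨Z, e, _, x, hx⟩ := locSurj_of_epi p X y
      refine memSub_of_map e ?_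
      rw [← hx]
      exact mem_subPreimage.1 (hK _ _ (mem_subPreimage.2 (hx ▸ memSub_map e hy)))
    exact fun K K' hK => le_antisymm (key _ _ hK.le) (key _ _ hK.ge)

/-- A subobject of `N` is sent to its preimage in `M` and its image in `P`. For `K ≤ K'` with the
same preimage and image one has `K = K'`, so this map is strictly monotone and both chain conditions
carry over. -/
theorem isFiniteLength_of_exact (i : M ⟶ N) (p : N ⟶ P)
    (h : ∀ (X : T) (x : El N X), (elMap p).app X x = 0 → ∃ y, (elMap i).app X y = x)
    (hM : isFiniteLength _ M) (hP : isFiniteLength _ P) : isFiniteLength _ N := by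
  obtain ⟨_, _⟩ := wellFounded_of_isFiniteLength hM
  obtain ⟨_, _⟩ := wellFounded_of_isFiniteLength hP
  have mono : Monotone fun K : Subobject N => (subPreimage i K, imageSubobject (K.arrow ≫ p)) := by
    intro K K' hK
    refine ⟨?_, ?_⟩
    · change subPreimage i K ≤ subPreimage i K'
      rw [le_iff_memSub] at hK ⊢
      intro X x hx
      rw [mem_subPreimage] at hx ⊢
      exact hK _ _ hx
    · change imageSubobject _ ≤ imageSubobject _
      rw [imageSubobject_le_iff]
      intro X x
      rw [← Subobject.ofLE_arrow hK, Category.assoc, elMap_comp_app]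
      exact map_mem_memSub_imageSubobject _ _
  refine isFiniteLength_of_strictMono _ fun K K' hK => lt_of_le_not_ge (mono hK.le) fun h' => ?_
  refine hK.not_ge ?_
  obtain ⟨h1, h2⟩ := h'
  dsimp only at h1 h2
  rw [le_iff_memSub] at h1 h2 ⊢
  rintro X x hx
  have h3 : (elMap p).app X x ∈ memSub (imageSubobject (K.arrow ≫ p)) X := by
    refine h2 _ _ ?_
    obtain ⟨x, rfl⟩ := hx
    rw [← elMap_comp_app]
    exact map_mem_memSub_imageSubobject _ _
  obtain ⟨Z, e, _, y, hy⟩ := exists_of_mem_imageSubobject _ h3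
  have hyK : (elMap K.arrow).app Z y ∈ memSub K Z := ⟨y, rfl⟩
  obtain ⟨z, hz⟩ := h Z ((elems N).map e x - (elMap K.arrow).app Z y) (by
    rw [_root_.map_sub, LexPresheaf.Hom.naturality, ← hy, elMap_comp_app, sub_self])
  refine memSub_of_map e ?_
  have h4 : z ∈ memSub (subPreimage i K') Z := by
    rw [mem_subPreimage, hz]
    exact sub_mem (memSub_map e hx) (le_iff_memSub.1 hK.le _ _ hyK)
  have h5 := mem_subPreimage.1 (h1 _ _ h4)
  rw [hz] at h5
  exact (Submodule.sub_mem_iff_left _ hyK).1 h5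

theorem isFiniteLength_of_isZero {C : Type*} [Category* C] [HasZeroObject C] {X : C}
    (h : IsZero X) : isFiniteLength C X :=
  ⟨isNoetherianObject_of_isZero h, isArtinianObject_of_isZero h⟩

end FiniteLength

/-! ### The modules `t(X)` have finite length. -/

section Simple

omit [Linear F T] in
/-- Finitely many morphisms to a simple object factor through an epimorphism onto a finite power
of it. -/
theorem exists_epi_factors_of_simple {X : T} [Simple X] (Q : T → Prop) (h0 : Q 0)
    (hX : ∀ P, Q P → Q (P ⊞ X)) {Y : T} {ι : Type*} (S : Finset ι) (f : ι → (Y ⟶ X)) :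
    ∃ (P : T) (_ : Q P) (g : Y ⟶ P) (_ : Epi g), ∀ i ∈ S, ∃ h, g ≫ h = f i := by
  classical
  induction S using Finset.induction_on with
  | empty => exact ⟨0, h0, 0, inferInstance, by simp⟩
  | insert i S hi ih =>
    obtain ⟨P, hP, g, _, hg⟩ := ih
    -- Either `f i` kills the kernel of `g` and factors through `g` already, or its restriction to
    -- that kernel is a nonzero morphism to a simple object, hence epi. In the second case the map
    -- to `P ⊞ X` is again epi.
    by_cases hk : kernel.ι g ≫ f i = 0
    · refine ⟨P, hP, g, inferInstance, fun j hj => ?_⟩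
      rcases Finset.mem_insert.1 hj with rfl | hj
      · exact ⟨Abelian.epiDesc g (f j) hk, Abelian.comp_epiDesc _ _ _⟩
      · exact hg j hj
    · have := epi_of_nonzero_to_simple hk
      refine ⟨P ⊞ X, hX P hP, biprod.lift g (f i), ?_, fun j hj => ?_⟩
      · refine Preadditive.epi_of_cancel_zero _ fun {W} u hu => ?_
        have hu' : g ≫ biprod.inl ≫ u + f i ≫ biprod.inr ≫ u = 0 := by
          rw [← Category.assoc, ← Category.assoc, ← Preadditive.add_comp, ← biprod.lift_eq, hu]
        have h2 : biprod.inr ≫ u = 0 := by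
          rw [← cancel_epi (kernel.ι g ≫ f i)]
          have := congrArg (kernel.ι g ≫ ·) hu'
          simpa using this
        have h1 : biprod.inl ≫ u = 0 := by
          rw [← cancel_epi g]
          simpa [h2] using hu'
        apply biprod.hom_ext' <;> simp [h1, h2]
      · rcases Finset.mem_insert.1 hj with rfl | hj
        · exact ⟨biprod.snd, biprod.lift_snd _ _⟩
        · obtain ⟨h, hh⟩ := hg j hj
          exact ⟨biprod.fst ≫ h, by rw [biprod.lift_fst_assoc, hh]⟩

theorem elMap_toIndModule_tSections {X Y Z : T} (f : X ⟶ Y) (w : TensorProduct F F' (Z ⟶ X)) :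
    (elMap ((toIndModule F F' T).map f)).app Z (tSectionsEquiv X Z w) =
      tSectionsEquiv Y Z ((Linear.rightComp F Z f).lTensor F' w) := by
  induction w using TensorProduct.induction_on with
  | zero => simp
  | add x y hx hy => simp only [_root_.map_add, hx, hy]
  | tmul a g =>
    rw [LinearMap.lTensor_tmul, tSectionsEquiv_tmul, tSectionsEquiv_tmul, _root_.map_smul,
      LexPresheaf.Hom.naturality, elMap_toIndModule_gen, ← LexPresheaf.map_comp]
    rfl

/-- On sections `t` is the functor `F' ⊗ Hom(W, -)`, so exactness in the middle is left exactness of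
`Hom` combined with flatness of `F'` over `F`. -/
theorem exists_of_elMap_toIndModule_eq_zero {X Y Z : T} (i : X ⟶ Y) (p : Y ⟶ Z) (hip : i ≫ p = 0)
    (h : ∀ {W : T} (k : W ⟶ Y), k ≫ p = 0 → ∃ l, l ≫ i = k) {W : T} (w : El (tObj F F' Y) W)
    (hw : (elMap ((toIndModule F F' T).map p)).app W w = 0) :
    ∃ w', (elMap ((toIndModule F F' T).map i)).app W w' = w := by
  obtain ⟨u, rfl⟩ := (tSectionsEquiv Y W).surjective w
  rw [elMap_toIndModule_tSections, LinearEquiv.map_eq_zero_iff] at hw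
  have hex : Function.Exact (Linear.rightComp F W i) (Linear.rightComp F W p) := by
    intro k
    constructor
    · exact h k
    · rintro ⟨l, rfl⟩
      simp [hip]
  obtain ⟨u', rfl⟩ := (Module.Flat.lTensor_exact F' hex u).1 hw
  exact ⟨tSectionsEquiv X W u', elMap_toIndModule_tSections i u'⟩

/-- A submodule of `t(X)`, for `X` simple, is determined by its sections over `X`. -/
theorem le_of_memSub_le_of_simple (X : T) [Simple X] {K K' : Subobject (tObj F F' X)}
    (h : memSub K' X ≤ memSub K X) : K' ≤ K := by
  rw [le_iff_memSub]
  intro Y w hw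
  obtain ⟨u, rfl⟩ := (tSectionsEquiv X Y).surjective w
  obtain ⟨S, hS⟩ := TensorProduct.exists_finset u
  -- The section is a finite sum of tensors `a ⊗ f` with `f : Y ⟶ X`. All these `f` factor through
  -- one epimorphism `g` onto a finite power `P` of `X`, so the section is pulled back from `P`.
  -- Membership in `K'` descends along `g`, and over a power of `X` it reduces to sections over `X`.
  obtain ⟨P, hP, g, _, hg⟩ := exists_epi_factors_of_simple (X := X)
    (fun P => ∀ w ∈ memSub K' P, w ∈ memSub K P)
    (fun w _ => by
      have : w = 0 := by
        rw [← (elems _).map_id w, (isZero_zero T).eq_of_src (𝟙 0) 0, LexPresheaf.map_zero_hom]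
      rw [this]
      exact zero_mem _)
    (fun P hP w hw => by
      have : w = (elems _).map (biprod.fst : P ⊞ X ⟶ P) ((elems _).map biprod.inl w) +
          (elems _).map (biprod.snd : P ⊞ X ⟶ X) ((elems _).map biprod.inr w) := by
        rw [← LexPresheaf.map_comp, ← LexPresheaf.map_comp, ← LexPresheaf.map_add, biprod.total,
          LexPresheaf.map_id]
      rw [this]
      exact add_mem (memSub_map _ (hP _ (memSub_map _ hw)))
        (memSub_map _ (h (memSub_map _ hw)))) S (fun i => i.2)
  choose! h' hh using hg
  let w' : El (tObj F F' X) P := ∑ i ∈ S, i.1 • (elems (tObj F F' X)).map (h' i) (gen F F' X)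
  have hw' : tSectionsEquiv X Y u = (elems _).map g w' := by
    rw [hS, _root_.map_sum, _root_.map_sum]
    refine Finset.sum_congr rfl fun i hi => ?_
    rw [tSectionsEquiv_tmul, _root_.map_smul, ← LexPresheaf.map_comp, hh i hi]
  rw [hw'] at hw ⊢
  exact memSub_map g (hP _ (memSub_of_map g hw))

/-- Sections over `X` embed the subobjects of `t(X)`, strictly monotonically, into the subspaces of
the finite-dimensional `F'`-space `F' ⊗ End(X)`. -/
theorem isFiniteLength_tObj_of_simple (X : T) [Simple X] [Module.Finite F (End X)] :
    isFiniteLength _ (tObj F F' X) := by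
  have : Module.Finite F (X ⟶ X) := inferInstanceAs (Module.Finite F (End X))
  have : Module.Finite F' (El (tObj F F' X) X) := Module.Finite.equiv (tSectionsEquiv X X)
  exact isFiniteLength_of_strictMono (fun K => memSub K X) fun K K' hK =>
    lt_of_le_not_ge (le_iff_memSub.1 hK.le X) fun h =>
      hK.not_ge (le_of_memSub_le_of_simple X h)

/-- Choose `K ≤ X` maximal with `t(K)` of finite length. If `K` is not all of `X`, the quotient has
a simple subobject, and its preimage `K'` in `X` is an extension of a simple object by `K`. Then
`t(K')` also has finite length, which contradicts maximality. -/
theorem isFiniteLength_tObj (hfl : ∀ X : T, isFiniteLength T X)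
    (hend : ∀ X : T, Module.Finite F (End X)) (X : T) : isFiniteLength _ (tObj F F' X) := by
  obtain ⟨_, _⟩ := wellFounded_of_isFiniteLength (hfl X)
  obtain ⟨K, hK, hmax⟩ := WellFounded.has_min (wellFounded_gt (α := Subobject X))
    {K | isFiniteLength _ (tObj F F' (K : T))} ⟨⊥, by
      refine isFiniteLength_of_isZero ?_
      have hz : IsZero ((⊥ : Subobject X) : T) :=
        (isZero_zero T).of_iso Subobject.botCoeIsoZero
      rw [IsZero.iff_id_eq_zero]
      refine tObj_hom_ext ?_
      rw [elMap_id_app, elMap_zero_app, ← (elems _).map_id (gen F F' _), hz.eq_of_src (𝟙 _) 0,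
        LexPresheaf.map_zero_hom]⟩
  by_cases hC : IsZero (cokernel K.arrow)
  · have : Epi K.arrow := Preadditive.epi_of_isZero_cokernel _ hC
    have : IsIso K.arrow := isIso_of_mono_of_epi _
    exact isFiniteLength_of_mono ((toIndModule F F' T).map (inv K.arrow)) hK
  exfalso
  have := (hfl (cokernel K.arrow)).2
  let s := simpleSubobjectArrow hC
  let q := cokernel.π K.arrow
  let r := cokernel.π s
  let K' : Subobject X := Subobject.mk (kernel.ι (q ≫ r))
  have hle : K ≤ K' := Subobject.le_mk_of_comm (kernel.lift (q ≫ r) K.arrow (by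
    rw [cokernel.condition_assoc, zero_comp])) (kernel.lift_ι _ _ _)
  have hK'r : K'.arrow ≫ q ≫ r = 0 := by
    rw [← Subobject.underlyingIso_hom_comp_eq_mk, Category.assoc, kernel.condition, comp_zero]
  let p : (K' : T) ⟶ simpleSubobject hC :=
    Abelian.monoLift s (K'.arrow ≫ q) (by rw [Category.assoc, hK'r])
  have hp : p ≫ s = K'.arrow ≫ q := Abelian.monoLift_comp _ _ _
  refine hmax K' ?_ (lt_of_le_not_ge hle fun hge => ?_)
  · refine isFiniteLength_of_exact ((toIndModule F F' T).map (K.ofLE K' hle))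
      ((toIndModule F F' T).map p) (fun Z x hx => exists_of_elMap_toIndModule_eq_zero _ p ?_ ?_ x hx)
      hK (isFiniteLength_tObj_of_simple _)
    · rw [← cancel_mono s, Category.assoc, hp, Subobject.ofLE_arrow_assoc, cokernel.condition,
        zero_comp]
    · intro W k hk
      refine ⟨Abelian.monoLift K.arrow (k ≫ K'.arrow) ?_, ?_⟩
      · rw [Category.assoc, ← hp, reassoc_of% hk, zero_comp]
      · rw [← cancel_mono K'.arrow, Category.assoc, Subobject.ofLE_arrow, Abelian.monoLift_comp]
  -- Strictness of `K < K'`: otherwise the quotient map kills `K'`, hence the preimage of the simple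
  -- subobject. That preimage maps epimorphically onto the simple subobject, which would then be
  -- zero.
  · have hq : K'.arrow ≫ q = 0 := by
      rw [← Subobject.ofLE_arrow hge, Category.assoc, cokernel.condition, comp_zero]
    let l : pullback q s ⟶ kernel (q ≫ r) := kernel.lift _ (pullback.fst q s) (by
      rw [pullback.condition_assoc, cokernel.condition, comp_zero])
    have h1 : pullback.fst q s ≫ q = 0 := by
      have : pullback.fst q s = l ≫ (Subobject.underlyingIso _).inv ≫ K'.arrow := by
        rw [Subobject.underlyingIso_arrow, kernel.lift_ι]
      rw [this, Category.assoc, Category.assoc, hq, comp_zero, comp_zero]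
    rw [pullback.condition] at h1
    have h2 : s = 0 := by
      rw [← cancel_epi (pullback.snd q s), h1, comp_zero]
    apply id_nonzero (simpleSubobject hC)
    rw [← cancel_mono s, h2, comp_zero, comp_zero]

end Simple

/-! ### Presentations of modules of finite length by modules `t(X)`. -/

section Presentation

variable {M : IndModule F F' T}

/-- The image of `t(X) ⟶ M` is the submodule generated by the section `m`, because `t(X)` is
generated by its tautological section. -/
theorem gen_mem_iff {X : T} (m : El M X) (K : Subobject M) :
    imageSubobject (tHom m) ≤ K ↔ m ∈ memSub K X := by
  rw [imageSubobject_le_iff]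
  constructor
  · intro h
    have := h X (gen F F' X)
    rwa [elMap_tHom_gen] at this
  · intro h Z x
    induction x using tSections_induction with
    | zero => rw [_root_.map_zero]; exact zero_mem _
    | add x y hx hy => rw [_root_.map_add]; exact add_mem hx hy
    | smul_map a f =>
      rw [_root_.map_smul, LexPresheaf.Hom.naturality, elMap_tHom_gen]
      exact Submodule.smul_mem _ _ (memSub_map _ h)

/-- An `F'`-module of finite length is a quotient of some `t(X)`. -/
theorem exists_epi_tHom (hM : isFiniteLength _ M) : ∃ (X : T) (m : El M X), Epi (tHom m) := by
  obtain ⟨_, _⟩ := wellFounded_of_isFiniteLength hM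
  obtain ⟨_, ⟨X, m, rfl⟩, hmax⟩ := WellFounded.has_min (wellFounded_gt (α := Subobject M))
    {K | ∃ (X : T) (m : El M X), K = imageSubobject (tHom m)} ⟨_, 0, 0, rfl⟩
  refine ⟨X, m, epi_of_locSurj _ fun Y x => exists_of_mem_imageSubobject (tHom m) ?_⟩
  -- A single section over `X ⊞ Y` which restricts to `m` and to `x`. It generates a submodule
  -- containing both, so by maximality of the image of `tHom m` the section `x` already lies there.
  let m' : El M (X ⊞ Y) := (elems M).map biprod.fst m + (elems M).map biprod.snd x
  have hm : (elems M).map biprod.inl m' = m := by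
    rw [_root_.map_add, ← LexPresheaf.map_comp, ← LexPresheaf.map_comp, biprod.inl_fst,
      biprod.inl_snd, LexPresheaf.map_id, LexPresheaf.map_zero_hom, add_zero]
  have hx : (elems M).map biprod.inr m' = x := by
    rw [_root_.map_add, ← LexPresheaf.map_comp, ← LexPresheaf.map_comp, biprod.inr_fst,
      biprod.inr_snd, LexPresheaf.map_id, LexPresheaf.map_zero_hom, zero_add]
  have hm' := (gen_mem_iff m' _).1 le_rfl
  have hle : imageSubobject (tHom m) ≤ imageSubobject (tHom m') :=
    (gen_mem_iff m _).2 (hm ▸ memSub_map biprod.inl hm')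
  have heq := hle.lt_or_eq.resolve_left (hmax _ ⟨_, m', rfl⟩)
  rw [heq, ← hx]
  exact memSub_map biprod.inr hm'

/-- An `F'`-module of finite length has a presentation by modules `t(X)`. -/
theorem exists_presentation (hfl : ∀ X : T, isFiniteLength _ (tObj F F' X))
    (hM : isFiniteLength _ M) :
    ∃ (X₁ X₀ : T) (φ : tObj F F' X₁ ⟶ tObj F F' X₀) (p : tObj F F' X₀ ⟶ M) (_ : Epi p)
      (w : φ ≫ p = 0), Nonempty (IsColimit (CokernelCofork.ofπ p w)) := by
  obtain ⟨X₀, m, _⟩ := exists_epi_tHom hM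
  obtain ⟨X₁, k, _⟩ := exists_epi_tHom (isFiniteLength_of_mono (kernel.ι (tHom m)) (hfl X₀))
  have w : (tHom k ≫ kernel.ι (tHom m)) ≫ tHom m = 0 := by
    rw [Category.assoc, kernel.condition, comp_zero]
  refine ⟨X₁, X₀, tHom k ≫ kernel.ι (tHom m), tHom m, inferInstance, w,
    ⟨CokernelCofork.IsColimit.ofπ' _ w fun g hg => ⟨Abelian.epiDesc (tHom m) g ?_,
      Abelian.comp_epiDesc _ _ _⟩⟩⟩
  rw [← cancel_epi (tHom k), ← Category.assoc, hg, comp_zero]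

end Presentation

end ScalarExtension

end

/-! ### `ScalarExt` as an abelian category whose objects have finite length. -/

noncomputable section
namespace ScalarExtension

open MonoidalCategory

set_option linter.unusedSectionVars false

attribute [local instance] indPreadditive indLinear LexPresheaf.baseModule

section

variable {C : Type*} [Category* C] [HasZeroObject C]

instance : (isFiniteLength C).ContainsZero where
  exists_zero := ⟨_, isZero_zero C, isFiniteLength_of_isZero (isZero_zero C)⟩

instance : (isFiniteLength C).IsClosedUnderSubobjects where
  prop_of_mono f _ h := isFiniteLength_of_mono f h

end

variable {F F' : Type v} [Field F] [Field F'] [Algebra F F']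
variable {T : Type u} [Category.{v} T] [Abelian T] [Linear F T]

section AbelianScalarExt

instance : (isFiniteLength (IndModule F F' T)).IsClosedUnderQuotients where
  prop_of_epi f _ h := isFiniteLength_of_epi f h

theorem isFiniteLength_biprod {M N : IndModule F F' T} (hM : isFiniteLength _ M)
    (hN : isFiniteLength _ N) : isFiniteLength _ (M ⊞ N) :=
  isFiniteLength_of_exact biprod.inl biprod.snd
    (fun X x => exists_of_elMap_eq_zero_of_factors _ _ (fun k hk => ⟨k ≫ biprod.fst, by
      apply biprod.hom_ext <;> simp [hk]⟩) x) hM hN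

instance : (isFiniteLength (IndModule F F' T)).IsClosedUnderFiniteProducts := by
  have : (isFiniteLength (IndModule F F' T)).IsClosedUnderBinaryProducts := by
    refine .mk' ?_
    rintro _ ⟨K, hK⟩
    let e : K ≅ pair (K.obj ⟨WalkingPair.left⟩) (K.obj ⟨WalkingPair.right⟩) := diagramIsoPair K
    exact (isFiniteLength (IndModule F F' T)).prop_of_iso
      ((biprod.isoProd _ _) ≪≫ (HasLimit.isoOfNatIso e).symm)
      (isFiniteLength_biprod (hK ⟨WalkingPair.left⟩) (hK ⟨WalkingPair.right⟩))
  exact ObjectProperty.IsClosedUnderFiniteProducts.mk'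

instance : Abelian (ScalarExt F F' T) := inferInstance

theorem scalarExt_isAbelian : IsAbelian (ScalarExt F F' T) where
  has_finite_products := inferInstance
  has_kernels := inferInstance
  has_cokernels := inferInstance

variable {M N : ScalarExt F F' T}

instance mono_obj_hom (f : M ⟶ N) [Mono f] : Mono f.hom :=
  have := (isFiniteLength (IndModule F F' T)).preservesMonomorphisms_ι_of_isNormalEpiCategory
  inferInstanceAs (Mono ((isFiniteLength (IndModule F F' T)).ι.map f))

instance epi_obj_hom (f : M ⟶ N) [Epi f] : Epi f.hom :=
  have := (isFiniteLength (IndModule F F' T)).preservesEpimorphisms_ι_of_isNormalMonoCategory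
  inferInstanceAs (Epi ((isFiniteLength (IndModule F F' T)).ι.map f))

theorem epi_of_epi_obj_hom (f : M ⟶ N) [Epi f.hom] : Epi f :=
  (isFiniteLength (IndModule F F' T)).ι.epi_of_epi_map ‹Epi f.hom›

/-- The inclusion into all modules preserves monomorphisms and is full, so it reflects the order of
subobjects. The chain conditions are therefore inherited from the ambient category. -/
theorem isFiniteLength_scalarExt (M : ScalarExt F F' T) : isFiniteLength (ScalarExt F F' T) M := by
  obtain ⟨_, _⟩ := wellFounded_of_isFiniteLength M.property
  refine isFiniteLength_of_strictMono (fun K : Subobject M => Subobject.mk K.arrow.hom)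
    (Monotone.strictMono_of_injective ?_ ?_)
  · intro K K' h
    refine Subobject.mk_le_mk_of_comm (K.ofLE K' h).hom ?_
    rw [← ObjectProperty.FullSubcategory.comp_hom, Subobject.ofLE_arrow]
  · have key : ∀ K K' : Subobject M, Subobject.mk K.arrow.hom ≤ Subobject.mk K'.arrow.hom →
        K ≤ K' := by
      intro K K' h
      refine Subobject.le_of_comm (ObjectProperty.homMk (Subobject.ofMkLEMk _ _ h)) ?_
      ext1
      exact Subobject.ofMkLEMk_comp h
    exact fun K K' h => le_antisymm (key _ _ h.le) (key _ _ h.ge)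

end AbelianScalarExt

/-- Every object has a dual. -/
class HasDualObjects (C : Type*) [Category* C] [MonoidalCategory C] : Prop where
  exists_exactPairing (X : C) : ∃ Y : C, Nonempty (ExactPairing X Y)

/-! ### Exactness of the tensor product when objects have duals. -/

section Exactness

variable {C : Type*} [Category* C] [MonoidalCategory C] [SymmetricCategory C] [HasDualObjects C]

/-- Tensoring with the dual is adjoint to tensoring with `X` on both sides, because the symmetry
turns a dual on one side into a dual on the other. Hence tensoring is exact, and the shifts `H(- ⊗
Z)` of a presheaf satisfy the separation and gluing conditions again. -/
theorem isLeftAdjoint_tensorLeft (X : C) : (tensorLeft X).IsLeftAdjoint := by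
  obtain ⟨Y, ⟨h⟩⟩ := HasDualObjects.exists_exactPairing X
  have : ExactPairing Y X := BraidedCategory.exactPairing_swap X Y
  exact (tensorLeftAdjunction Y X).isLeftAdjoint

theorem isRightAdjoint_tensorLeft (X : C) : (tensorLeft X).IsRightAdjoint := by
  obtain ⟨Y, ⟨h⟩⟩ := HasDualObjects.exists_exactPairing X
  exact (tensorLeftAdjunction X Y).isRightAdjoint

theorem isLeftAdjoint_tensorRight (X : C) : (tensorRight X).IsLeftAdjoint :=
  have := isLeftAdjoint_tensorLeft X
  Functor.isLeftAdjoint_of_iso (BraidedCategory.tensorLeftIsoTensorRight X)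

theorem isRightAdjoint_tensorRight (X : C) : (tensorRight X).IsRightAdjoint :=
  have := isRightAdjoint_tensorLeft X
  Functor.isRightAdjoint_of_iso (BraidedCategory.tensorLeftIsoTensorRight X)

instance epi_whiskerRight_of_hasDualObjects {X Y : C} (f : X ⟶ Y) [Epi f] (Z : C) :
    Epi (f ▷ Z) :=
  have := isLeftAdjoint_tensorRight Z
  inferInstanceAs (Epi ((tensorRight Z).map f))

instance epi_whiskerLeft_of_hasDualObjects {X Y : C} (Z : C) (f : X ⟶ Y) [Epi f] :
    Epi (Z ◁ f) :=
  have := isLeftAdjoint_tensorLeft Z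
  inferInstanceAs (Epi ((tensorLeft Z).map f))

variable [Preadditive C] [HasKernels C] [MonoidalPreadditive C]

theorem exists_factor_kernel_whiskerRight {X Y : C} (f : X ⟶ Y) (Z : C) {W : C} (k : W ⟶ X ⊗ Z)
    (hk : k ≫ f ▷ Z = 0) : ∃ l, l ≫ kernel.ι f ▷ Z = k := by
  have := isRightAdjoint_tensorRight Z
  obtain ⟨l, hl⟩ := KernelFork.IsLimit.lift'
    (isLimitForkMapOfIsLimit' (tensorRight Z) (kernel.condition f) (kernelIsKernel f)) k hk
  exact ⟨l, hl⟩

theorem exists_factor_kernel_whiskerLeft {X Y : C} (f : X ⟶ Y) (Z : C) {W : C} (k : W ⟶ Z ⊗ X)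
    (hk : k ≫ Z ◁ f = 0) : ∃ l, l ≫ Z ◁ kernel.ι f = k := by
  have := isRightAdjoint_tensorLeft Z
  obtain ⟨l, hl⟩ := KernelFork.IsLimit.lift'
    (isLimitForkMapOfIsLimit' (tensorLeft Z) (kernel.condition f) (kernelIsKernel f)) k hk
  exact ⟨l, hl⟩

end Exactness

/-! ### Shifts of presheaves, bimorphisms, and universality of cokernels. -/

namespace LexPresheaf

variable [MonoidalCategory T] [SymmetricCategory T] [HasDualObjects T] [MonoidalPreadditive T]
  [MonoidalLinear F T]

/-- The presheaf `X ↦ H(X ⊗ Z)`. -/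
def shiftRight (H : LexPresheaf F F' T) (Z : T) : LexPresheaf F F' T where
  obj X := H.obj (X ⊗ Z)
  map f := H.map (f ▷ Z)
  map_id x := by rw [id_whiskerRight, H.map_id]
  map_comp f g x := by rw [comp_whiskerRight, H.map_comp]
  map_add f g x := by rw [MonoidalPreadditive.add_whiskerRight, H.map_add]
  map_smul a f x := by rw [MonoidalLinear.smul_whiskerRight, H.map_smul]
  sep e _ y h := H.sep _ y h
  glue e _ x h := H.glue (e ▷ Z) x fun W k hk => by
    obtain ⟨l, rfl⟩ := exists_factor_kernel_whiskerRight e Z k hk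
    rw [H.map_comp, h _ _ (kernel.condition e), _root_.map_zero]

/-- The presheaf `X ↦ H(Z ⊗ X)`. -/
def shiftLeft (Z : T) (H : LexPresheaf F F' T) : LexPresheaf F F' T where
  obj X := H.obj (Z ⊗ X)
  map f := H.map (Z ◁ f)
  map_id x := by rw [whiskerLeft_id, H.map_id]
  map_comp f g x := by rw [whiskerLeft_comp, H.map_comp]
  map_add f g x := by rw [MonoidalPreadditive.whiskerLeft_add, H.map_add]
  map_smul a f x := by rw [MonoidalLinear.whiskerLeft_smul, H.map_smul]
  sep e _ y h := H.sep _ y h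
  glue e _ x h := H.glue (Z ◁ e) x fun W k hk => by
    obtain ⟨l, rfl⟩ := exists_factor_kernel_whiskerLeft e Z k hk
    rw [H.map_comp, h _ _ (kernel.condition e), _root_.map_zero]

/-- A bilinear natural family of maps `M(X) × N(Y) → H(X ⊗ Y)`. -/
@[ext]
structure Bimor (M N H : LexPresheaf F F' T) where
  app : ∀ X Y : T, M.obj X →ₗ[F'] N.obj Y →ₗ[F'] H.obj (X ⊗ Y)
  naturality_left : ∀ {X X' : T} (f : X ⟶ X') (Y : T) (x : M.obj X') (y : N.obj Y),
    app X Y (M.map f x) y = H.map (f ▷ Y) (app X' Y x y)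
  naturality_right : ∀ (X : T) {Y Y' : T} (g : Y ⟶ Y') (x : M.obj X) (y : N.obj Y'),
    app X Y x (N.map g y) = H.map (X ◁ g) (app X Y' x y)

namespace Bimor

variable {M M' N N' H H' : LexPresheaf F F' T}

theorem ext_apply {β γ : Bimor M N H} (h : ∀ X Y x y, β.app X Y x y = γ.app X Y x y) : β = γ :=
  Bimor.ext (funext fun X => funext fun Y => LinearMap.ext₂ (h X Y))

/-- Composition with a morphism. -/
def comp (β : Bimor M N H) (α : H.Hom H') : Bimor M N H' where
  app X Y := (β.app X Y).compr₂ (α.app (X ⊗ Y))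
  naturality_left f Y x y := by
    simp only [LinearMap.compr₂_apply, β.naturality_left, α.naturality]
  naturality_right X _ _ g x y := by
    simp only [LinearMap.compr₂_apply, β.naturality_right, α.naturality]

@[simp]
theorem comp_app (β : Bimor M N H) (α : H.Hom H') (X Y : T) (x : M.obj X) (y : N.obj Y) :
    (β.comp α).app X Y x y = α.app _ (β.app X Y x y) := rfl

/-- Restriction along morphisms. -/
def precomp (β : Bimor M N H) (f : M'.Hom M) (g : N'.Hom N) : Bimor M' N' H where
  app X Y := (β.app X Y).compl₁₂ (f.app X) (g.app Y)
  naturality_left h Y x y := by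
    simp only [LinearMap.compl₁₂_apply, β.naturality_left, f.naturality]
  naturality_right X _ _ h x y := by
    simp only [LinearMap.compl₁₂_apply, β.naturality_right, g.naturality]

/-- Fixing the second variable. -/
def curryRight (β : Bimor M N H) {Y : T} (y : N.obj Y) : M.Hom (H.shiftRight Y) where
  app X := (β.app X Y).flip y
  naturality f x := β.naturality_left f Y x y

/-- Fixing the first variable. -/
def curryLeft (β : Bimor M N H) {X : T} (x : M.obj X) : N.Hom (H.shiftLeft X) where
  app Y := β.app X Y x
  naturality f y := β.naturality_right X f x y

/-- Construction from the morphisms obtained by fixing the second variable. -/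
def ofCurryRight (A : ∀ {Y : T}, N.obj Y → M.Hom (H.shiftRight Y))
    (add : ∀ {X Y : T} (x : M.obj X) (y y' : N.obj Y), (A (y + y')).app X x = (A y).app X x + (A y').app X x)
    (smul : ∀ {X Y : T} (x : M.obj X) (a : F') (y : N.obj Y),
      (A (a • y)).app X x = a • (A y).app X x)
    (nat : ∀ {X Y Y' : T} (x : M.obj X) (g : Y ⟶ Y') (y : N.obj Y'),
      (A (N.map g y)).app X x = H.map (X ◁ g) ((A y).app X x)) : Bimor M N H where
  app X _ := LinearMap.mk₂ F' (fun x y => (A y).app X x) (fun x x' y => ((A y).app X).map_add x x')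
    (fun a x y => ((A y).app X).map_smul a x) (fun x y y' => add x y y') (fun a x y => smul x a y)
  naturality_left f _ x y := (A y).naturality f x
  naturality_right _ _ _ g x y := nat x g y

/-- Exchange of the variables. -/
def swap (β : Bimor M N H) : Bimor N M H where
  app X Y := (((β.app Y X).compr₂ (H.map (β_ X Y).hom))).flip
  naturality_left f Y x y := by
    simp only [LinearMap.flip_apply, LinearMap.compr₂_apply, β.naturality_right, ← H.map_comp,
      BraidedCategory.braiding_naturality_left]
  naturality_right X _ _ g x y := by
    simp only [LinearMap.flip_apply, LinearMap.compr₂_apply, β.naturality_left, ← H.map_comp,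
      BraidedCategory.braiding_naturality_right]

@[simp]
theorem swap_app (β : Bimor M N H) (X Y : T) (x : N.obj X) (y : M.obj Y) :
    β.swap.app X Y x y = H.map (β_ X Y).hom (β.app Y X y x) := rfl

/-- Every bimorphism factors uniquely through `β`. -/
def IsUniversal (β : Bimor M N H) : Prop :=
  ∀ (H' : LexPresheaf F F' T) (γ : Bimor M N H'), ∃! α : H.Hom H', β.comp α = γ

theorem IsUniversal.hom_ext {β : Bimor M N H} (hβ : β.IsUniversal) {α α' : H.Hom H'}
    (h : ∀ X Y x y, α.app _ (β.app X Y x y) = α'.app _ (β.app X Y x y)) : α = α' :=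
  (hβ H' (β.comp α)).unique rfl (ext_apply fun X Y x y => (h X Y x y).symm)

/-- The morphism induced by a bimorphism. -/
def IsUniversal.desc {β : Bimor M N H} (hβ : β.IsUniversal) (γ : Bimor M N H') : H.Hom H' :=
  (hβ H' γ).choose

theorem IsUniversal.desc_app {β : Bimor M N H} (hβ : β.IsUniversal) (γ : Bimor M N H') {X Y : T}
    (x : M.obj X) (y : N.obj Y) : (hβ.desc γ).app _ (β.app X Y x y) = γ.app X Y x y :=
  congrArg (fun δ : Bimor M N H' => δ.app X Y x y) (hβ H' γ).choose_spec.1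

theorem IsUniversal.swap {β : Bimor M N H} (hβ : β.IsUniversal) : β.swap.IsUniversal := by
  intro H' γ
  refine ⟨hβ.desc γ.swap, ?_, fun α hα => hβ.hom_ext fun X Y x y => ?_⟩
  · refine ext_apply fun X Y x y => ?_
    rw [comp_app, swap_app, Hom.naturality, hβ.desc_app, swap_app, ← H'.map_comp,
      SymmetricCategory.symmetry, H'.map_id]
  · rw [hβ.desc_app, ← hα, swap_app, comp_app, swap_app, Hom.naturality, ← H'.map_comp,
      SymmetricCategory.symmetry, H'.map_id]

end Bimor

/-- `M₁ → M₀ → M → 0` is exact. -/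
structure RightExact {M₁ M₀ M : LexPresheaf F F' T} (φ : M₁.Hom M₀) (p : M₀.Hom M) : Prop where
  locSurj : p.LocSurj
  zero : ∀ X x, p.app X (φ.app X x) = 0
  exact : ∀ (X : T) (x : M₀.obj X), p.app X x = 0 →
    ∃ (Z : T) (e : Z ⟶ X) (_ : Epi e) (y : M₁.obj Z), φ.app Z y = M₀.map e x

/-- A section in the kernel of `p` comes from `M₁` after an epimorphism, and `P` is separated. -/
theorem RightExact.eq_zero {M₁ M₀ M P : LexPresheaf F F' T} {φ : M₁.Hom M₀} {p : M₀.Hom M}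
    (h : RightExact φ p) (α : M₀.Hom P) (hα : ∀ X x, α.app X (φ.app X x) = 0) {X : T} (x : M₀.obj X)
    (hx : p.app X x = 0) : α.app X x = 0 := by
  obtain ⟨Z, e, _, y, hy⟩ := h.exact X x hx
  refine P.sep e _ ?_
  rw [← α.naturality, ← hy, hα]

section Cokernel

variable {M₁ M₀ M N H₁ H₀ H : LexPresheaf F F' T} {φ : M₁.Hom M₀} {p : M₀.Hom M}
  {ψ : H₁.Hom H₀} {q : H₀.Hom H} {β₁ : Bimor M₁ N H₁} {β₀ : Bimor M₀ N H₀}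

/-- A bimorphism on `M₀` which kills `M₁` descends to `M`. -/
theorem RightExact.exists_bimor (h : RightExact φ p) (γ : Bimor M₀ N H)
    (hγ : ∀ X Y x y, γ.app X Y (φ.app X x) y = 0) :
    ∃ β : Bimor M N H, ∀ X Y x y, β.app X Y (p.app X x) y = γ.app X Y x y := by
  -- For fixed `y` the bimorphism is a morphism to the shift of `H` by `Y`, and morphisms descend
  -- along `p`. Since `p` is locally surjective, the descended morphisms are determined by their
  -- values on sections from `M₀`, so they inherit linearity and naturality in `y`.
  have key : ∀ {Y : T} (y : N.obj Y), ∃ α : M.Hom (H.shiftRight Y),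
      ∀ X x, α.app X (p.app X x) = γ.app X Y x y := fun {Y} y => by
    obtain ⟨α, hα⟩ := exists_desc h.locSurj (γ.curryRight y)
      (fun X x hx => h.eq_zero _ (fun X x => hγ X Y x y) x hx)
    exact ⟨α, fun X x => LinearMap.congr_fun (congrFun (congrArg Hom.app hα) X) x⟩
  choose A hA using @key
  refine ⟨.ofCurryRight A ?_ ?_ ?_, fun X Y x y => hA y X x⟩
  · intro X Y x y y'
    obtain ⟨Z, e, _, x', hx'⟩ := h.locSurj X x
    refine (H.shiftRight Y).sep' e ?_
    rw [← Hom.naturality, _root_.map_add, ← Hom.naturality, ← Hom.naturality, ← hx', hA, hA, hA,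
      _root_.map_add]
    rfl
  · intro X Y x a y
    obtain ⟨Z, e, _, x', hx'⟩ := h.locSurj X x
    refine (H.shiftRight Y).sep' e ?_
    rw [← Hom.naturality, _root_.map_smul, ← Hom.naturality, ← hx', hA, hA, _root_.map_smul]
    rfl
  · intro X Y Y' x g y
    obtain ⟨Z, e, _, x', hx'⟩ := h.locSurj X x
    refine (H.shiftRight Y).sep' e ?_
    have h1 := (A y).naturality e x
    rw [← hx', hA] at h1
    have key (z : H.obj (X ⊗ Y')) :
        H.map (Z ◁ g) (H.map (e ▷ Y') z) = H.map (e ▷ Y) (H.map (X ◁ g) z) := by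
      rw [← H.map_comp, ← H.map_comp, whisker_exchange]
    rw [← Hom.naturality, ← hx', hA, γ.naturality_right, h1]
    exact key _

/-- Universality passes to cokernels. -/
theorem RightExact.isUniversal (h : RightExact φ p) (hH : RightExact ψ q)
    (h₁ : β₁.IsUniversal) (h₀ : β₀.IsUniversal) (β : Bimor M N H)
    (hψ : ∀ X Y x y, ψ.app _ (β₁.app X Y x y) = β₀.app X Y (φ.app X x) y)
    (hq : ∀ X Y x y, q.app _ (β₀.app X Y x y) = β.app X Y (p.app X x) y) : β.IsUniversal := by
  intro H' γ
  let γ₀ : Bimor M₀ N H' := γ.precomp p ⟨fun _ => LinearMap.id, fun _ _ => rfl⟩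
  have hγ₀ : ∀ X Y x y, γ₀.app X Y x y = γ.app X Y (p.app X x) y := fun _ _ _ _ => rfl
  -- The induced morphism on `H₀` kills the image of `ψ`: by universality of `β₁` this may be
  -- checked on pure tensors, where it becomes the vanishing of `p` on the image of `φ`. It
  -- therefore descends to `H`.
  have hz : ψ.comp (h₀.desc γ₀) = ⟨fun _ => 0, fun _ _ => by simp⟩ := h₁.hom_ext fun X Y x y => by
    rw [Hom.comp_app, hψ, h₀.desc_app, hγ₀, h.zero, _root_.map_zero]
    rfl
  obtain ⟨α, hα⟩ := exists_desc hH.locSurj (h₀.desc γ₀) fun X x hx => hH.eq_zero _ (fun X x => by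
    exact LinearMap.congr_fun (congrFun (congrArg Hom.app hz) X) x) x hx
  have hloc : ∀ {α' : H.Hom H'} {X Y : T} (x : M.obj X) (y : N.obj Y),
      (∀ X Y x y, α'.app _ (q.app _ (β₀.app X Y x y)) = γ.app X Y (p.app X x) y) →
      α'.app _ (β.app X Y x y) = γ.app X Y x y := by
    intro α' X Y x y h'
    obtain ⟨Z, e, _, x', hx'⟩ := h.locSurj X x
    refine H'.sep' (e ▷ Y) ?_
    rw [← Hom.naturality, ← β.naturality_left, ← γ.naturality_left, ← hx', ← h', hq]
  refine ⟨α, Bimor.ext_apply fun X Y x y => hloc x y fun X Y x y => ?_, fun α' hα' =>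
    Hom.eq_of_locSurj hH.locSurj (h₀.hom_ext fun X Y x y => ?_)⟩
  · rw [← Hom.comp_app, hα, h₀.desc_app, hγ₀]
  · rw [hα, h₀.desc_app, hγ₀, Hom.comp_app, hq, ← Bimor.comp_app, hα']

end Cokernel

end LexPresheaf

end ScalarExtension

end

/-! ### Existence of the tensor product of modules of finite length. -/

noncomputable section
namespace ScalarExtension

open MonoidalCategory

set_option linter.unusedSectionVars false

attribute [local instance] indPreadditive indLinear LexPresheaf.baseModule

variable {F F' : Type v} [Field F] [Field F'] [Algebra F F']
variable {T : Type u} [Category.{v} T] [Abelian T] [Linear F T]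

theorem tDesc_smul_map {H : LexPresheaf F F' T} {X Z : T} (h : H.obj X) (a : F') (f : Z ⟶ X) :
    (tDesc h).app Z (a • (elems (tObj F F' X)).map f (gen F F' X)) = a • H.map f h := by
  rw [_root_.map_smul, LexPresheaf.Hom.naturality, tDesc_gen]

theorem tDesc_add {H : LexPresheaf F F' T} {X Z : T} (h h' : H.obj X) (w : El (tObj F F' X) Z) :
    (tDesc (h + h')).app Z w = (tDesc h).app Z w + (tDesc h').app Z w := by
  induction w using tSections_induction with
  | zero => simp
  | add x y hx hy => simp only [_root_.map_add, hx, hy]; abel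
  | smul_map a f => rw [tDesc_smul_map, tDesc_smul_map, tDesc_smul_map, _root_.map_add, smul_add]

theorem tDesc_smul {H : LexPresheaf F F' T} {X Z : T} (a : F') (h : H.obj X)
    (w : El (tObj F F' X) Z) : (tDesc (a • h)).app Z w = a • (tDesc h).app Z w := by
  induction w using tSections_induction with
  | zero => simp
  | add x y hx hy => simp only [_root_.map_add, hx, hy, smul_add]
  | smul_map b f => rw [tDesc_smul_map, tDesc_smul_map, _root_.map_smul, smul_comm]

section RightExact

variable {M₁ M₀ M : IndModule F F' T}

theorem rightExact_elMap (φ : M₁ ⟶ M₀) (p : M₀ ⟶ M) [Epi p] (w : φ ≫ p = 0)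
    (h : ∃ l, p ≫ l = cokernel.π φ) : LexPresheaf.RightExact (elMap φ) (elMap p) where
  locSurj := locSurj_of_epi p
  zero X x := by rw [← elMap_comp_app, w, elMap_zero_app]
  exact X x hx := by
    obtain ⟨l, hl⟩ := h
    have h1 : (elMap (cokernel.π φ)).app X x = 0 := by
      rw [← hl, elMap_comp_app, hx, _root_.map_zero]
    obtain ⟨y, rfl⟩ := exists_of_elMap_eq_zero_of_factors (Abelian.image.ι φ) (cokernel.π φ)
      (fun k hk => ⟨kernel.lift _ k hk, kernel.lift_ι _ _ _⟩) x h1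
    obtain ⟨Z, e, he, z, hz⟩ := locSurj_of_epi (Abelian.factorThruImage φ) X y
    refine ⟨Z, e, he, z, ?_⟩
    rw [← LexPresheaf.Hom.naturality, ← hz, ← elMap_comp_app, Abelian.image.fac]

theorem rightExact_cokernel (φ : M₁ ⟶ M₀) :
    LexPresheaf.RightExact (elMap φ) (elMap (cokernel.π φ)) :=
  rightExact_elMap φ _ (cokernel.condition φ) ⟨𝟙 _, Category.comp_id _⟩

theorem rightExact_of_isColimit (φ : M₁ ⟶ M₀) (p : M₀ ⟶ M) (w : φ ≫ p = 0)
    (h : IsColimit (CokernelCofork.ofπ p w)) : LexPresheaf.RightExact (elMap φ) (elMap p) := by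
  have : Epi p := Cofork.IsColimit.epi h
  obtain ⟨l, hl⟩ := CokernelCofork.IsColimit.desc' h (cokernel.π φ) (cokernel.condition φ)
  exact rightExact_elMap φ p w ⟨l, hl⟩

end RightExact

section Existence

variable [MonoidalCategory T] [SymmetricCategory T] [HasDualObjects T] [MonoidalPreadditive T]
  [MonoidalLinear F T]

open LexPresheaf

/-- Fix one variable at a time: the resulting morphisms go from `t(X)` or `t(Y)` to a shift of `H`,
and are determined by the tautological section. -/
theorem bimor_t_ext {X Y : T} {H : LexPresheaf F F' T}
    {β γ : Bimor (elems (tObj F F' X)) (elems (tObj F F' Y)) H}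
    (h : β.app X Y (gen F F' X) (gen F F' Y) = γ.app X Y (gen F F' X) (gen F F' Y)) : β = γ := by
  have h1 : β.curryLeft (gen F F' X) = γ.curryLeft (gen F F' X) := t_hom_ext h
  refine Bimor.ext_apply fun X' Y' x y => ?_
  have h2 : β.curryRight y = γ.curryRight y :=
    t_hom_ext (LinearMap.congr_fun (congrFun (congrArg Hom.app h1) Y') y)
  exact LinearMap.congr_fun (congrFun (congrArg Hom.app h2) X') x

/-- Shifts are functorial. -/
def shiftRightMap (H : LexPresheaf F F' T) {Y Y' : T} (g : Y ⟶ Y') :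
    (H.shiftRight Y').Hom (H.shiftRight Y) where
  app X := H.map (X ◁ g)
  naturality {X X'} f y := by
    change H.map (X ◁ g) (H.map (f ▷ Y') (show H.obj (X' ⊗ Y') from y)) =
      H.map (f ▷ Y) (H.map (X' ◁ g) (show H.obj (X' ⊗ Y') from y))
    rw [← H.map_comp, ← H.map_comp, whisker_exchange]

theorem tDesc_shiftRightMap {H : LexPresheaf F F' T} {X Y Y' : T} (g : Y ⟶ Y')
    (z : (H.shiftRight Y').obj X) {Z : T} (x : El (tObj F F' X) Z) :
    (tDesc (H := H.shiftRight Y) ((shiftRightMap H g).app X z)).app Z x =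
      (shiftRightMap H g).app Z ((tDesc z).app Z x) := by
  have : tDesc (H := H.shiftRight Y) ((shiftRightMap H g).app X z) =
      (tDesc z).comp (shiftRightMap H g) := t_hom_ext (by rw [Hom.comp_app, tDesc_gen, tDesc_gen])
  rw [this, Hom.comp_app]

/-- The bimorphism on `t(X)` and `t(Y)` defined by a section over `X ⊗ Y`. -/
def bimorOfSection {X Y : T} {H : LexPresheaf F F' T} (h : H.obj (X ⊗ Y)) :
    Bimor (elems (tObj F F' X)) (elems (tObj F F' Y)) H :=
  .ofCurryRight (fun {Y'} y => tDesc (H := H.shiftRight Y')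
      ((tDesc (H := H.shiftLeft X) (X := Y) h).app Y' y))
    (fun x y y' => by
      rw [_root_.map_add]
      exact tDesc_add _ _ _)
    (fun x a y => by
      rw [_root_.map_smul]
      exact tDesc_smul _ _ _)
    (fun {X' Y' Y''} x g y => by
      rw [Hom.naturality]
      exact tDesc_shiftRightMap _ _ _)

theorem bimorOfSection_gen {X Y : T} {H : LexPresheaf F F' T} (h : H.obj (X ⊗ Y)) :
    (bimorOfSection h).app X Y (gen F F' X) (gen F F' Y) = h := by
  exact (tDesc_gen (H := H.shiftRight Y) _).trans (tDesc_gen (H := H.shiftLeft X) h)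

/-- Both bimorphisms from `t(X)`, `t(Y)` to `H` and morphisms from `t(X ⊗ Y)` to `H` are given by
elements of `H(X ⊗ Y)`. The condition on the tautological sections makes composition with `β` this
identification. -/
theorem isUniversal_of_gen {X Y : T} (β : Bimor (elems (tObj F F' X)) (elems (tObj F F' Y))
      (elems (tObj F F' (X ⊗ Y))))
    (h : β.app X Y (gen F F' X) (gen F F' Y) = gen F F' (X ⊗ Y)) : β.IsUniversal := by
  intro H γ
  refine ⟨tDesc (γ.app X Y (gen F F' X) (gen F F' Y)), bimor_t_ext ?_, fun α hα => t_hom_ext ?_⟩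
  · rw [Bimor.comp_app, h, tDesc_gen]
  · rw [tDesc_gen, ← hα, Bimor.comp_app, h]

/-- The tensor product with a cokernel is constructed as the cokernel of the morphism between the
tensor products, which remains of finite length. -/
theorem exists_universal_of_rightExact {M₁ M₀ M : IndModule F F' T} (φ : M₁ ⟶ M₀) (p : M₀ ⟶ M)
    (h : RightExact (elMap φ) (elMap p)) {N : LexPresheaf F F' T}
    (h₁ : ∃ (P : IndModule F F' T) (β : Bimor (elems M₁) N (elems P)), β.IsUniversal)
    (h₀ : ∃ (P : IndModule F F' T) (_ : isFiniteLength _ P) (β : Bimor (elems M₀) N (elems P)),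
      β.IsUniversal) :
    ∃ (P : IndModule F F' T) (_ : isFiniteLength _ P) (β : Bimor (elems M) N (elems P)),
      β.IsUniversal := by
  obtain ⟨P₁, β₁, h₁⟩ := h₁
  obtain ⟨P₀, hP₀, β₀, h₀⟩ := h₀
  let γ : Bimor (elems M₁) N (elems P₀) :=
    β₀.precomp (elMap φ) ⟨fun _ => LinearMap.id, fun _ _ => rfl⟩
  let ψ : P₁ ⟶ P₀ := homOfLexHom (h₁.desc γ)
  have hψ : ∀ X Y x y, (elMap ψ).app _ (β₁.app X Y x y) = β₀.app X Y ((elMap φ).app X x) y := by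
    intro X Y x y
    rw [elMap_homOfLexHom, h₁.desc_app]
    rfl
  have hc := rightExact_cokernel ψ
  obtain ⟨β, hβ⟩ := h.exists_bimor (β₀.comp (elMap (cokernel.π ψ))) fun X Y x y => by
    rw [Bimor.comp_app, ← hψ, hc.zero]
  exact ⟨cokernel ψ, isFiniteLength_of_epi (cokernel.π ψ) hP₀, β,
    h.isUniversal hc h₁ h₀ β hψ fun X Y x y => (hβ X Y x y).symm⟩

/-- The modules `t(X)` have finite length. -/
class IsFiniteScalarExt (F F' : Type v) [Field F] [Field F'] [Algebra F F']
    (T : Type u) [Category.{v} T] [Abelian T] [Linear F T] : Prop where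
  isFiniteLength (X : T) : isFiniteLength _ ((toIndModule F F' T).obj X)

variable [IsFiniteScalarExt F F' T]

theorem exists_universal (M N : ScalarExt F F' T) : ∃ (P : ScalarExt F F' T)
    (β : Bimor (elems M.obj) (elems N.obj) (elems P.obj)), β.IsUniversal := by
  suffices h : ∃ (P : IndModule F F' T) (_ : isFiniteLength _ P)
      (β : Bimor (elems M.obj) (elems N.obj) (elems P)), β.IsUniversal by
    obtain ⟨P, hP, h⟩ := h
    exact ⟨⟨P, hP⟩, h⟩
  have hfl : ∀ X : T, isFiniteLength _ (tObj F F' X) := IsFiniteScalarExt.isFiniteLength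
  have step : ∀ {M : IndModule F F' T} (_ : isFiniteLength _ M) (N : LexPresheaf F F' T)
      (_ : ∀ X : T, ∃ (P : IndModule F F' T) (_ : isFiniteLength _ P)
        (β : Bimor (elems (tObj F F' X)) N (elems P)), β.IsUniversal),
      ∃ (P : IndModule F F' T) (_ : isFiniteLength _ P)
        (β : Bimor (elems M) N (elems P)), β.IsUniversal := by
    intro M hM N h
    obtain ⟨X₁, X₀, φ, p, _, w, ⟨hp⟩⟩ := exists_presentation hfl hM
    obtain ⟨P₁, _, h₁⟩ := h X₁
    exact exists_universal_of_rightExact φ p (rightExact_of_isColimit φ p w hp) ⟨P₁, h₁⟩ (h X₀)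
  refine step M.property _ fun X => ?_
  -- The second variable is treated by resolving `N` in the first variable against `t(X)` and
  -- exchanging the factors. This leaves only the tensor products of `t(Y)` with `t(X)`.
  obtain ⟨P, hP, β, hβ⟩ := step N.property (elems (tObj F F' X)) fun Y =>
    ⟨_, hfl _, bimorOfSection (gen F F' (Y ⊗ X)), isUniversal_of_gen _ (bimorOfSection_gen _)⟩
  exact ⟨P, hP, β.swap, hβ.swap⟩

end Existence

end ScalarExtension

end

/-! ### The symmetric monoidal structure on `ScalarExt` and the tensor functor `t`. -/

noncomputable section
namespace ScalarExtension

open MonoidalCategory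

set_option linter.unusedSectionVars false

attribute [local instance] indPreadditive indLinear LexPresheaf.baseModule

variable {F F' : Type v} [Field F] [Field F'] [Algebra F F']
variable {T : Type u} [Category.{v} T] [Abelian T] [Linear F T]

/-- The effect of a morphism on sections. -/
def act {M N : ScalarExt F F' T} (f : M ⟶ N) : (elems M.obj).Hom (elems N.obj) := elMap f.hom

section Act

variable {M N P : ScalarExt F F' T} {X : T}

@[simp]
theorem act_id (x : El M.obj X) : (act (𝟙 M)).app X x = x := elMap_id_app x

@[simp]
theorem act_comp (f : M ⟶ N) (g : N ⟶ P) (x : El M.obj X) :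
    (act (f ≫ g)).app X x = (act g).app X ((act f).app X x) := elMap_comp_app _ _ _

@[simp]
theorem act_add (f g : M ⟶ N) (x : El M.obj X) :
    (act (f + g)).app X x = (act f).app X x + (act g).app X x := elMap_add_app _ _ _

@[simp]
theorem act_smul (a : F') (f : M ⟶ N) (x : El M.obj X) :
    (act (a • f)).app X x = a • (act f).app X x := elMap_smul_app _ _ _

@[simp]
theorem act_zero (x : El M.obj X) : (act (0 : M ⟶ N)).app X x = 0 := elMap_zero_app x

theorem act_injective {f g : M ⟶ N} (h : act f = act g) : f = g :=
  ObjectProperty.hom_ext _ (elMap_injective fun X x => by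
    exact LinearMap.congr_fun (congrFun (congrArg LexPresheaf.Hom.app h) X) x)

/-- The morphism with given effect on sections. -/
def ofAct (α : (elems M.obj).Hom (elems N.obj)) : M ⟶ N := ObjectProperty.homMk (homOfLexHom α)

@[simp]
theorem act_ofAct (α : (elems M.obj).Hom (elems N.obj)) : act (ofAct α) = α :=
  elMap_homOfLexHom α

/-- The cokernel of the underlying modules is a quotient of a module of finite length, so it lies in
`ScalarExt`. A cokernel there is thus a cokernel of modules, which gives exactness on sections up to
refinement. -/
theorem rightExact_act {M₁ M₀ M : ScalarExt F F' T} (φ : M₁ ⟶ M₀) (p : M₀ ⟶ M) (w : φ ≫ p = 0)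
    (h : IsColimit (CokernelCofork.ofπ p w)) : LexPresheaf.RightExact (act φ) (act p) := by
  have : Epi p := Cofork.IsColimit.epi h
  let c : ScalarExt F F' T := ⟨cokernel φ.hom, isFiniteLength_of_epi (cokernel.π φ.hom) M₀.property⟩
  let π : M₀ ⟶ c := ObjectProperty.homMk (cokernel.π φ.hom)
  obtain ⟨l, hl⟩ := CokernelCofork.IsColimit.desc' h π
    (ObjectProperty.hom_ext _ (cokernel.condition φ.hom))
  exact rightExact_elMap φ.hom p.hom (congrArg (fun f => f.hom) w)
    ⟨l.hom, congrArg (fun f => f.hom) hl⟩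

end Act

section Monoidal

variable [MonoidalCategory T] [SymmetricCategory T] [HasDualObjects T] [MonoidalPreadditive T]
  [MonoidalLinear F T] [IsFiniteScalarExt F F' T]

open LexPresheaf

namespace LexPresheaf

variable {M N H : LexPresheaf F F' T}

instance : Add (M.Hom N) :=
  ⟨fun α β => ⟨fun X => α.app X + β.app X, fun f y => by
    simp only [LinearMap.add_apply, α.naturality, β.naturality, _root_.map_add]⟩⟩

instance : SMul F' (M.Hom N) :=
  ⟨fun a α => ⟨fun X => a • α.app X, fun f y => by
    simp only [LinearMap.smul_apply, α.naturality, _root_.map_smul]⟩⟩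

theorem Hom.add_app (α β : M.Hom N) {X : T} (x : M.obj X) :
    (α + β).app X x = α.app X x + β.app X x := rfl

theorem Hom.smul_app (a : F') (α : M.Hom N) {X : T} (x : M.obj X) :
    (a • α).app X x = a • α.app X x := rfl

/-- Shifts are functorial. -/
def shiftLeftMap (H : LexPresheaf F F' T) {Y Y' : T} (g : Y ⟶ Y') :
    (H.shiftLeft Y').Hom (H.shiftLeft Y) where
  app X := H.map (g ▷ X)
  naturality {X X'} f y := by
    change H.map (g ▷ X) (H.map (Y' ◁ f) (show H.obj (Y' ⊗ X') from y)) =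
      H.map (Y ◁ f) (H.map (g ▷ X') (show H.obj (Y' ⊗ X') from y))
    rw [← H.map_comp, ← H.map_comp, whisker_exchange]

namespace Bimor

/-- Construction from a linear family of morphisms, obtained by fixing the second variable. -/
def ofCurryRight' (A : ∀ {Y : T}, N.obj Y → M.Hom (H.shiftRight Y))
    (add : ∀ {Y : T} (y y' : N.obj Y), A (y + y') = A y + A y')
    (smul : ∀ {Y : T} (a : F') (y : N.obj Y), A (a • y) = a • A y)
    (nat : ∀ {Y Y' : T} (g : Y ⟶ Y') (y : N.obj Y'),
      A (N.map g y) = (A y).comp (shiftRightMap H g)) : Bimor M N H :=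
  ofCurryRight A (fun x y y' => by rw [add, Hom.add_app]) (fun x a y => by rw [smul, Hom.smul_app])
    (fun x g y => by rw [nat]; rfl)

/-- Construction from a linear family of morphisms, obtained by fixing the first variable. -/
def ofCurryLeft (A : ∀ {X : T}, M.obj X → N.Hom (H.shiftLeft X))
    (add : ∀ {X : T} (x x' : M.obj X), A (x + x') = A x + A x')
    (smul : ∀ {X : T} (a : F') (x : M.obj X), A (a • x) = a • A x)
    (nat : ∀ {X X' : T} (g : X ⟶ X') (x : M.obj X'),
      A (M.map g x) = (A x).comp (shiftLeftMap H g)) : Bimor M N H where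
  app X Y := LinearMap.mk₂ F' (fun x y => (A x).app Y y)
    (fun x x' y => by rw [add]; rfl) (fun a x y => by rw [smul]; rfl)
    (fun x y y' => ((A x).app Y).map_add y y') (fun a x y => ((A x).app Y).map_smul a y)
  naturality_left f Y x y := by
    change (A _).app Y y = _
    rw [nat]
    rfl
  naturality_right X _ _ g x y := (A x).naturality g y

end Bimor

end LexPresheaf

/-- `t(X)` as an object of the scalar extension. -/
abbrev tFin (X : T) : ScalarExt F F' T := ⟨tObj F F' X, IsFiniteScalarExt.isFiniteLength X⟩

namespace ScalarExt

/-- The tensor product. -/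
def tens (M N : ScalarExt F F' T) : ScalarExt F F' T := (exists_universal M N).choose

/-- The universal bimorphism. -/
def univ (M N : ScalarExt F F' T) : Bimor (elems M.obj) (elems N.obj) (elems (tens M N).obj) :=
  (exists_universal M N).choose_spec.choose

theorem univ_isUniversal (M N : ScalarExt F F' T) : (univ M N).IsUniversal :=
  (exists_universal M N).choose_spec.choose_spec

/-- The pure tensor of two sections. -/
def pure {M N : ScalarExt F F' T} {X Y : T} (x : El M.obj X) (y : El N.obj Y) :
    El (tens M N).obj (X ⊗ Y) := (univ M N).app X Y x y

variable {M N P Q M' N' P' Q' : ScalarExt F F' T}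

theorem map_left_pure {X X' Y : T} (f : X ⟶ X') (x : El M.obj X') (y : El N.obj Y) :
    pure ((elems M.obj).map f x) y = (elems _).map (f ▷ Y) (pure x y) :=
  (univ M N).naturality_left f Y x y

theorem map_right_pure {X Y Y' : T} (g : Y ⟶ Y') (x : El M.obj X) (y : El N.obj Y') :
    pure x ((elems N.obj).map g y) = (elems _).map (X ◁ g) (pure x y) :=
  (univ M N).naturality_right X g x y

/-- The morphism from a tensor product defined by a bimorphism. -/
def lift (γ : Bimor (elems M.obj) (elems N.obj) (elems Q.obj)) : tens M N ⟶ Q :=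
  ofAct ((univ_isUniversal M N).desc γ)

@[simp]
theorem act_lift_pure (γ : Bimor (elems M.obj) (elems N.obj) (elems Q.obj)) {X Y : T}
    (x : El M.obj X) (y : El N.obj Y) : (act (lift γ)).app _ (pure x y) = γ.app X Y x y := by
  rw [lift, act_ofAct]
  exact (univ_isUniversal M N).desc_app γ x y

theorem lex_ext₂ {H : LexPresheaf F F' T} {α α' : (elems (tens M N).obj).Hom H}
    (h : ∀ X Y (x : El M.obj X) (y : El N.obj Y), α.app _ (pure x y) = α'.app _ (pure x y)) :
    α = α' := (univ_isUniversal M N).hom_ext h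

/-- With `z` fixed, both sides are morphisms from `tens M N` to a shift of `H`, to which
universality applies. This is why universality is demanded against all presheaves and not only
against modules. -/
theorem lex_ext₃ {H : LexPresheaf F F' T} {α α' : (elems (tens (tens M N) P).obj).Hom H}
    (h : ∀ X Y Z (x : El M.obj X) (y : El N.obj Y) (z : El P.obj Z),
      α.app _ (pure (pure x y) z) = α'.app _ (pure (pure x y) z)) : α = α' :=
  lex_ext₂ fun W Z w z => by
    have : ((univ _ P).comp α).curryRight z = ((univ _ P).comp α').curryRight z :=
      lex_ext₂ fun X Y x y => h X Y Z x y z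
    exact LinearMap.congr_fun (congrFun (congrArg Hom.app this) W) w

theorem lex_ext₃' {H : LexPresheaf F F' T} {α α' : (elems (tens M (tens N P)).obj).Hom H}
    (h : ∀ X Y Z (x : El M.obj X) (y : El N.obj Y) (z : El P.obj Z),
      α.app _ (pure x (pure y z)) = α'.app _ (pure x (pure y z))) : α = α' :=
  lex_ext₂ fun X W x w => by
    have : ((univ M _).comp α).curryLeft x = ((univ M _).comp α').curryLeft x :=
      lex_ext₂ fun Y Z y z => h X Y Z x y z
    exact LinearMap.congr_fun (congrFun (congrArg Hom.app this) W) w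

theorem lex_ext₄ {H : LexPresheaf F F' T} {α α' : (elems (tens (tens (tens M N) P) Q).obj).Hom H}
    (h : ∀ X Y Z W (x : El M.obj X) (y : El N.obj Y) (z : El P.obj Z) (w : El Q.obj W),
      α.app _ (pure (pure (pure x y) z) w) = α'.app _ (pure (pure (pure x y) z) w)) : α = α' :=
  lex_ext₂ fun V W v w => by
    have : ((univ _ Q).comp α).curryRight w = ((univ _ Q).comp α').curryRight w :=
      lex_ext₃ fun X Y Z x y z => h X Y Z W x y z w
    exact LinearMap.congr_fun (congrFun (congrArg Hom.app this) V) v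

theorem lex_ext_left_t {U : T} {H : LexPresheaf F F' T}
    {α α' : (elems (tens (tFin U) N).obj).Hom H}
    (h : ∀ Y (y : El N.obj Y), α.app _ (pure (gen F F' U : El (tFin U).obj U) y) =
      α'.app _ (pure (gen F F' U : El (tFin U).obj U) y)) : α = α' :=
  lex_ext₂ fun X Y x y => by
    have : ((univ _ N).comp α).curryRight y = ((univ _ N).comp α').curryRight y :=
      t_hom_ext (h Y y)
    exact LinearMap.congr_fun (congrFun (congrArg Hom.app this) X) x

theorem lex_ext_right_t {U : T} {H : LexPresheaf F F' T}
    {α α' : (elems (tens N (tFin U)).obj).Hom H}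
    (h : ∀ Y (y : El N.obj Y), α.app _ (pure y (gen F F' U : El (tFin U).obj U)) =
      α'.app _ (pure y (gen F F' U : El (tFin U).obj U))) : α = α' :=
  lex_ext₂ fun Y X y x => by
    have : ((univ N _).comp α).curryLeft y = ((univ N _).comp α').curryLeft y :=
      t_hom_ext (h Y y)
    exact LinearMap.congr_fun (congrFun (congrArg Hom.app this) X) x

/-- Functoriality of the tensor product. -/
def tensMap (f : M ⟶ M') (g : N ⟶ N') : tens M N ⟶ tens M' N' :=
  lift ((univ M' N').precomp (act f) (act g))

@[simp]
theorem act_tensMap_pure (f : M ⟶ M') (g : N ⟶ N') {X Y : T} (x : El M.obj X) (y : El N.obj Y) :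
    (act (tensMap f g)).app _ (pure x y) = pure ((act f).app X x) ((act g).app Y y) :=
  act_lift_pure _ x y

/-- Fixing the last variable in a triple product. -/
def assocAux {Z : T} (z : El P.obj Z) :
    (elems (tens M N).obj).Hom ((elems (tens M (tens N P)).obj).shiftRight Z) :=
  (univ_isUniversal M N).desc
    { app := fun X Y => ((univ M (tens N P)).app X (Y ⊗ Z)).compl₂ (((univ N P).app Y Z).flip z) |>.compr₂
        ((elems _).map (α_ X Y Z).hom)
      naturality_left := fun {X X'} f Y x y => by
        change (elems _).map _ (pure _ (pure _ _)) =
          (elems _).map (f ▷ Y ▷ Z) ((elems _).map _ (pure _ (pure _ _)))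
        rw [map_left_pure, ← LexPresheaf.map_comp, ← LexPresheaf.map_comp,
          associator_naturality_left]
      naturality_right := fun X {Y Y'} g x y => by
        change (elems _).map _ (pure _ (pure _ _)) =
          (elems _).map ((X ◁ g) ▷ Z) ((elems _).map _ (pure _ (pure _ _)))
        rw [map_left_pure, map_right_pure, ← LexPresheaf.map_comp, ← LexPresheaf.map_comp,
          associator_naturality_middle] }

theorem assocAux_pure {X Y Z : T} (x : El M.obj X) (y : El N.obj Y) (z : El P.obj Z) :
    (assocAux z).app _ (pure x y) = (elems _).map (α_ X Y Z).hom (pure x (pure y z)) :=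
  (univ_isUniversal M N).desc_app _ x y

/-- Fixing the first variable in a triple product. -/
def assocInvAux {X : T} (x : El M.obj X) :
    (elems (tens N P).obj).Hom ((elems (tens (tens M N) P).obj).shiftLeft X) :=
  (univ_isUniversal N P).desc
    { app := fun Y Z => ((univ (tens M N) P).app (X ⊗ Y) Z).comp ((univ M N).app X Y x) |>.compr₂
        ((elems _).map (α_ X Y Z).inv)
      naturality_left := fun {Y Y'} f Z y z => by
        change (elems _).map _ (pure (pure _ _) _) =
          (elems _).map (X ◁ f ▷ Z) ((elems _).map _ (pure (pure _ _) _))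
        rw [map_right_pure, map_left_pure, ← LexPresheaf.map_comp, ← LexPresheaf.map_comp,
          associator_inv_naturality_middle]
      naturality_right := fun Y {Z Z'} g y z => by
        change (elems _).map _ (pure (pure _ _) _) =
          (elems _).map (X ◁ Y ◁ g) ((elems _).map _ (pure (pure _ _) _))
        rw [map_right_pure, ← LexPresheaf.map_comp, ← LexPresheaf.map_comp,
          associator_inv_naturality_right] }

theorem assocInvAux_pure {X Y Z : T} (x : El M.obj X) (y : El N.obj Y) (z : El P.obj Z) :
    (assocInvAux x).app _ (pure y z) = (elems _).map (α_ X Y Z).inv (pure (pure x y) z) :=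
  (univ_isUniversal N P).desc_app _ y z

/-- The associativity constraint. -/
def assocHom (M N P : ScalarExt F F' T) : tens (tens M N) P ⟶ tens M (tens N P) :=
  lift (.ofCurryRight' assocAux
    (fun z z' => lex_ext₂ fun X Y x y => by
      rw [Hom.add_app, assocAux_pure, assocAux_pure, assocAux_pure]
      simp only [pure, _root_.map_add]
      rfl)
    (fun a z => lex_ext₂ fun X Y x y => by
      rw [Hom.smul_app, assocAux_pure, assocAux_pure]
      simp only [pure, _root_.map_smul]
      rfl)
    (fun {Z Z'} g z => lex_ext₂ fun X Y x y => by
      rw [Hom.comp_app, assocAux_pure, assocAux_pure]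
      change _ = (elems _).map ((X ⊗ Y) ◁ g) ((elems _).map _ (pure _ (pure _ _)))
      rw [map_right_pure, map_right_pure, ← LexPresheaf.map_comp, ← LexPresheaf.map_comp,
        associator_naturality_right]))

@[simp]
theorem act_assocHom_pure {X Y Z : T} (x : El M.obj X) (y : El N.obj Y) (z : El P.obj Z) :
    (act (assocHom M N P)).app _ (pure (pure x y) z) =
      (elems _).map (α_ X Y Z).hom (pure x (pure y z)) :=
  (act_lift_pure _ _ _).trans (assocAux_pure x y z)

/-- The inverse of the associativity constraint. -/
def assocInv (M N P : ScalarExt F F' T) : tens M (tens N P) ⟶ tens (tens M N) P :=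
  lift (.ofCurryLeft assocInvAux
    (fun x x' => lex_ext₂ fun Y Z y z => by
      rw [Hom.add_app, assocInvAux_pure, assocInvAux_pure, assocInvAux_pure]
      simp only [pure, _root_.map_add, LinearMap.add_apply]
      rfl)
    (fun a z => lex_ext₂ fun X Y x y => by
      rw [Hom.smul_app, assocInvAux_pure, assocInvAux_pure]
      simp only [pure, _root_.map_smul, LinearMap.smul_apply]
      rfl)
    (fun {X X'} g x => lex_ext₂ fun Y Z y z => by
      rw [Hom.comp_app, assocInvAux_pure, assocInvAux_pure]
      change _ = (elems _).map (g ▷ (Y ⊗ Z)) ((elems _).map _ (pure (pure _ _) _))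
      rw [map_left_pure, map_left_pure, ← LexPresheaf.map_comp, ← LexPresheaf.map_comp,
        associator_inv_naturality_left]))

@[simp]
theorem act_assocInv_pure {X Y Z : T} (x : El M.obj X) (y : El N.obj Y) (z : El P.obj Z) :
    (act (assocInv M N P)).app _ (pure x (pure y z)) =
      (elems _).map (α_ X Y Z).inv (pure (pure x y) z) :=
  (act_lift_pure _ _ _).trans (assocInvAux_pure x y z)

theorem map_hom_map_inv {H : LexPresheaf F F' T} {X Y : T} (e : X ≅ Y) (x : H.obj X) :
    H.map e.hom (H.map e.inv x) = x := by
  rw [← H.map_comp, e.hom_inv_id, H.map_id]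

theorem map_inv_map_hom {H : LexPresheaf F F' T} {X Y : T} (e : X ≅ Y) (x : H.obj Y) :
    H.map e.inv (H.map e.hom x) = x := by
  rw [← H.map_comp, e.inv_hom_id, H.map_id]

/-- The associativity constraint, as an isomorphism. -/
def assocIso (M N P : ScalarExt F F' T) : tens (tens M N) P ≅ tens M (tens N P) where
  hom := assocHom M N P
  inv := assocInv M N P
  hom_inv_id := act_injective <| lex_ext₃ fun X Y Z x y z => by
    rw [act_comp, act_assocHom_pure, Hom.naturality, act_assocInv_pure, map_hom_map_inv, act_id]
  inv_hom_id := act_injective <| lex_ext₃' fun X Y Z x y z => by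
    rw [act_comp, act_assocInv_pure, Hom.naturality, act_assocHom_pure, map_inv_map_hom, act_id]

/-- The unit object. -/
abbrev one : ScalarExt F F' T := tFin (𝟙_ T)

/-- The tautological section of the unit. -/
def oneGen : El (one (F := F) (F' := F') (T := T)).obj (𝟙_ T) := gen F F' (𝟙_ T)

/-- A section of `M` over `Y`, as a section over `𝟙 ⊗ Y`. -/
def leftSection {Y : T} : (elems M.obj).obj Y →ₗ[F'] ((elems M.obj).shiftRight Y).obj (𝟙_ T) :=
  (elems M.obj).map (λ_ Y).hom

theorem leftSection_map {Y Y' : T} (g : Y ⟶ Y') (m : (elems M.obj).obj Y') :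
    leftSection ((elems M.obj).map g m) =
      (shiftRightMap (elems M.obj) g).app (𝟙_ T) (leftSection m) := by
  change (elems _).map (λ_ Y).hom _ = (elems _).map (𝟙_ T ◁ g) ((elems _).map (λ_ Y').hom _)
  rw [← LexPresheaf.map_comp, ← LexPresheaf.map_comp, leftUnitor_naturality]

/-- The left unit constraint. -/
def leftHom (M : ScalarExt F F' T) : tens one M ⟶ M :=
  lift (.ofCurryRight' (fun {Y} m => tDesc (leftSection m))
    (fun {Y} m m' => t_hom_ext (by
      rw [tDesc_gen, Hom.add_app, tDesc_gen, tDesc_gen, _root_.map_add]))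
    (fun {Y} a m => t_hom_ext (by
      rw [tDesc_gen, Hom.smul_app, tDesc_gen, _root_.map_smul]))
    (fun {Y Y'} g m => t_hom_ext (by
      rw [tDesc_gen, Hom.comp_app, tDesc_gen, leftSection_map])))

@[simp]
theorem act_leftHom_pure {X : T} (x : El M.obj X) :
    (act (leftHom M)).app _ (pure oneGen x) = (elems _).map (λ_ X).hom x :=
  (act_lift_pure _ _ _).trans (tDesc_gen (leftSection x))

/-- The inverse of the left unit constraint. -/
def leftInv (M : ScalarExt F F' T) : M ⟶ tens one M :=
  ofAct
    { app := fun X => ((elems _).map (λ_ X).inv).comp ((univ one M).app _ X oneGen)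
      naturality := fun {X Y} f y => by
        change (elems _).map _ (pure _ _) = (elems _).map _ ((elems _).map _ (pure _ _))
        rw [map_right_pure, ← LexPresheaf.map_comp, ← LexPresheaf.map_comp,
          leftUnitor_inv_naturality] }

theorem act_leftInv {X : T} (x : El M.obj X) :
    (act (leftInv M)).app X x = (elems _).map (λ_ X).inv (pure oneGen x) := by
  rw [leftInv, act_ofAct]
  rfl

/-- The left unit constraint, as an isomorphism. -/
def leftIso (M : ScalarExt F F' T) : tens one M ≅ M where
  hom := leftHom M
  inv := leftInv M
  hom_inv_id := act_injective <| lex_ext_left_t fun Y y => by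
    change (act (leftHom M ≫ leftInv M)).app _ (pure oneGen y) = (act (𝟙 _)).app _ (pure oneGen y)
    rw [act_comp, act_id, act_leftHom_pure, Hom.naturality, act_leftInv, map_hom_map_inv]
  inv_hom_id := act_injective <| Hom.ext_apply fun X x => by
    rw [act_comp, act_leftInv, Hom.naturality, act_leftHom_pure, map_inv_map_hom, act_id]

/-- The commutativity constraint. -/
def braidHom (M N : ScalarExt F F' T) : tens M N ⟶ tens N M := lift (univ N M).swap

@[simp]
theorem act_braidHom_pure {X Y : T} (x : El M.obj X) (y : El N.obj Y) :
    (act (braidHom M N)).app _ (pure x y) = (elems _).map (β_ X Y).hom (pure y x) :=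
  act_lift_pure _ x y

theorem braidHom_braidHom (M N : ScalarExt F F' T) : braidHom M N ≫ braidHom N M = 𝟙 _ :=
  act_injective <| lex_ext₂ fun X Y x y => by
    rw [act_comp, act_braidHom_pure, Hom.naturality, act_braidHom_pure, ← LexPresheaf.map_comp,
      SymmetricCategory.symmetry, LexPresheaf.map_id, act_id]

/-- The commutativity constraint, as an isomorphism. -/
def braidIso (M N : ScalarExt F F' T) : tens M N ≅ tens N M where
  hom := braidHom M N
  inv := braidHom N M
  hom_inv_id := braidHom_braidHom M N
  inv_hom_id := braidHom_braidHom N M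

/-- The right unit constraint, as an isomorphism. -/
def rightIso (M : ScalarExt F F' T) : tens M one ≅ M := braidIso M one ≪≫ leftIso M

theorem act_rightIso_pure {X : T} (x : El M.obj X) :
    (act (rightIso M).hom).app _ (pure x oneGen) = (elems _).map (ρ_ X).hom x := by
  change (act (braidHom M one ≫ leftHom M)).app _ _ = _
  rw [act_comp, act_braidHom_pure, Hom.naturality, act_leftHom_pure, ← LexPresheaf.map_comp,
    braiding_leftUnitor]

theorem act_assocIso_pure {X Y Z : T} (x : El M.obj X) (y : El N.obj Y) (z : El P.obj Z) :
    (act (assocIso M N P).hom).app _ (pure (pure x y) z) =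
      (elems _).map (α_ X Y Z).hom (pure x (pure y z)) := act_assocHom_pure x y z

theorem act_assocIso_inv_pure {X Y Z : T} (x : El M.obj X) (y : El N.obj Y) (z : El P.obj Z) :
    (act (assocIso M N P).inv).app _ (pure x (pure y z)) =
      (elems _).map (α_ X Y Z).inv (pure (pure x y) z) := act_assocInv_pure x y z

theorem act_leftIso_pure {X : T} (x : El M.obj X) :
    (act (leftIso M).hom).app _ (pure oneGen x) = (elems _).map (λ_ X).hom x := act_leftHom_pure x

theorem act_braidIso_pure {X Y : T} (x : El M.obj X) (y : El N.obj Y) :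
    (act (braidIso M N).hom).app _ (pure x y) = (elems _).map (β_ X Y).hom (pure y x) :=
  act_braidHom_pure x y

/-- The data of the tensor structure. -/
@[reducible]
def monoidalStruct : MonoidalCategoryStruct (ScalarExt F F' T) where
  tensorObj := tens
  whiskerLeft M _ _ f := tensMap (𝟙 M) f
  whiskerRight f N := tensMap f (𝟙 N)
  tensorHom := tensMap
  tensorUnit := one
  associator := assocIso
  leftUnitor := leftIso
  rightUnitor := rightIso

/-- The tensor structure on the scalar extension. -/
@[reducible]
def monoidal : MonoidalCategory (ScalarExt F F' T) :=
  letI := monoidalStruct (F := F) (F' := F') (T := T)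
  .ofTensorHom
    (id_tensorHom_id := fun M N => act_injective <| lex_ext₂ fun X Y x y => by
      change (act (tensMap _ _)).app _ _ = _
      rw [act_tensMap_pure, act_id, act_id, act_id])
    (id_tensorHom := fun _ _ _ _ => rfl)
    (tensorHom_id := fun _ _ => rfl)
    (tensorHom_comp_tensorHom := fun f₁ f₂ g₁ g₂ => act_injective <| lex_ext₂ fun X Y x y => by
      change (act (tensMap _ _ ≫ tensMap _ _)).app _ _ = (act (tensMap _ _)).app _ _
      rw [act_comp, act_tensMap_pure, act_tensMap_pure, act_tensMap_pure, act_comp, act_comp])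
    (associator_naturality := fun f₁ f₂ f₃ => act_injective <| lex_ext₃ fun X Y Z x y z => by
      change (act (tensMap (tensMap _ _) _ ≫ (assocIso _ _ _).hom)).app _ _ =
        (act ((assocIso _ _ _).hom ≫ tensMap _ (tensMap _ _))).app _ _
      rw [act_comp, act_tensMap_pure, act_tensMap_pure, act_assocIso_pure, act_comp,
        act_assocIso_pure, Hom.naturality, act_tensMap_pure, act_tensMap_pure])
    (leftUnitor_naturality := fun {M N} f => act_injective <| lex_ext_left_t fun Y y => by
      change (act (tensMap (𝟙 one) f ≫ (leftIso _).hom)).app _ (pure oneGen y) =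
        (act ((leftIso _).hom ≫ f)).app _ (pure oneGen y)
      rw [act_comp, act_tensMap_pure, act_id, act_leftIso_pure, act_comp, act_leftIso_pure,
        Hom.naturality])
    (rightUnitor_naturality := fun {M N} f => act_injective <| lex_ext_right_t fun Y y => by
      change (act (tensMap f (𝟙 one) ≫ (rightIso _).hom)).app _ (pure y oneGen) =
        (act ((rightIso _).hom ≫ f)).app _ (pure y oneGen)
      rw [act_comp, act_tensMap_pure, act_id, act_rightIso_pure, act_comp, act_rightIso_pure,
        Hom.naturality])
    -- On a pure tensor each associativity constraint acts by rebracketing the sections and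
    -- restricting along the associator of `T`. The pentagon thus becomes the pentagon of `T`
    -- applied to the base.
    (pentagon := fun M N P Q => act_injective <| lex_ext₄ fun X Y Z W x y z w => by
      change (act (tensMap (assocIso M N P).hom (𝟙 Q) ≫ (assocIso _ _ _).hom ≫
        tensMap (𝟙 _) (assocIso _ _ _).hom)).app _ _ =
          (act ((assocIso _ _ _).hom ≫ (assocIso _ _ _).hom)).app _ _
      rw [act_comp, act_tensMap_pure, act_assocIso_pure, act_id, map_left_pure, Hom.naturality,
        act_comp, act_assocIso_pure, Hom.naturality, act_tensMap_pure, act_id, act_assocIso_pure,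
        map_right_pure, ← LexPresheaf.map_comp, ← LexPresheaf.map_comp, Category.assoc, pentagon, act_comp,
        act_assocIso_pure, Hom.naturality, act_assocIso_pure, LexPresheaf.map_comp])
    (triangle := fun M N => act_injective <| lex_ext₂ fun W Y w y => by
      change (act ((assocIso M one N).hom ≫ tensMap (𝟙 M) (leftIso N).hom)).app _ _ =
        (act (tensMap (rightIso M).hom (𝟙 N))).app _ _
      -- For fixed `y` the unit factor may be tested on its tautological section alone, where the
      -- unit constraints are given by those of `T`.
      have : ((univ _ N).comp (act ((assocIso M one N).hom ≫
          tensMap (𝟙 M) (leftIso N).hom))).curryRight y =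
          ((univ _ N).comp (act (tensMap (rightIso M).hom (𝟙 N)))).curryRight y :=
        lex_ext_right_t fun X x => by
          change (act _).app _ (pure (pure x oneGen) y) = (act _).app _ (pure (pure x oneGen) y)
          rw [act_comp, act_assocIso_pure, Hom.naturality, act_tensMap_pure, act_leftIso_pure,
            act_id, map_right_pure, ← LexPresheaf.map_comp, triangle, act_tensMap_pure,
            act_rightIso_pure, act_id, map_left_pure]
      exact LinearMap.congr_fun (congrFun (congrArg Hom.app this) W) w)

attribute [local instance] monoidal

/-- The symmetry of the tensor structure on the scalar extension. -/
@[reducible]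
def symmetric : SymmetricCategory (ScalarExt F F' T) where
  braiding := braidIso
  braiding_naturality_right M N P f := act_injective <| lex_ext₂ fun X Y x y => by
    change (act (tensMap (𝟙 M) f ≫ (braidIso _ _).hom)).app _ _ =
      (act ((braidIso _ _).hom ≫ tensMap f (𝟙 M))).app _ _
    rw [act_comp, act_tensMap_pure, act_braidIso_pure, act_comp, act_braidIso_pure,
      Hom.naturality, act_tensMap_pure]
  braiding_naturality_left {M N} f P := act_injective <| lex_ext₂ fun X Y x y => by
    change (act (tensMap f (𝟙 P) ≫ (braidIso _ _).hom)).app _ _ =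
      (act ((braidIso _ _).hom ≫ tensMap (𝟙 P) f)).app _ _
    rw [act_comp, act_tensMap_pure, act_braidIso_pure, act_comp, act_braidIso_pure,
      Hom.naturality, act_tensMap_pure]
  hexagon_forward M N P := act_injective <| lex_ext₃ fun X Y Z x y z => by
    change (act ((assocIso _ _ _).hom ≫ (braidIso _ _).hom ≫ (assocIso _ _ _).hom)).app _ _ =
      (act (tensMap (braidIso _ _).hom (𝟙 P) ≫ (assocIso _ _ _).hom ≫
        tensMap (𝟙 N) (braidIso _ _).hom)).app _ _
    rw [act_comp, act_assocIso_pure, Hom.naturality, act_comp, act_braidIso_pure, Hom.naturality,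
      act_assocIso_pure, ← LexPresheaf.map_comp, ← LexPresheaf.map_comp,
      Category.assoc, BraidedCategory.hexagon_forward, act_comp, act_tensMap_pure, act_braidIso_pure, act_id,
      map_left_pure, Hom.naturality, act_comp, act_assocIso_pure, Hom.naturality,
      act_tensMap_pure, act_braidIso_pure, act_id, map_right_pure, LexPresheaf.map_comp,
      LexPresheaf.map_comp]
  hexagon_reverse M N P := act_injective <| lex_ext₃' fun X Y Z x y z => by
    change (act ((assocIso _ _ _).inv ≫ (braidIso _ _).hom ≫ (assocIso _ _ _).inv)).app _ _ =
      (act (tensMap (𝟙 M) (braidIso _ _).hom ≫ (assocIso _ _ _).inv ≫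
        tensMap (braidIso _ _).hom (𝟙 N))).app _ _
    rw [act_comp, act_assocIso_inv_pure, Hom.naturality, act_comp, act_braidIso_pure, Hom.naturality,
      act_assocIso_inv_pure, ← LexPresheaf.map_comp, ← LexPresheaf.map_comp,
      Category.assoc, BraidedCategory.hexagon_reverse, act_comp, act_tensMap_pure, act_braidIso_pure, act_id,
      map_right_pure, Hom.naturality, act_comp, act_assocIso_inv_pure, Hom.naturality,
      act_tensMap_pure, act_braidIso_pure, act_id, map_left_pure, LexPresheaf.map_comp,
      LexPresheaf.map_comp]
  symmetry := braidHom_braidHom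

attribute [local instance] symmetric

instance monoidalPreadditive : MonoidalPreadditive (ScalarExt F F' T) where
  whiskerLeft_zero {M N P} := act_injective <| lex_ext₂ fun X Y x y => by
    change (act (tensMap (𝟙 M) 0)).app _ _ = _
    rw [act_tensMap_pure, act_zero, act_zero, pure, _root_.map_zero]
  zero_whiskerRight {M N P} := act_injective <| lex_ext₂ fun X Y x y => by
    change (act (tensMap 0 (𝟙 M))).app _ _ = _
    rw [act_tensMap_pure, act_zero, act_zero, pure, _root_.map_zero, LinearMap.zero_apply]
  whiskerLeft_add {M N P} f g := act_injective <| lex_ext₂ fun X Y x y => by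
    change (act (tensMap (𝟙 M) (f + g))).app _ _ =
      (act (tensMap (𝟙 M) f + tensMap (𝟙 M) g)).app _ _
    rw [act_add, act_tensMap_pure, act_tensMap_pure, act_tensMap_pure, act_add, pure,
      _root_.map_add]
    rfl
  add_whiskerRight {M N P} f g := act_injective <| lex_ext₂ fun X Y x y => by
    change (act (tensMap (f + g) (𝟙 M))).app _ _ =
      (act (tensMap f (𝟙 M) + tensMap g (𝟙 M))).app _ _
    rw [act_add, act_tensMap_pure, act_tensMap_pure, act_tensMap_pure, act_add, pure,
      _root_.map_add, LinearMap.add_apply]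
    rfl

instance monoidalLinear : MonoidalLinear F' (ScalarExt F F' T) where
  whiskerLeft_smul M _ _ a f := act_injective <| lex_ext₂ fun X Y x y => by
    change (act (tensMap (𝟙 M) (a • f))).app _ _ = (act (a • tensMap (𝟙 M) f)).app _ _
    rw [act_smul, act_tensMap_pure, act_tensMap_pure, act_smul, pure, _root_.map_smul]
    rfl
  smul_whiskerRight a _ _ f M := act_injective <| lex_ext₂ fun X Y x y => by
    change (act (tensMap (a • f) (𝟙 M))).app _ _ = (act (a • tensMap f (𝟙 M))).app _ _
    rw [act_smul, act_tensMap_pure, act_tensMap_pure, act_smul, pure, _root_.map_smul,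
      LinearMap.smul_apply]
    rfl

/-- A morphism from `M₀ ⊗ N` that kills `M₁ ⊗ N` is a bimorphism on `M₀` and `N` that kills `M₁`. It
descends to the cokernel in the first variable by `RightExact.exists_bimor`. -/
theorem preservesFiniteColimits_tensorRight (N : ScalarExt F F' T) :
    PreservesFiniteColimits (tensorRight N) := by
  have key : ∀ {M₁ M₀ : ScalarExt F F' T} (φ : M₁ ⟶ M₀),
      PreservesColimit (parallelPair φ 0) (tensorRight N) := by
    intro M₁ M₀ φ
    have h := rightExact_act φ (cokernel.π φ) (cokernel.condition φ) (cokernelIsCokernel φ)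
    refine preservesColimit_of_preserves_colimit_cocone (cokernelIsCokernel φ) ?_
    refine (CokernelCofork.isColimitMapCoconeEquiv _ _).symm ?_
    have hepi : Epi (tensMap (cokernel.π φ) (𝟙 N)) := ⟨fun {Q} f g hfg => act_injective <|
      lex_ext₂ fun X Y x y => by
        obtain ⟨Z, e, _, x', hx'⟩ := h.locSurj X x
        refine (elems Q.obj).sep' (e ▷ Y) ?_
        rw [← Hom.naturality, ← Hom.naturality, ← map_left_pure, ← hx']
        have := LinearMap.congr_fun (congrFun (congrArg Hom.app (congrArg act hfg)) (Z ⊗ Y))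
          (pure x' y)
        rwa [act_comp, act_comp, act_tensMap_pure, act_id] at this⟩
    have : Epi ((tensorRight N).map (cokernel.π φ)) := hepi
    refine CokernelCofork.IsColimit.ofπ' _ (((tensorRight N).map_comp _ _).symm.trans
      ((congrArg _ (cokernel.condition φ)).trans (Functor.map_zero _ _ _))) fun {Q} g hg => ?_
    refine Nonempty.some ?_
    obtain ⟨β, hβ⟩ := h.exists_bimor ((univ M₀ N).comp (act g)) fun X Y x y => by
      have hg' : tensMap φ (𝟙 N) ≫ g = 0 := hg
      have := LinearMap.congr_fun (congrFun (congrArg Hom.app (congrArg act hg')) (X ⊗ Y))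
          (pure x y)
      rwa [act_comp, act_tensMap_pure, act_id, act_zero] at this
    refine ⟨lift β, act_injective <| lex_ext₂ fun X Y x y => ?_⟩
    change (act (tensMap (cokernel.π φ) (𝟙 N) ≫ lift β)).app _ _ = _
    rw [act_comp, act_tensMap_pure, act_lift_pure, act_id, hβ]
    rfl
  exact Functor.preservesFiniteColimits_of_preservesCokernels _

theorem preservesFiniteColimits_tensorLeft (N : ScalarExt F F' T) :
    PreservesFiniteColimits (tensorLeft N) :=
  have := preservesFiniteColimits_tensorRight N
  preservesFiniteColimits_of_natIso (BraidedCategory.tensorLeftIsoTensorRight N).symm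

/-- The functoriality of `t`. -/
def tMap {X Y : T} (f : X ⟶ Y) : (tFin X : ScalarExt F F' T) ⟶ tFin Y :=
  ObjectProperty.homMk ((toIndModule F F' T).map f)

/-- The tautological section. -/
def tGen (X : T) : El (tFin X : ScalarExt F F' T).obj X := gen F F' X

theorem act_tMap_gen {X Y : T} (f : X ⟶ Y) :
    (act (tMap f)).app X (tGen (F := F) (F' := F') X) = (elems _).map f (tGen Y) :=
  elMap_toIndModule_gen f

theorem lex_ext_t {X : T} {H : LexPresheaf F F' T}
    {α α' : (elems (tFin X).obj).Hom H} (h : α.app _ (tGen X) = α'.app _ (tGen X)) : α = α' :=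
  t_hom_ext h

theorem lex_ext_tt {X Y : T} {H : LexPresheaf F F' T}
    {α α' : (elems (tens (tFin X) (tFin Y)).obj).Hom H}
    (h : α.app _ (pure (tGen X) (tGen Y)) = α'.app _ (pure (tGen X) (tGen Y))) : α = α' :=
  lex_ext_right_t fun W w => by
    have : ((univ _ _).comp α).curryRight (tGen Y) = ((univ _ _).comp α').curryRight (tGen Y) :=
      lex_ext_t h
    exact LinearMap.congr_fun (congrFun (congrArg Hom.app this) W) w

theorem lex_ext_ttt {X Y Z : T} {H : LexPresheaf F F' T}
    {α α' : (elems (tens (tens (tFin X) (tFin Y)) (tFin Z)).obj).Hom H}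
    (h : α.app _ (pure (pure (tGen X) (tGen Y)) (tGen Z)) =
      α'.app _ (pure (pure (tGen X) (tGen Y)) (tGen Z))) : α = α' :=
  lex_ext_right_t fun W w => by
    have : ((univ _ _).comp α).curryRight (tGen Z) = ((univ _ _).comp α').curryRight (tGen Z) :=
      lex_ext_tt h
    exact LinearMap.congr_fun (congrFun (congrArg Hom.app this) W) w

/-- The tensor constraint of `t`. -/
def tMu (X Y : T) : tens (tFin X) (tFin Y) ≅ (tFin (X ⊗ Y) : ScalarExt F F' T) where
  hom := lift (bimorOfSection (gen F F' (X ⊗ Y)))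
  inv := ofAct (tDesc (pure (tGen X) (tGen Y)))
  hom_inv_id := act_injective <| lex_ext_tt <| by
    rw [act_comp, act_lift_pure, act_id, act_ofAct]
    exact (congrArg _ (bimorOfSection_gen (gen F F' (X ⊗ Y)))).trans (tDesc_gen _)
  inv_hom_id := act_injective <| lex_ext_t <| by
    rw [act_comp, act_ofAct, act_id]
    refine (congrArg _ (tDesc_gen _)).trans ?_
    rw [act_lift_pure]
    exact bimorOfSection_gen (gen F F' (X ⊗ Y))

theorem act_tMu_pure (X Y : T) :
    (act (tMu (F := F) (F' := F') X Y).hom).app _ (pure (tGen X) (tGen Y)) = tGen (X ⊗ Y) := by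
  refine (act_lift_pure _ _ _).trans ?_
  exact bimorOfSection_gen (gen F F' (X ⊗ Y))

/-- The functor `t` is a tensor functor. -/
def tCoreMonoidal (ht : ∀ X : T, isFiniteLength _ ((toIndModule F F' T).obj X)) :
    (toScalarExt ht).CoreMonoidal where
  εIso := Iso.refl _
  μIso := tMu
  μIso_hom_natural_left {X Y} f Z := act_injective <| lex_ext_tt <| by
    change (act (tensMap (tMap f) (𝟙 (tFin Z)) ≫ (tMu Y Z).hom)).app _ _ =
      (act ((tMu X Z).hom ≫ tMap (f ▷ Z))).app _ _
    rw [act_comp, act_tensMap_pure, act_tMap_gen, act_id, map_left_pure, Hom.naturality,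
      act_tMu_pure, act_comp, act_tMu_pure, act_tMap_gen]
  μIso_hom_natural_right {X Y} Z f := act_injective <| lex_ext_tt <| by
    change (act (tensMap (𝟙 (tFin Z)) (tMap f) ≫ (tMu Z Y).hom)).app _ _ =
      (act ((tMu Z X).hom ≫ tMap (Z ◁ f))).app _ _
    rw [act_comp, act_tensMap_pure, act_tMap_gen, act_id, map_right_pure, Hom.naturality,
      act_tMu_pure, act_comp, act_tMu_pure, act_tMap_gen]
  associativity X Y Z := act_injective <| lex_ext_ttt <| by
    change (act (tensMap (tMu X Y).hom (𝟙 (tFin Z)) ≫ (tMu (X ⊗ Y) Z).hom ≫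
      tMap (α_ X Y Z).hom)).app _ _ =
      (act ((assocIso _ _ _).hom ≫ tensMap (𝟙 (tFin X)) (tMu Y Z).hom ≫
        (tMu X (Y ⊗ Z)).hom)).app _ _
    rw [act_comp, act_tensMap_pure, act_tMu_pure, act_id, act_comp, act_tMu_pure, act_tMap_gen,
      act_comp, act_assocIso_pure, Hom.naturality, act_comp, act_tensMap_pure, act_tMu_pure,
      act_id, act_tMu_pure]
  left_unitality X := act_injective <| lex_ext_tt <| by
    change (act (leftIso (tFin X)).hom).app _ (pure oneGen (tGen X)) =
      (act (tensMap (𝟙 one) (𝟙 (tFin X)) ≫ (tMu (𝟙_ T) X).hom ≫ tMap (λ_ X).hom)).app _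
        (pure (tGen (𝟙_ T)) (tGen X))
    rw [act_leftIso_pure, act_comp, act_tensMap_pure, act_id, act_id, act_comp, act_tMu_pure,
      act_tMap_gen]
  right_unitality X := act_injective <| lex_ext_tt <| by
    change (act (rightIso (tFin X)).hom).app _ (pure (tGen X) oneGen) =
      (act (tensMap (𝟙 (tFin X)) (𝟙 one) ≫ (tMu X (𝟙_ T)).hom ≫ tMap (ρ_ X).hom)).app _
        (pure (tGen X) (tGen (𝟙_ T)))
    rw [act_rightIso_pure, act_comp, act_tensMap_pure, act_id, act_id, act_comp, act_tMu_pure,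
      act_tMap_gen]

/-- The functor `t` is a symmetric tensor functor. -/
@[reducible]
def tBraided (ht : ∀ X : T, isFiniteLength _ ((toIndModule F F' T).obj X)) :
    (toScalarExt ht).Braided where
  toMonoidal := (tCoreMonoidal ht).toMonoidal
  braided X Y := act_injective <| lex_ext_tt <| by
    change (act ((tMu X Y).hom ≫ tMap (β_ X Y).hom)).app _ _ =
      (act ((braidIso (tFin X) (tFin Y)).hom ≫ (tMu Y X).hom)).app _ _
    rw [act_comp, act_tMu_pure, act_tMap_gen, act_comp, act_braidIso_pure, Hom.naturality,
      act_tMu_pure]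

theorem isScalarExtTensor (ht : ∀ X : T, isFiniteLength _ ((toIndModule F F' T).obj X)) :
    IsScalarExtTensor ht where
  tensorLeft_rightExact := preservesFiniteColimits_tensorLeft
  tensorRight_rightExact := preservesFiniteColimits_tensorRight
  braided := ⟨tBraided ht⟩

end ScalarExt

end Monoidal

end ScalarExtension

end

/-! ### Antisymmetrized tensor powers of a morphism. -/

noncomputable section
namespace ScalarExtension

open MonoidalCategory

set_option linter.unusedSectionVars false

section Alternation

variable {C : Type*} [Category* C] [MonoidalCategory C] [SymmetricCategory C]

/-- Tensor powers. -/
def tpow (A : C) : ℕ → C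
  | 0 => 𝟙_ C
  | n + 1 => A ⊗ tpow A n

/-- Tensor powers of morphisms. -/
def tpowMap {A B : C} (f : A ⟶ B) : ∀ n, tpow A n ⟶ tpow B n
  | 0 => 𝟙 (𝟙_ C)
  | n + 1 => f ⊗ₘ tpowMap f n

/-- The exchange of the first two factors. -/
def exch (A B X : C) : A ⊗ (B ⊗ X) ⟶ B ⊗ (A ⊗ X) :=
  (α_ A B X).inv ≫ (β_ A B).hom ▷ X ≫ (α_ B A X).hom

theorem exch_naturality {A A' B B' X X' : C} (f : A ⟶ A') (g : B ⟶ B') (h : X ⟶ X') :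
    (f ⊗ₘ (g ⊗ₘ h)) ≫ exch A' B' X' = exch A B X ≫ (g ⊗ₘ (f ⊗ₘ h)) := by
  rw [exch, exch, associator_inv_naturality_assoc, Category.assoc, Category.assoc,
    ← associator_naturality, ← tensorHom_id, ← tensorHom_id, tensorHom_comp_tensorHom_assoc,
    tensorHom_comp_tensorHom_assoc, BraidedCategory.braiding_naturality, Category.comp_id,
    Category.id_comp]

variable [Preadditive C]

/-- The inductive step in the definition of `frontSum`. -/
def frontStep (A P : C) (x : A ⊗ P ⟶ A ⊗ P) : A ⊗ (A ⊗ P) ⟶ A ⊗ (A ⊗ P) :=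
  𝟙 _ - A ◁ x ≫ exch A A P

theorem frontStep_naturality {A B P Q : C} (f : A ⟶ B) (h : P ⟶ Q) {x : A ⊗ P ⟶ A ⊗ P}
    {y : B ⊗ Q ⟶ B ⊗ Q} (hxy : (f ⊗ₘ h) ≫ y = x ≫ (f ⊗ₘ h)) :
    (f ⊗ₘ (f ⊗ₘ h)) ≫ frontStep B Q y = frontStep A P x ≫ (f ⊗ₘ (f ⊗ₘ h)) := by
  rw [frontStep, frontStep, Preadditive.comp_sub, Preadditive.sub_comp, Category.comp_id,
    Category.id_comp, Category.assoc, ← exch_naturality, ← id_tensorHom, ← id_tensorHom,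
    tensorHom_comp_tensorHom_assoc, hxy, tensorHom_comp_tensorHom_assoc, Category.id_comp,
    Category.comp_id]

/-- The hypothesis isolates the identity term: `f ⊗ Φ` equals `x` on the last factors, then the
exchange, then `f ⊗ Φ`. After the exchange the original first factor is the one on which `Φ` begins
with `f`. It is untouched by `x`, so that `f` can be applied at the very start, while the other `f`
acts on the factor that was moved to the front and can be applied at the very end. -/
theorem exists_factor_of_frontStep_comp_eq_zero {A B P Q : C} (f : A ⟶ B) {x : A ⊗ P ⟶ A ⊗ P}
    {Φ : A ⊗ P ⟶ Q} {g : B ⊗ P ⟶ Q} (hg : Φ = f ▷ P ≫ g)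
    (h : frontStep A P x ≫ (f ⊗ₘ Φ) = 0) :
    ∃ Ψ : B ⊗ (A ⊗ P) ⟶ A ⊗ Q, f ⊗ₘ Φ = f ▷ (A ⊗ P) ≫ Ψ ≫ f ▷ Q := by
  refine ⟨B ◁ x ≫ exch B A P ≫ A ◁ g, ?_⟩
  rw [frontStep, Preadditive.sub_comp, Category.id_comp, sub_eq_zero] at h
  rw [h, hg]
  have h1 : exch A A P ≫ (f ⊗ₘ f ▷ P ≫ g) = f ▷ (A ⊗ P) ≫ exch B A P ≫ (f ⊗ₘ g) := by
    have := exch_naturality f (𝟙 A) (𝟙 P)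
    rw [id_tensorHom_id, tensorHom_id, tensorHom_id, id_tensorHom] at this
    rw [← Category.assoc (f ▷ _), this, Category.assoc, ← id_tensorHom,
      tensorHom_comp_tensorHom, Category.id_comp]
  rw [Category.assoc, h1, whisker_exchange_assoc, MonoidalCategory.tensorHom_def']
  simp only [Category.assoc]

/-- The alternating sum of the ways of moving a factor to the front. -/
def frontSum (A : C) : ∀ n, A ⊗ tpow A n ⟶ A ⊗ tpow A n
  | 0 => 𝟙 _
  | n + 1 => frontStep A (tpow A n) (frontSum A n)

/-- The antisymmetrization of a tensor power. -/
def alt (A : C) : ∀ n, tpow A n ⟶ tpow A n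
  | 0 => 𝟙 (𝟙_ C)
  | n + 1 => frontSum A n ≫ A ◁ alt A n

/-- The antisymmetrized power of a morphism. -/
def altMap {A B : C} (f : A ⟶ B) (n : ℕ) : tpow A n ⟶ tpow B n := alt A n ≫ tpowMap f n

theorem altMap_succ {A B : C} (f : A ⟶ B) (n : ℕ) :
    altMap f (n + 1) = frontSum A n ≫ (f ⊗ₘ altMap f n) := by
  change (frontSum A n ≫ A ◁ alt A n) ≫ (f ⊗ₘ tpowMap f n) = _
  rw [Category.assoc, ← id_tensorHom, tensorHom_comp_tensorHom, Category.id_comp]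
  rfl

variable [MonoidalPreadditive C]

theorem frontSum_naturality {A B : C} (f : A ⟶ B) (n : ℕ) :
    (f ⊗ₘ tpowMap f n) ≫ frontSum B n = frontSum A n ≫ (f ⊗ₘ tpowMap f n) := by
  induction n with
  | zero =>
    change _ ≫ 𝟙 _ = 𝟙 _ ≫ _
    rw [Category.comp_id, Category.id_comp]
  | succ n ih => exact frontStep_naturality f (tpowMap f n) ih

theorem alt_naturality {A B : C} (f : A ⟶ B) (n : ℕ) :
    tpowMap f n ≫ alt B n = alt A n ≫ tpowMap f n := by
  induction n with
  | zero => rfl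
  | succ n ih =>
    change (f ⊗ₘ tpowMap f n) ≫ frontSum B n ≫ B ◁ alt B n =
      (frontSum A n ≫ A ◁ alt A n) ≫ (f ⊗ₘ tpowMap f n)
    rw [← Category.assoc, frontSum_naturality, Category.assoc, Category.assoc, ← id_tensorHom,
      ← id_tensorHom, tensorHom_comp_tensorHom, tensorHom_comp_tensorHom, ih, Category.id_comp,
      Category.comp_id]

/-- Antisymmetrization is natural, so the power of `f` can be applied before it, and in particular
`f` on the first factor. -/
theorem exists_altMap_succ_eq {A B : C} (f : A ⟶ B) (n : ℕ) :
    ∃ g : B ⊗ tpow A n ⟶ tpow B (n + 1), altMap f (n + 1) = f ▷ tpow A n ≫ g :=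
  ⟨B ◁ tpowMap f n ≫ alt B (n + 1), by
    rw [altMap, ← alt_naturality]
    exact (congrArg (· ≫ alt B (n + 1)) (MonoidalCategory.tensorHom_def f (tpowMap f n))).trans
      (Category.assoc _ _ _)⟩

/-- If the `(k+1)`-st antisymmetrized power of `f` vanishes, then `f ⊗ Λᵏf` factors through `f` on
both sides. -/
theorem exists_factor_of_altMap_succ_eq_zero {A B : C} (f : A ⟶ B) {k : ℕ}
    (h : altMap f (k + 1) = 0) :
    ∃ Ψ : B ⊗ tpow A k ⟶ A ⊗ tpow B k,
      f ⊗ₘ altMap f k = f ▷ tpow A k ≫ Ψ ≫ f ▷ tpow B k := by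
  rw [altMap_succ] at h
  cases k with
  -- Here `frontSum A 0` is the identity, so the hypothesis says that `f ⊗ Λ⁰f` itself vanishes and
  -- `Ψ = 0` works.
  | zero =>
    have h' : f ⊗ₘ altMap f 0 = 0 := (Category.id_comp _).symm.trans h
    exact ⟨0, by rw [zero_comp, comp_zero, h']⟩
  | succ k =>
    obtain ⟨g, hg⟩ := exists_altMap_succ_eq f k
    exact exists_factor_of_frontStep_comp_eq_zero f hg h

end Alternation

/-! ### Objects with a dual. -/

section Dualisable

variable {C : Type*} [Category* C] [MonoidalCategory C]

/-- An object which has a dual. -/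
def Dualisable (X : C) : Prop := ∃ Y : C, Nonempty (ExactPairing X Y)

theorem dualisable_unit : Dualisable (𝟙_ C) := ⟨𝟙_ C, ⟨inferInstance⟩⟩

theorem Dualisable.of_iso {X Y : C} (h : Dualisable X) (e : X ≅ Y) : Dualisable Y := by
  obtain ⟨Z, ⟨_⟩⟩ := h
  exact ⟨Z, ⟨exactPairingCongrLeft e.symm⟩⟩

variable [SymmetricCategory C]

theorem Dualisable.exists_swap {X : C} (h : Dualisable X) : ∃ Y : C, Nonempty (ExactPairing Y X) := by
  obtain ⟨Y, ⟨_⟩⟩ := h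
  exact ⟨Y, ⟨BraidedCategory.exactPairing_swap X Y⟩⟩

theorem Dualisable.tensor {X Y : C} (hX : Dualisable X) (hY : Dualisable Y) :
    Dualisable (X ⊗ Y) := by
  obtain ⟨X', ⟨_⟩⟩ := hX
  obtain ⟨Y', ⟨_⟩⟩ := hY
  exact ⟨Y' ⊗ X', ⟨inferInstance⟩⟩

theorem Dualisable.tpow {X : C} (hX : Dualisable X) : ∀ n, Dualisable (tpow X n)
  | 0 => dualisable_unit
  | n + 1 => hX.tensor (Dualisable.tpow hX n)

theorem Dualisable.mono_whiskerRight {X K L : C} (hX : Dualisable X) (j : K ⟶ L) [Mono j] :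
    Mono (j ▷ X) := by
  obtain ⟨Y, ⟨_⟩⟩ := hX.exists_swap
  have : (tensorRight X).IsRightAdjoint := (tensorRightAdjunction Y X).isRightAdjoint
  exact inferInstanceAs (Mono ((tensorRight X).map j))

variable [Preadditive C] [MonoidalPreadditive C]

/-- By the zigzag identity a morphism to a dual is recovered from its pairing `W ⊗ X ⟶ 𝟙`. -/
theorem eq_zero_of_whiskerRight_evaluation {W X Y : C} [ExactPairing X Y] (f : W ⟶ Y)
    (h : f ▷ X ≫ ExactPairing.evaluation X Y = 0) : f = 0 := by
  have h1 : f = (ρ_ W).inv ≫ W ◁ ExactPairing.coevaluation X Y ≫ (α_ W X Y).inv ≫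
      (f ▷ X ≫ ExactPairing.evaluation X Y) ▷ Y ≫ (λ_ Y).hom := by
    rw [comp_whiskerRight, Category.assoc, ← associator_inv_naturality_left_assoc,
      whisker_exchange_assoc, ExactPairing.coevaluation_evaluation_assoc, Iso.inv_hom_id,
      Category.comp_id, rightUnitor_naturality, Iso.inv_hom_id_assoc]
  rw [h1, h, MonoidalPreadditive.zero_whiskerRight, zero_comp, comp_zero, comp_zero, comp_zero]

end Dualisable

/-! ### Cokernels of morphisms of dualisable objects: flatness and duals. -/

section Flat

variable {C : Type*} [Category* C] [Abelian C] [MonoidalCategory C] [SymmetricCategory C]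
  [MonoidalPreadditive C]

/-- Right exactness of the tensor product. -/
class RightExactTensor (C : Type*) [Category* C] [MonoidalCategory C] : Prop where
  tensorLeft (X : C) : PreservesFiniteColimits (tensorLeft X)
  tensorRight (X : C) : PreservesFiniteColimits (tensorRight X)

variable [RightExactTensor C]

instance epi_whiskerLeft_of_rightExact {X Y : C} (Z : C) (f : X ⟶ Y) [Epi f] : Epi (Z ◁ f) :=
  have := RightExactTensor.tensorLeft Z
  inferInstanceAs (Epi ((tensorLeft Z).map f))

instance epi_whiskerRight_of_rightExact {X Y : C} (f : X ⟶ Y) [Epi f] (Z : C) : Epi (f ▷ Z) :=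
  have := RightExactTensor.tensorRight Z
  inferInstanceAs (Epi ((tensorRight Z).map f))

theorem exists_desc_whiskerRight {X Y W : C} (f : X ⟶ Y) (Z : C) (k : Y ⊗ Z ⟶ W)
    (hk : f ▷ Z ≫ k = 0) : ∃ l, cokernel.π f ▷ Z ≫ l = k := by
  have := RightExactTensor.tensorRight Z
  obtain ⟨l, hl⟩ := CokernelCofork.IsColimit.desc'
    (isColimitCoforkMapOfIsColimit' (tensorRight Z) (cokernel.condition f) (cokernelIsCokernel f))
    k hk
  exact ⟨l, hl⟩

theorem exists_desc_whiskerLeft {X Y W : C} (f : X ⟶ Y) (Z : C) (k : Z ⊗ Y ⟶ W)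
    (hk : Z ◁ f ≫ k = 0) : ∃ l, Z ◁ cokernel.π f ≫ l = k := by
  have := RightExactTensor.tensorLeft Z
  obtain ⟨l, hl⟩ := CokernelCofork.IsColimit.desc'
    (isColimitCoforkMapOfIsColimit' (tensorLeft Z) (cokernel.condition f) (cokernelIsCokernel f))
    k hk
  exact ⟨l, hl⟩

/-- Tensoring with a flat object preserves monomorphisms. -/
def Flat (N : C) : Prop := ∀ ⦃K L : C⦄ (j : K ⟶ L) [Mono j], Mono (j ▷ N)

/-- If `Λᵏ⁺¹f = 0`, then `Λᵏf` becomes divisible by a dualisable object after tensoring with the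
cokernel of `f`. -/
theorem exists_factor_cokernel {A B : C} (f : A ⟶ B) {k : ℕ} (h : altMap f (k + 1) = 0) :
    ∃ s : cokernel f ⊗ tpow A k ⟶ B ⊗ tpow B k,
      s ≫ cokernel.π f ▷ tpow B k = cokernel f ◁ altMap f k := by
  obtain ⟨Ψ, hΨ⟩ := exists_factor_of_altMap_succ_eq_zero f h
  -- After precomposition with `f ▷ tpow A k` both terms become `f ⊗ Λᵏf`, so their difference
  -- descends to the cokernel. The term ending in `f ▷ tpow B k` disappears again after projecting
  -- to the cokernel.
  obtain ⟨s, hs⟩ := exists_desc_whiskerRight f (tpow A k) (B ◁ altMap f k - Ψ ≫ f ▷ tpow B k) (by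
    rw [Preadditive.comp_sub, ← hΨ, ← MonoidalCategory.tensorHom_def, sub_self])
  refine ⟨s, ?_⟩
  rw [← cancel_epi (cokernel.π f ▷ tpow A k), reassoc_of% hs, Preadditive.sub_comp,
    Category.assoc, ← comp_whiskerRight, cokernel.condition, MonoidalPreadditive.zero_whiskerRight,
    comp_zero, sub_zero, whisker_exchange]

/-- Since `B` has a dual, a nonzero `f` yields a nonzero morphism from `A ⊗ Z` to the unit, which is
epi because the unit is simple. Tensored with `K` it is both epi and zero, so `K ⊗ 𝟙` vanishes. -/
theorem isZero_of_whiskerLeft_eq_zero [Simple (𝟙_ C)] {A B K : C} (hB : Dualisable B) {f : A ⟶ B}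
    (hf : f ≠ 0) (h : K ◁ f = 0) : IsZero K := by
  obtain ⟨Z, ⟨_⟩⟩ := hB.exists_swap
  have h0 : f ▷ Z ≫ ExactPairing.evaluation Z B ≠ 0 := fun h0 =>
    hf (eq_zero_of_whiskerRight_evaluation f h0)
  have := epi_of_nonzero_to_simple h0
  have h1 : K ◁ (f ▷ Z ≫ ExactPairing.evaluation Z B) = 0 := by
    rw [whiskerLeft_comp, whisker_assoc_symm, h, MonoidalPreadditive.zero_whiskerRight]
    simp
  have h2 : IsZero (K ⊗ 𝟙_ C) := by
    rw [IsZero.iff_id_eq_zero, ← cancel_epi (K ◁ (f ▷ Z ≫ ExactPairing.evaluation Z B)), h1]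
    simp
  exact h2.of_iso (ρ_ K).symm

/-- Let `R` be the kernel of `j ⊗ N` for the cokernel `N` of `f`. The morphism `N ⊗ Λᵏf` factors
through `B ⊗ tpow B k`, which is dualisable, so `j` stays mono after tensoring with it. Therefore `R
⊗ tpow A k` dies in `K ⊗ (B ⊗ tpow B k)`, which gives `R ⊗ Λᵏf = 0`. As `Λᵏf` is nonzero, `R`
vanishes. -/
theorem flat_cokernel_of_altMap [Simple (𝟙_ C)] {A B : C} (hB : Dualisable B) (f : A ⟶ B) {k : ℕ}
    (h : altMap f (k + 1) = 0) (h' : altMap f k ≠ 0) : Flat (cokernel f) := by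
  intro K L j _
  obtain ⟨s, hs⟩ := exists_factor_cokernel f h
  have hm1 : Mono (j ▷ (B ⊗ tpow B k)) := (hB.tensor (hB.tpow k)).mono_whiskerRight j
  have hm2 : Mono (kernel.ι (j ▷ cokernel f) ▷ tpow B k) := (hB.tpow k).mono_whiskerRight _
  have h1 : kernel.ι (j ▷ cokernel f) ▷ tpow A k ≫ (α_ _ _ _).hom ≫ K ◁ s = 0 := by
    rw [← cancel_mono (j ▷ (B ⊗ tpow B k)), Category.assoc, Category.assoc, zero_comp,
      whisker_exchange, ← associator_naturality_left_assoc, ← comp_whiskerRight_assoc,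
      kernel.condition, MonoidalPreadditive.zero_whiskerRight, zero_comp]
  have h2 : kernel (j ▷ cokernel f) ◁ altMap f k = 0 := by
    rw [← cancel_mono (kernel.ι (j ▷ cokernel f) ▷ tpow B k), zero_comp, whisker_exchange,
      tensor_whiskerLeft, ← hs, whiskerLeft_comp, Category.assoc]
    rw [← Category.assoc, ← Category.assoc, Category.assoc _ _ (K ◁ s), h1, zero_comp]
  exact Preadditive.mono_of_isZero_kernel _ (isZero_of_whiskerLeft_eq_zero (hB.tpow k) h' h2)

theorem flat_cokernel [Simple (𝟙_ C)] {A B : C} (hB : Dualisable B) (f : A ⟶ B) {n : ℕ}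
    (h : alt A n = 0) : Flat (cokernel f) := by
  classical
  have hex : ∃ n, altMap f n = 0 := ⟨n, by rw [altMap, h, zero_comp]⟩
  -- The least exponent with vanishing power is not `0`: the zeroth power is the identity of the
  -- unit, which is nonzero. Its predecessor is the `k` required above.
  obtain ⟨m, hm⟩ : ∃ m, Nat.find hex = m + 1 := by
    refine Nat.exists_eq_succ_of_ne_zero fun h0 => ?_
    have := Nat.find_spec hex
    rw [h0] at this
    exact id_nonzero (𝟙_ C) ((Category.comp_id _).symm.trans this)
  exact flat_cokernel_of_altMap hB f (k := m) (hm ▸ Nat.find_spec hex)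
    (Nat.find_min hex (by omega))

theorem Flat.whiskerLeft {N K L : C} (hN : Flat N) (j : K ⟶ L) [Mono j] : Mono (N ◁ j) := by
  have := hN j
  have h : N ◁ j = (β_ N K).hom ≫ j ▷ N ≫ (β_ N L).inv := by
    rw [← Category.assoc, ← BraidedCategory.braiding_naturality_right, Category.assoc,
      Iso.hom_inv_id, Category.comp_id]
  rw [h]
  infer_instance

/-- By right exactness the cokernel of `N ◁ kernel.ι g` is `N` tensored with the coimage of `g`. By
flatness this object embeds into `N ⊗ Y`, and `N ◁ kernel.ι g` is itself mono, hence the kernel of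
its cokernel. -/
theorem Flat.exists_factor {N X Y W : C} (hN : Flat N) (g : X ⟶ Y) (k : W ⟶ N ⊗ X)
    (hk : k ≫ N ◁ g = 0) : ∃ l, l ≫ N ◁ kernel.ι g = k := by
  have : Mono ((tensorLeft N).map (kernel.ι g)) := hN.whiskerLeft (kernel.ι g)
  have hm := hN.whiskerLeft (Abelian.factorThruCoimage g)
  have hk' : k ≫ N ◁ Abelian.coimage.π g = 0 := by
    rw [← cancel_mono (N ◁ Abelian.factorThruCoimage g), Category.assoc, zero_comp,
      ← whiskerLeft_comp]
    exact (congrArg (fun f => k ≫ N ◁ f) (Abelian.coimage.fac g)).trans hk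
  have := RightExactTensor.tensorLeft N
  have hc := isColimitCoforkMapOfIsColimit' (tensorLeft N) (cokernel.condition (kernel.ι g))
    (cokernelIsCokernel (kernel.ι g))
  obtain ⟨l, hl⟩ := KernelFork.IsLimit.lift' (Abelian.monoIsKernelOfCokernel _ hc) k hk'
  exact ⟨l, hl⟩

/-- The cokernel of a morphism of dualisable objects is dualisable if it is flat. -/
theorem dualisable_cokernel {A B : C} (hA : Dualisable A) (hB : Dualisable B) (f : A ⟶ B)
    (hN : Flat (cokernel f)) : Dualisable (cokernel f) := by
  obtain ⟨A', ⟨_⟩⟩ := hA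
  obtain ⟨B', ⟨_⟩⟩ := hB
  let _ : HasRightDual A := ⟨A'⟩
  let _ : HasRightDual B := ⟨B'⟩
  -- The dual of a cokernel has to be the kernel of the transpose.
  let D := kernel (fᘁ)
  let ι : D ⟶ Bᘁ := kernel.ι (fᘁ)
  let π := cokernel.π f
  -- On `D` the pairing with `B` kills the image of `f`, because moving `f` across the pairing gives
  -- the transpose, which is zero on `D`.
  obtain ⟨ε, hε⟩ := exists_desc_whiskerLeft f D (ι ▷ B ≫ ExactPairing.evaluation B Bᘁ) (by
    rw [whisker_exchange_assoc, ← rightAdjointMate_comp_evaluation, ← comp_whiskerRight_assoc,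
      kernel.condition, MonoidalPreadditive.zero_whiskerRight, zero_comp])
  -- Flatness enters here: it identifies `N ⊗ D` with the kernel of `N ⊗ fᘁ`, where the image of the
  -- coevaluation of `B` lies. The zigzag identities of `B` then pass to `D` and the cokernel after
  -- cancelling the mono `ι` and the epi `π`.
  obtain ⟨η, hη⟩ := hN.exists_factor (fᘁ) (ExactPairing.coevaluation B Bᘁ ≫ π ▷ (Bᘁ)) (by
    rw [Category.assoc, ← whisker_exchange, ← Category.assoc, coevaluation_comp_rightAdjointMate,
      Category.assoc, ← comp_whiskerRight, cokernel.condition,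
      MonoidalPreadditive.zero_whiskerRight, comp_zero])
  refine ⟨D, ⟨⟨η, ε, ?_, ?_⟩⟩⟩
  · have : Mono (𝟙_ C ◁ ι) := by
      rw [id_whiskerLeft]
      infer_instance
    rw [← cancel_mono (𝟙_ C ◁ ι)]
    simp only [Category.assoc]
    rw [← whisker_exchange, ← associator_inv_naturality_right_assoc, ← whiskerLeft_comp_assoc, hη,
      whiskerLeft_comp_assoc, associator_inv_naturality_middle_assoc, ← comp_whiskerRight, hε,
      comp_whiskerRight, ← associator_inv_naturality_left_assoc, whisker_exchange_assoc,
      ExactPairing.coevaluation_evaluation, ← leftUnitor_inv_naturality,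
      rightUnitor_naturality_assoc]
  · rw [← cancel_epi (𝟙_ C ◁ π), whisker_exchange_assoc, associator_naturality_right_assoc,
      ← whiskerLeft_comp, hε, whiskerLeft_comp, ← associator_naturality_middle_assoc,
      ← comp_whiskerRight_assoc, hη, comp_whiskerRight_assoc, associator_naturality_left_assoc,
      ← whisker_exchange, ExactPairing.evaluation_coevaluation_assoc, ← rightUnitor_inv_naturality,
      leftUnitor_naturality_assoc]

end Flat

end ScalarExtension

end

/-! ### Behaviour of duals and antisymmetrization under tensor functors. -/

noncomputable section
namespace ScalarExtension

open MonoidalCategory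

set_option linter.unusedSectionVars false

section MonoidalFunctor

open Functor.LaxMonoidal Functor.OplaxMonoidal

variable {C D : Type*} [Category* C] [Category* D] [MonoidalCategory C] [MonoidalCategory D]

/-- The image of an exact pairing under a monoidal functor. -/
@[reducible]
def mapExactPairing (G : C ⥤ D) [G.Monoidal] (X Y : C) [ExactPairing X Y] :
    ExactPairing (G.obj X) (G.obj Y) where
  coevaluation' := ε G ≫ G.map (ExactPairing.coevaluation X Y) ≫ δ G X Y
  evaluation' := μ G Y X ≫ G.map (ExactPairing.evaluation X Y) ≫ η G
  coevaluation_evaluation' := by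
    have h := congrArg G.map (ExactPairing.coevaluation_evaluation X Y)
    simp only [Functor.map_comp, Functor.Monoidal.map_whiskerLeft,
      Functor.Monoidal.map_whiskerRight, Functor.Monoidal.map_associator_inv, Functor.Monoidal.map_rightUnitor,
      Functor.Monoidal.map_leftUnitor_inv, Category.assoc, Functor.Monoidal.μ_δ_assoc] at h
    have h2 := congrArg (fun f => G.obj Y ◁ ε G ≫ μ G Y (𝟙_ C) ≫ f ≫ δ G (𝟙_ C) Y ≫ η G ▷ G.obj Y) h
    simp only [Category.assoc, Functor.Monoidal.μ_δ_assoc, Functor.Monoidal.whiskerRight_ε_η,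
      Functor.Monoidal.whiskerLeft_ε_η_assoc, Category.comp_id] at h2
    simpa only [whiskerLeft_comp, comp_whiskerRight, Category.assoc] using h2
  evaluation_coevaluation' := by
    have h := congrArg G.map (ExactPairing.evaluation_coevaluation X Y)
    simp only [Functor.map_comp, Functor.Monoidal.map_whiskerLeft,
      Functor.Monoidal.map_whiskerRight,
      Functor.Monoidal.map_associator,
      Functor.Monoidal.map_leftUnitor, Functor.Monoidal.map_rightUnitor_inv, Category.assoc, Functor.Monoidal.μ_δ_assoc] at h
    have h2 := congrArg (fun f => ε G ▷ G.obj X ≫ μ G (𝟙_ C) X ≫ f ≫ δ G X (𝟙_ C) ≫ G.obj X ◁ η G) h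
    simp only [Category.assoc, Functor.Monoidal.μ_δ_assoc,
      Functor.Monoidal.whiskerLeft_ε_η,
      Functor.Monoidal.whiskerRight_ε_η_assoc, Category.comp_id] at h2
    simpa only [whiskerLeft_comp, comp_whiskerRight, Category.assoc] using h2

theorem Dualisable.map (G : C ⥤ D) [G.Monoidal] {X : C} (h : Dualisable X) :
    Dualisable (G.obj X) := by
  obtain ⟨Y, ⟨_⟩⟩ := h
  exact ⟨G.obj Y, ⟨mapExactPairing G X Y⟩⟩

variable [SymmetricCategory C] [SymmetricCategory D]

theorem exch_comp_μ (G : C ⥤ D) [G.Braided] (A B X : C) :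
    exch (G.obj A) (G.obj B) (G.obj X) ≫ G.obj B ◁ μ G A X ≫ μ G B (A ⊗ X) =
      G.obj A ◁ μ G B X ≫ μ G A (B ⊗ X) ≫ G.map (exch A B X) := by
  simp only [exch, Functor.map_comp, Category.assoc]
  rw [Functor.LaxMonoidal.associativity_inv_assoc, ← Functor.LaxMonoidal.associativity,
    ← μ_natural_left_assoc, ← comp_whiskerRight_assoc, ← comp_whiskerRight_assoc,
    Functor.LaxBraided.braided]

variable [Preadditive C] [Preadditive D] [MonoidalPreadditive D]

theorem frontStep_comp_μ (G : C ⥤ D) [G.Braided] [G.Additive] {A X : C} {P : D} (p : P ⟶ G.obj X)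
    {x' : G.obj A ⊗ P ⟶ G.obj A ⊗ P} {x : A ⊗ X ⟶ A ⊗ X}
    (h : x' ≫ G.obj A ◁ p ≫ μ G A X = (G.obj A ◁ p ≫ μ G A X) ≫ G.map x) :
    frontStep (G.obj A) P x' ≫ G.obj A ◁ (G.obj A ◁ p ≫ μ G A X) ≫ μ G A (A ⊗ X) =
      (G.obj A ◁ (G.obj A ◁ p ≫ μ G A X) ≫ μ G A (A ⊗ X)) ≫ G.map (frontStep A X x) := by
  have h1 : exch (G.obj A) (G.obj A) P ≫ G.obj A ◁ G.obj A ◁ p =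
      G.obj A ◁ G.obj A ◁ p ≫ exch (G.obj A) (G.obj A) (G.obj X) := by
    simpa using (exch_naturality (𝟙 (G.obj A)) (𝟙 (G.obj A)) p).symm
  rw [frontStep, frontStep, Preadditive.sub_comp, Category.id_comp, G.map_sub,
    Preadditive.comp_sub, G.map_id, Category.comp_id, G.map_comp]
  congr 1
  rw [Category.assoc, Category.assoc, ← μ_natural_right_assoc G A x, ← whiskerLeft_comp_assoc, ← h]
  simp only [whiskerLeft_comp, Category.assoc]
  rw [reassoc_of% h1, exch_comp_μ]

/-- The comparison of tensor powers under a monoidal functor. -/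
def tpowIso (G : C ⥤ D) [G.Monoidal] (A : C) : ∀ n, tpow (G.obj A) n ≅ G.obj (tpow A n)
  | 0 => Functor.Monoidal.εIso G
  | n + 1 => whiskerLeftIso (G.obj A) (tpowIso G A n) ≪≫ Functor.Monoidal.μIso G A (tpow A n)

theorem frontSum_comp_tpowIso (G : C ⥤ D) [G.Braided] [G.Additive] (A : C) (n : ℕ) :
    frontSum (G.obj A) n ≫ G.obj A ◁ (tpowIso G A n).hom ≫ μ G A (tpow A n) =
      (G.obj A ◁ (tpowIso G A n).hom ≫ μ G A (tpow A n)) ≫ G.map (frontSum A n) := by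
  induction n with
  | zero =>
    change 𝟙 _ ≫ _ = _ ≫ G.map (𝟙 _)
    rw [G.map_id, Category.comp_id, Category.id_comp]
  | succ n ih => exact frontStep_comp_μ G (tpowIso G A n).hom ih

/-- A braided additive functor carries antisymmetrization to antisymmetrization. Its vanishing
therefore passes forward along any such functor, and backward along a faithful one. -/
theorem alt_comp_tpowIso (G : C ⥤ D) [G.Braided] [G.Additive] (A : C) (n : ℕ) :
    alt (G.obj A) n ≫ (tpowIso G A n).hom = (tpowIso G A n).hom ≫ G.map (alt A n) := by
  induction n with
  | zero =>
    change 𝟙 _ ≫ _ = _ ≫ G.map (𝟙 _)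
    rw [G.map_id, Category.comp_id, Category.id_comp]
  | succ n ih =>
    change (frontSum (G.obj A) n ≫ G.obj A ◁ alt (G.obj A) n) ≫
      G.obj A ◁ (tpowIso G A n).hom ≫ μ G A (tpow A n) =
      (G.obj A ◁ (tpowIso G A n).hom ≫ μ G A (tpow A n)) ≫ G.map (frontSum A n ≫ A ◁ alt A n)
    rw [Category.assoc, ← whiskerLeft_comp_assoc, ih, whiskerLeft_comp, Category.assoc,
      μ_natural_right, G.map_comp, ← Category.assoc, ← Category.assoc, ← Category.assoc,
      Category.assoc (frontSum (G.obj A) n), frontSum_comp_tpowIso]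

theorem alt_map_eq_zero (G : C ⥤ D) [G.Braided] [G.Additive] {A : C} {n : ℕ} (h : alt A n = 0) :
    alt (G.obj A) n = 0 := by
  rw [← cancel_mono (tpowIso G A n).hom, alt_comp_tpowIso, h, G.map_zero, comp_zero, zero_comp]

theorem alt_eq_zero_of_map (G : C ⥤ D) [G.Braided] [G.Additive] [G.Faithful] {A : C} {n : ℕ}
    (h : alt (G.obj A) n = 0) : alt A n = 0 := by
  apply G.map_injective
  rw [← cancel_epi (tpowIso G A n).hom, ← alt_comp_tpowIso, h, G.map_zero, comp_zero, zero_comp]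

end MonoidalFunctor

/-! ### Antisymmetrization of modules. -/

section AltModule

open TensorProduct

variable {R : Type v} [CommRing R]

/-- Tensor powers of a module. -/
abbrev tpowMod (V : ModuleCat.{v} R) (n : ℕ) : ModuleCat.{v} R := tpow V n

/-- Pure tensors in a tensor power. -/
def tpowPure (V : ModuleCat.{v} R) : ∀ n, (Fin n → V) → tpowMod V n
  | 0, _ => (1 : R)
  | n + 1, w => w 0 ⊗ₜ[R] tpowPure V n (Fin.tail w)

theorem tpow_hom_ext {V W : ModuleCat.{v} R} {n : ℕ} {f g : tpowMod V n ⟶ W}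
    (h : ∀ w, f.hom (tpowPure V n w) = g.hom (tpowPure V n w)) : f = g := by
  induction n generalizing W with
  | zero =>
    apply ModuleCat.hom_ext
    exact LinearMap.ext_ring (h Fin.elim0)
  | succ n ih =>
    apply ModuleCat.hom_ext
    refine TensorProduct.ext (LinearMap.ext fun x => ?_)
    have := ih (f := ModuleCat.ofHom (f.hom ∘ₗ TensorProduct.mk R V (tpowMod V n) x))
      (g := ModuleCat.ofHom (g.hom ∘ₗ TensorProduct.mk R V (tpowMod V n) x)) fun w =>
        h (Fin.cons x w)
    exact congrArg (fun f => f.hom) this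

/-- Each further step moves the factor in front of the tail, which costs one exchange and one sign.
-/
theorem frontSum_tpowPure (V : ModuleCat.{v} R) (n : ℕ) (w : Fin (n + 1) → V) :
    (frontSum V n).hom (tpowPure V (n + 1) w) =
      ∑ i : Fin (n + 1), (-1 : ℤ) ^ (i : ℕ) •
        (w i ⊗ₜ[R] tpowPure V n (i.removeNth w) : V ⊗[R] tpowMod V n) := by
  induction n with
  | zero =>
    rw [Fin.sum_univ_one, Fin.val_zero, pow_zero, one_smul]
    rfl
  | succ n ih =>
    rw [Fin.sum_univ_succ]
    have h1 := ih (Fin.tail w)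
    let E : V ⊗[R] tpowMod V n →ₗ[R] tpowMod V (n + 2) :=
      (exch V V (tpowMod V n)).hom ∘ₗ TensorProduct.mk R V (V ⊗[R] tpowMod V n) (w 0)
    have h2 : (frontSum V (n + 1)).hom (tpowPure V (n + 2) w) =
        tpowPure V (n + 2) w - E ((frontSum V n).hom (tpowPure V (n + 1) (Fin.tail w))) := rfl
    rw [h2, h1, _root_.map_sum, sub_eq_add_neg, ← Finset.sum_neg_distrib]
    congr 1
    · rw [Fin.val_zero, pow_zero, one_smul]
      rfl
    · refine Finset.sum_congr rfl fun i _ => ?_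
      rw [_root_.map_zsmul, Fin.val_succ, pow_succ, mul_neg_one, neg_smul]
      have h3 : i.succ.removeNth w = Fin.cons (w 0) (i.removeNth (Fin.tail w)) := by
        funext j
        cases j using Fin.cases <;> simp [Fin.removeNth, Fin.tail]
      rw [h3]
      rfl

/-- The expansion of `frontSum` is the sum defining `AlternatingMap.alternatizeUncurryFin`. The
result is alternating, not merely antisymmetric, so the argument is valid in every characteristic.
-/
theorem exists_alternatingMap (V : ModuleCat.{v} R) (n : ℕ) :
    ∃ Φ : V [⋀^Fin n]→ₗ[R] tpowMod V n,
      ∀ w, (alt V n).hom (tpowPure V n w) = Φ w := by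
  induction n with
  | zero => exact ⟨AlternatingMap.constOfIsEmpty R V (Fin 0) (1 : R), fun w => rfl⟩
  | succ n ih =>
    obtain ⟨Φ, hΦ⟩ := ih
    let f : V →ₗ[R] V [⋀^Fin n]→ₗ[R] tpowMod V (n + 1) :=
      { toFun x := (TensorProduct.mk R V (tpowMod V n) x).compAlternatingMap Φ
        map_add' x y := by ext w; exact TensorProduct.add_tmul _ _ _
        map_smul' a x := by ext w; exact TensorProduct.smul_tmul' _ _ _ }
    refine ⟨AlternatingMap.alternatizeUncurryFin f, fun w => ?_⟩
    change (V ◁ alt V n).hom ((frontSum V n).hom (tpowPure V (n + 1) w)) = _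
    rw [frontSum_tpowPure, AlternatingMap.alternatizeUncurryFin_apply, _root_.map_sum]
    refine Finset.sum_congr rfl fun i _ => ?_
    rw [_root_.map_zsmul]
    congr 1
    change w i ⊗ₜ[R] (alt V n).hom _ = w i ⊗ₜ[R] Φ _
    rw [hΦ]

/-- More vectors than the dimension are linearly dependent, and an alternating map vanishes on them.
-/
theorem alt_eq_zero_of_finrank_lt {K : Type v} [Field K] (V : ModuleCat.{v} K)
    [Module.Finite K V] {n : ℕ} (hn : Module.finrank K V < n) : alt V n = 0 := by
  obtain ⟨Φ, hΦ⟩ := exists_alternatingMap V n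
  refine tpow_hom_ext fun w => ?_
  rw [hΦ]
  refine Φ.map_linearDependent w fun h => ?_
  have := h.fintype_card_le_finrank
  rw [Fintype.card_fin] at this
  omega

end AltModule

end ScalarExtension

end

/-! ### Morphisms from `t(X)`, and simplicity of `t(X)`. -/

noncomputable section
namespace ScalarExtension

open MonoidalCategory

set_option linter.unusedSectionVars false

attribute [local instance] indPreadditive indLinear LexPresheaf.baseModule

variable {F F' : Type v} [Field F] [Field F'] [Algebra F F']
variable {T : Type u} [Category.{v} T] [Abelian T] [Linear F T] [IsFiniteScalarExt F F' T]

section TFunctor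

variable (F F' T) in
/-- The functor `t`. -/
abbrev tFunctor : T ⥤ ScalarExt F F' T := toScalarExt IsFiniteScalarExt.isFiniteLength

/-- The tautological section of `t(X)`. -/
def tUnit (X : T) : El ((tFunctor F F' T).obj X).obj X := gen F F' X

theorem tFunctor_lex_ext {X : T} {H : LexPresheaf F F' T}
    {α α' : (elems ((tFunctor F F' T).obj X).obj).Hom H}
    (h : α.app X (tUnit X) = α'.app X (tUnit X)) : α = α' := t_hom_ext h

theorem tFunctor_hom_ext {X : T} {M : ScalarExt F F' T} {f g : (tFunctor F F' T).obj X ⟶ M}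
    (h : (act f).app X (tUnit X) = (act g).app X (tUnit X)) : f = g :=
  act_injective (tFunctor_lex_ext h)

theorem act_tFunctor_map_tUnit {X Y : T} (f : X ⟶ Y) :
    (act ((tFunctor F F' T).map f)).app X (tUnit X) = (elems _).map f (tUnit Y) :=
  elMap_toIndModule_gen f

/-- The morphism `t(X) ⟶ M` defined by a section. -/
def sec {M : ScalarExt F F' T} {X : T} (x : El M.obj X) : (tFunctor F F' T).obj X ⟶ M :=
  ofAct (tDesc x)

@[simp]
theorem act_sec_tUnit {M : ScalarExt F F' T} {X : T} (x : El M.obj X) :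
    (act (sec x)).app X (tUnit X) = x :=
  (congrArg (fun α => α.app X (tUnit X)) (act_ofAct (tDesc x))).trans (tDesc_gen x)

@[simp]
theorem sec_act_tUnit {M : ScalarExt F F' T} {X : T} (f : (tFunctor F F' T).obj X ⟶ M) :
    sec ((act f).app X (tUnit X)) = f := tFunctor_hom_ext (act_sec_tUnit _)

theorem sec_map {M : ScalarExt F F' T} {X Y : T} (f : X ⟶ Y) (y : El M.obj Y) :
    sec ((elems M.obj).map f y) = (tFunctor F F' T).map f ≫ sec y :=
  tFunctor_hom_ext (by rw [act_sec_tUnit, act_comp, act_tFunctor_map_tUnit,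
    LexPresheaf.Hom.naturality, act_sec_tUnit])

theorem sec_act {M N : ScalarExt F F' T} {X : T} (f : M ⟶ N) (x : El M.obj X) :
    sec ((act f).app X x) = sec x ≫ f :=
  tFunctor_hom_ext (by rw [act_sec_tUnit, act_comp, act_sec_tUnit])

theorem sec_add {M : ScalarExt F F' T} {X : T} (x y : El M.obj X) :
    sec (x + y) = sec x + sec y :=
  tFunctor_hom_ext (by rw [act_sec_tUnit, act_add, act_sec_tUnit, act_sec_tUnit])

theorem sec_smul {M : ScalarExt F F' T} {X : T} (a : F') (x : El M.obj X) :
    sec (a • x) = a • sec x :=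
  tFunctor_hom_ext (by rw [act_sec_tUnit, act_smul, act_sec_tUnit])

instance tFunctor_additive : (tFunctor F F' T).Additive where
  map_add {X Y f g} := tFunctor_hom_ext (by
    rw [act_add, act_tFunctor_map_tUnit, act_tFunctor_map_tUnit, act_tFunctor_map_tUnit,
      LexPresheaf.map_add])

/-- Morphisms `t(X) ⟶ M` are sections of `M` over `X`. -/
def secEquiv (X : T) (M : ScalarExt F F' T) :
    El M.obj X ≃ₗ[F'] ((tFunctor F F' T).obj X ⟶ M) where
  toFun := sec
  map_add' := sec_add
  map_smul' := sec_smul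
  invFun f := (act f).app X (tUnit X)
  left_inv := act_sec_tUnit
  right_inv := sec_act_tUnit

/-- The tautological section corresponds to `1 ⊗ 𝟙 X`, and `F'` is faithfully flat over `F`. -/
theorem tUnit_ne_zero {X : T} (h : 𝟙 X ≠ 0) : tUnit (F := F) (F' := F') X ≠ 0 := by
  intro h0
  have h1 : tSectionsEquiv X X (TensorProduct.tmul F (1 : F') (𝟙 X)) = gen F F' X := by
    rw [tSectionsEquiv_tmul, one_smul, LexPresheaf.map_id]
  exact h ((Module.FaithfullyFlat.one_tmul_eq_zero_iff F (X ⟶ X) (A := F') (𝟙 X)).1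
    ((tSectionsEquiv X X).map_eq_zero_iff.1 (h1.trans h0)))

/-- Every object of the scalar extension has a presentation by objects `t(X)`. -/
theorem exists_presentation_scalarExt (M : ScalarExt F F' T) : ∃ (X₁ X₀ : T)
    (φ : (tFunctor F F' T).obj X₁ ⟶ (tFunctor F F' T).obj X₀) (p : (tFunctor F F' T).obj X₀ ⟶ M)
    (w : φ ≫ p = 0), Nonempty (IsColimit (CokernelCofork.ofπ p w)) := by
  obtain ⟨X₁, X₀, φ, p, _, w, ⟨hp⟩⟩ := exists_presentation
    (fun X => IsFiniteScalarExt.isFiniteLength (F := F) (F' := F') X) M.property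
  let φ' : (tFunctor F F' T).obj X₁ ⟶ (tFunctor F F' T).obj X₀ := ObjectProperty.homMk φ
  let p' : (tFunctor F F' T).obj X₀ ⟶ M := ObjectProperty.homMk p
  have : Epi p'.hom := ‹Epi p›
  have : Epi p' := epi_of_epi_obj_hom p'
  have w' : φ' ≫ p' = 0 := ObjectProperty.hom_ext _ w
  exact ⟨X₁, X₀, φ', p', w', ⟨CokernelCofork.IsColimit.ofπ' p' w' fun g hg =>
    let d := CokernelCofork.IsColimit.desc' hp g.hom (congrArg (fun f => f.hom) hg)
    ⟨ObjectProperty.homMk d.1, ObjectProperty.hom_ext _ d.2⟩⟩⟩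

/-- Every object of the scalar extension is a cokernel of a morphism between objects `t(X)`. -/
theorem exists_iso_cokernel (M : ScalarExt F F' T) : ∃ (X₁ X₀ : T)
    (φ : (tFunctor F F' T).obj X₁ ⟶ (tFunctor F F' T).obj X₀), Nonempty (M ≅ cokernel φ) := by
  obtain ⟨X₁, X₀, φ, p, w, ⟨hp⟩⟩ := exists_presentation_scalarExt M
  exact ⟨X₁, X₀, φ, ⟨hp.coconePointUniqueUpToIso (colimit.isColimit (parallelPair φ 0))⟩⟩

theorem exists_epi_tFunctor (M : ScalarExt F F' T) : ∃ (X : T)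
    (p : (tFunctor F F' T).obj X ⟶ M), Epi p := by
  obtain ⟨X₁, X₀, φ, ⟨e⟩⟩ := exists_iso_cokernel M
  exact ⟨X₀, cokernel.π φ ≫ e.inv, inferInstance⟩

theorem exists_eq_smul_tUnit (X : T) (h : ∀ f : X ⟶ X, ∃ a : F, f = a • 𝟙 X)
    (x : El (tObj F F' X) X) : ∃ a : F', x = a • gen F F' X := by
  induction x using tSections_induction with
  | zero => exact ⟨0, (zero_smul _ _).symm⟩
  | add x y hx hy =>
    obtain ⟨a, rfl⟩ := hx
    obtain ⟨b, rfl⟩ := hy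
    exact ⟨a + b, (add_smul _ _ _).symm⟩
  | smul_map a f =>
    obtain ⟨b, rfl⟩ := h f
    exact ⟨a * algebraMap F F' b, by rw [LexPresheaf.map_smul, LexPresheaf.map_id, smul_smul]⟩

theorem exists_eq_smul_id_tFunctor (X : T) (h : ∀ f : X ⟶ X, ∃ a : F, f = a • 𝟙 X)
    (f : (tFunctor F F' T).obj X ⟶ (tFunctor F F' T).obj X) : ∃ a : F', f = a • 𝟙 _ := by
  obtain ⟨a, ha⟩ := exists_eq_smul_tUnit X h ((act f).app X (tUnit X))
  exact ⟨a, tFunctor_hom_ext (by rw [act_smul, act_id]; exact ha)⟩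

/-- If all endomorphisms of `X` are scalars, the sections of `t(X)` over `X` are the multiples of
the tautological one. A submodule with a nonzero section over `X` contains the tautological section,
which splits the inclusion. Otherwise it has no nonzero section over `X`, and is zero by
`le_of_memSub_le_of_simple`. -/
theorem simple_tFunctor_obj (X : T) [Simple X]
    (h : ∀ f : X ⟶ X, ∃ a : F, f = a • 𝟙 X) : Simple ((tFunctor F F' T).obj X) where
  mono_isIso_iff_nonzero {M} f _ := by
    constructor
    · intro _ hf
      have h0 : 𝟙 ((tFunctor F F' T).obj X) = 0 := by
        rw [← cancel_epi f, hf, zero_comp, zero_comp]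
      refine tUnit_ne_zero (F := F) (F' := F') (id_nonzero X) ?_
      rw [← act_id (tUnit X), h0, act_zero]
    · intro hf
      have : Mono f.hom := inferInstance
      suffices Epi f from isIso_of_mono_of_epi f
      by_contra hepi
      refine hf (ObjectProperty.hom_ext _ ?_)
      have hle : Subobject.mk f.hom ≤ ⊥ := le_of_memSub_le_of_simple X fun x hx => by
        obtain ⟨a, rfl⟩ := exists_eq_smul_tUnit X h x
        by_cases ha : a = 0
        · rw [ha, zero_smul]
          exact zero_mem _
        · exfalso
          obtain ⟨y, hy⟩ := (mem_memSub_mk f.hom).1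
            (((memSub (Subobject.mk f.hom) X).smul_mem_iff ha).1 hx)
          have : sec y ≫ f = 𝟙 _ := tFunctor_hom_ext (by
            rw [act_comp, act_sec_tUnit, act_id]
            exact hy)
          have : IsSplitEpi f := ⟨⟨⟨sec y, this⟩⟩⟩
          exact hepi inferInstance
      have := Subobject.mk_eq_bot_iff_zero.1 (le_bot_iff.1 hle)
      exact this

/-- `Hom(X, Y)` embeds into `End(X ⊞ Y)` as a block. -/
theorem finite_hom_of_finite_end (hend : ∀ X : T, Module.Finite F (End X)) (X Y : T) :
    Module.Finite F (X ⟶ Y) := by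
  have : Module.Finite F (X ⊞ Y ⟶ X ⊞ Y) := hend (X ⊞ Y)
  let l : (X ⟶ Y) →ₗ[F] (X ⊞ Y ⟶ X ⊞ Y) :=
    (Linear.leftComp F _ biprod.fst).comp (Linear.rightComp F X (biprod.inr : Y ⟶ X ⊞ Y))
  refine Module.Finite.of_injective l fun f g hfg => ?_
  have : (biprod.fst : X ⊞ Y ⟶ X) ≫ f ≫ (biprod.inr : Y ⟶ X ⊞ Y) = biprod.fst ≫ g ≫ biprod.inr :=
    hfg
  rwa [cancel_epi, cancel_mono] at this

theorem finite_tFunctor_hom (hend : ∀ X : T, Module.Finite F (End X)) (X Y : T) :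
    Module.Finite F' ((tFunctor F F' T).obj X ⟶ (tFunctor F F' T).obj Y) :=
  have := finite_hom_of_finite_end hend X Y
  have : Module.Finite F' (El ((tFunctor F F' T).obj Y).obj X) :=
    Module.Finite.equiv (tSectionsEquiv Y X)
  Module.Finite.equiv (secEquiv X _)

end TFunctor

/-! ### Consequences of a fibre functor: the unit is simple, antisymmetrized powers vanish. -/

section FibreFunctor

variable [MonoidalCategory T] [SymmetricCategory T]

/-- The fibre functor sends the unit to a line. A nonzero morphism to the unit has nonzero image by
faithfulness, hence surjective image, and a faithful functor reflects epimorphisms. -/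
theorem simple_unit_of_fibreFunctor {L : Type v} [Field L] [Algebra F L] (ω : FibreFunctor F T L)
    (h : 𝟙 (𝟙_ T) ≠ 0) : Simple (𝟙_ T) where
  mono_isIso_iff_nonzero {K} f _ := by
    have := ω.braided
    have := ω.faithful
    have := ω.additive
    have := ω.leftExact
    constructor
    · intro _ hf
      exact h (by rw [← cancel_epi f, hf, zero_comp, zero_comp])
    · intro hf
      let e : 𝟙_ (ModuleCat.{v} L) ≅ ω.functor.obj (𝟙_ T) := Functor.Monoidal.εIso ω.functor
      let g : ω.functor.obj K ⟶ 𝟙_ (ModuleCat.{v} L) := ω.functor.map f ≫ e.inv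
      have hg : g.hom ≠ 0 := fun h0 => hf (ω.functor.map_injective (by
        have : g = 0 := ModuleCat.hom_ext h0
        rw [ω.functor.map_zero, ← cancel_mono e.inv, zero_comp]
        exact this))
      have : Epi g := (ModuleCat.epi_iff_surjective g).2 (LinearMap.surjective (f := (g.hom : _ →ₗ[L] L)) hg)
      have h1 : ω.functor.map f = g ≫ e.hom := by
        rw [Category.assoc, Iso.inv_hom_id, Category.comp_id]
      have : Epi (ω.functor.map f) := by
        rw [h1]
        infer_instance
      have : Epi f := ω.functor.epi_of_epi_map this
      exact isIso_of_mono_of_epi f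

/-- The fibre is finite-dimensional, so its antisymmetrization vanishes beyond the dimension;
faithfulness brings this back to `X`. -/
theorem exists_alt_eq_zero [MonoidalPreadditive T] {L : Type v} [Field L] [Algebra F L]
    (ω : FibreFunctor F T L) (X : T) : ∃ n, alt X n = 0 := by
  have := ω.braided
  have := ω.faithful
  have := ω.additive
  have := ω.finite X
  exact ⟨_, alt_eq_zero_of_map ω.functor
    (alt_eq_zero_of_finrank_lt (ω.functor.obj X) (Nat.lt_succ_self _))⟩

end FibreFunctor

/-! ### `ScalarExt` is pre-Tannakian. -/

section Rigidity

variable [MonoidalCategory T] [SymmetricCategory T]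
  [MonoidalCategory (ScalarExt F F' T)] [SymmetricCategory (ScalarExt F F' T)]
  [MonoidalPreadditive (ScalarExt F F' T)] [RightExactTensor (ScalarExt F F' T)]
  [(tFunctor F F' T).Braided]

variable (F F' T) in
/-- The unit constraint of `t`. -/
def tUnitIso : 𝟙_ (ScalarExt F F' T) ≅ (tFunctor F F' T).obj (𝟙_ T) :=
  Functor.Monoidal.εIso (tFunctor F F' T)

theorem simple_unit_scalarExt [Simple (𝟙_ T)] (h : ∀ f : 𝟙_ T ⟶ 𝟙_ T, ∃ a : F, f = a • 𝟙 _) :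
    Simple (𝟙_ (ScalarExt F F' T)) :=
  have := simple_tFunctor_obj (F := F) (F' := F') (𝟙_ T) h
  Simple.of_iso (tUnitIso F F' T)

/-- Write `M` as the cokernel of a morphism `t(X₁) ⟶ t(X₀)`. Both objects inherit duals from `T`,
and antisymmetrization of a high power of `t(X₁)` vanishes because it does so for `X₁`. The cokernel
is then flat, hence dualisable. -/
theorem dualisable_scalarExt [HasDualObjects T] [Simple (𝟙_ (ScalarExt F F' T))]
    (halt : ∀ X : T, ∃ n, alt X n = 0) (M : ScalarExt F F' T) : Dualisable M := by
  obtain ⟨X₁, X₀, φ, ⟨e⟩⟩ := exists_iso_cokernel M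
  have hd : ∀ X : T, Dualisable ((tFunctor F F' T).obj X) := fun X =>
    Dualisable.map (tFunctor F F' T) (HasDualObjects.exists_exactPairing X)
  obtain ⟨n, hn⟩ := halt X₁
  exact (dualisable_cokernel (hd X₁) (hd X₀) φ
    (flat_cokernel (hd X₀) φ (alt_map_eq_zero (tFunctor F F' T) hn))).of_iso e.symm

/-- The unit is isomorphic to `t(𝟙)`, whose endomorphisms are `F' ⊗ End(𝟙) = F'`. Injectivity only
needs that the unit is nonzero. -/
theorem unit_bijective_scalarExt [Simple (𝟙_ (ScalarExt F F' T))]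
    (h : ∀ f : 𝟙_ T ⟶ 𝟙_ T, ∃ a : F, f = a • 𝟙 _) :
    Function.Bijective fun a : F' => a • 𝟙 (𝟙_ (ScalarExt F F' T)) := by
  constructor
  · intro a b hab
    have h0 : (a - b) • 𝟙 (𝟙_ (ScalarExt F F' T)) = 0 := by
      rw [sub_smul, sub_eq_zero]
      exact hab
    by_contra hne
    exact id_nonzero (𝟙_ (ScalarExt F F' T))
      ((smul_eq_zero.1 h0).resolve_left (sub_ne_zero.2 hne))
  · intro f
    obtain ⟨a, ha⟩ := exists_eq_smul_id_tFunctor (F' := F') (𝟙_ T) h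
      ((tUnitIso F F' T).inv ≫ f ≫ (tUnitIso F F' T).hom)
    refine ⟨a, ?_⟩
    change a • 𝟙 _ = f
    rw [← cancel_epi (tUnitIso F F' T).inv, ← cancel_mono (tUnitIso F F' T).hom, Category.assoc,
      Category.assoc, ha, Linear.smul_comp, Linear.comp_smul, Category.id_comp, Iso.inv_hom_id]

/-- By duality `Hom(M, N)` embeds into `Hom(M ⊗ N', 𝟙)` for a dual `N'` of `N`. Covering `M` by
`t(X)` and `N'` by `t(Y)` embeds this into `Hom(t(X ⊗ Y), t(𝟙))`, which is finite-dimensional. -/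
theorem finite_hom_scalarExt (hd : ∀ M : ScalarExt F F' T, Dualisable M)
    (hend : ∀ X : T, Module.Finite F (End X)) [MonoidalLinear F' (ScalarExt F F' T)]
    (M N : ScalarExt F F' T) : Module.Finite F' (M ⟶ N) := by
  obtain ⟨N', ⟨_⟩⟩ := (hd N).exists_swap
  obtain ⟨X, p, _⟩ := exists_epi_tFunctor M
  obtain ⟨Y, q, _⟩ := exists_epi_tFunctor N'
  have := finite_tFunctor_hom (F' := F') hend (X ⊗ Y) (𝟙_ T)
  let l : (M ⟶ N) →ₗ[F'] ((tFunctor F F' T).obj (X ⊗ Y) ⟶ (tFunctor F F' T).obj (𝟙_ T)) :=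
    { toFun f := (Functor.Monoidal.μIso (tFunctor F F' T) X Y).inv ≫ (p ⊗ₘ q) ≫
        (f ▷ N' ≫ ExactPairing.evaluation N' N) ≫ (tUnitIso F F' T).hom
      map_add' f g := by
        simp only [MonoidalPreadditive.add_whiskerRight, Preadditive.add_comp, Preadditive.comp_add]
      map_smul' a f := by
        simp only [MonoidalLinear.smul_whiskerRight, Linear.smul_comp, Linear.comp_smul,
          RingHom.id_apply] }
  refine Module.Finite.of_injective l ((injective_iff_map_eq_zero l).2 fun f hf => ?_)
  have hf' : (Functor.Monoidal.μIso (tFunctor F F' T) X Y).inv ≫ (p ⊗ₘ q) ≫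
        (f ▷ N' ≫ ExactPairing.evaluation N' N) ≫ (tUnitIso F F' T).hom = 0 := hf
  have : Epi (p ⊗ₘ q) := by
    rw [MonoidalCategory.tensorHom_def]
    infer_instance
  rw [← comp_zero (f := (Functor.Monoidal.μIso (tFunctor F F' T) X Y).inv), cancel_epi,
    ← comp_zero (f := p ⊗ₘ q), cancel_epi, ← zero_comp (f := (tUnitIso F F' T).hom), cancel_mono] at hf'
  exact eq_zero_of_whiskerRight_evaluation f hf'

theorem exists_eq_smul_id_unit (hT : IsPreTannakian F T) (f : 𝟙_ T ⟶ 𝟙_ T) :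
    ∃ a : F, f = a • 𝟙 _ := by
  obtain ⟨a, ha⟩ := hT.unit_bijective.2 f
  exact ⟨a, ha.symm⟩

theorem simple_unit_scalarExt_of_fibreFunctor (hT : IsPreTannakian F T) {L : Type v} [Field L]
    [Algebra F L] (ω : FibreFunctor F T L) : Simple (𝟙_ (ScalarExt F F' T)) := by
  have h0 : 𝟙 (𝟙_ T) ≠ 0 := fun h => one_ne_zero (α := F) (hT.unit_bijective.1 (by simp [h]))
  have := simple_unit_of_fibreFunctor ω h0
  exact simple_unit_scalarExt (exists_eq_smul_id_unit hT)

/-- The scalar extension of a Tannakian category is pre-Tannakian. -/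
theorem isPreTannakian_scalarExt (hT : IsPreTannakian F T) {L : Type v} [Field L] [Algebra F L]
    (ω : FibreFunctor F T L) [MonoidalLinear F' (ScalarExt F F' T)] :
    IsPreTannakian F' (ScalarExt F F' T) := by
  have := hT.toMonoidalPreadditive
  have : HasDualObjects T := ⟨hT.dualisable⟩
  have : Simple (𝟙_ (ScalarExt F F' T)) := simple_unit_scalarExt_of_fibreFunctor hT ω
  have hd := dualisable_scalarExt (F := F) (F' := F') (exists_alt_eq_zero ω)
  exact
    { toIsAbelian := scalarExt_isAbelian
      toMonoidalPreadditive := inferInstance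
      toMonoidalLinear := inferInstance
      tensorLeft_rightExact := RightExactTensor.tensorLeft
      tensorRight_rightExact := RightExactTensor.tensorRight
      unit_bijective := unit_bijective_scalarExt (exists_eq_smul_id_unit hT)
      dualisable := hd
      finite_length := isFiniteLength_scalarExt
      finite_end := fun M => finite_hom_scalarExt hd hT.finite_end M M }

end Rigidity

end ScalarExtension

end

/-! ### Any tensor structure extending that of `T` represents bimorphisms. -/

noncomputable section
namespace ScalarExtension

open MonoidalCategory

set_option linter.unusedSectionVars false

attribute [local instance] indPreadditive indLinear LexPresheaf.baseModule

variable {F F' : Type v} [Field F] [Field F'] [Algebra F F']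
variable {T : Type u} [Category.{v} T] [Abelian T] [Linear F T] [IsFiniteScalarExt F F' T]
variable [MonoidalCategory T] [SymmetricCategory T] [HasDualObjects T] [MonoidalPreadditive T]
  [MonoidalLinear F T]
  [MonoidalCategory (ScalarExt F F' T)] [SymmetricCategory (ScalarExt F F' T)]
  [MonoidalPreadditive (ScalarExt F F' T)] [MonoidalLinear F' (ScalarExt F F' T)]
  [RightExactTensor (ScalarExt F F' T)] [(tFunctor F F' T).Braided]

namespace LexPresheaf.Bimor

theorem IsUniversal.comp_iso {M N H H₂ : LexPresheaf F F' T} {β : Bimor M N H} (hβ : β.IsUniversal)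
    (α : H.Hom H₂) (α' : H₂.Hom H) (h : ∀ X x, α'.app X (α.app X x) = x)
    (h' : ∀ X x, α.app X (α'.app X x) = x) : (β.comp α).IsUniversal := by
  intro H' γ
  refine ⟨α'.comp (hβ.desc γ), ext_apply fun X Y x y => ?_, fun κ hκ => Hom.ext_apply fun X x => ?_⟩
  · rw [comp_app, comp_app, Hom.comp_app, h, hβ.desc_app]
  · have : α.comp κ = hβ.desc γ := hβ.hom_ext fun X Y x y => by
      rw [hβ.desc_app, ← hκ]
      rfl
    rw [Hom.comp_app, ← this, Hom.comp_app, h']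

end LexPresheaf.Bimor

section PureTensor

open Functor.LaxMonoidal Functor.OplaxMonoidal LexPresheaf

variable {M N P M' N' : ScalarExt F F' T}

theorem sec_injective {X : T} {x y : El M.obj X} (h : sec x = sec y) : x = y := by
  rw [← act_sec_tUnit x, h, act_sec_tUnit]

/-- The tensor product of two sections. -/
def tensorSec {X Y : T} (x : El M.obj X) (y : El N.obj Y) : El (M ⊗ N).obj (X ⊗ Y) :=
  (act (δ (tFunctor F F' T) X Y ≫ (sec x ⊗ₘ sec y))).app _ (tUnit (X ⊗ Y))

theorem sec_tensorSec {X Y : T} (x : El M.obj X) (y : El N.obj Y) :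
    sec (tensorSec x y) = δ (tFunctor F F' T) X Y ≫ (sec x ⊗ₘ sec y) := sec_act_tUnit _

/-- The bimorphism given by the tensor product of sections. -/
def tensorBimor (M N : ScalarExt F F' T) :
    Bimor (elems M.obj) (elems N.obj) (elems (M ⊗ N).obj) where
  app X Y := LinearMap.mk₂ F' tensorSec
    (fun x x' y => sec_injective (by
      simp only [sec_add, sec_tensorSec, MonoidalPreadditive.add_tensor, Preadditive.comp_add]))
    (fun a x y => sec_injective (by
      simp only [sec_smul, sec_tensorSec, MonoidalCategory.tensorHom_def,
        MonoidalLinear.smul_whiskerRight, Linear.smul_comp, Linear.comp_smul]))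
    (fun x y y' => sec_injective (by
      simp only [sec_add, sec_tensorSec, MonoidalPreadditive.tensor_add, Preadditive.comp_add]))
    (fun a x y => sec_injective (by
      simp only [sec_smul, sec_tensorSec, MonoidalCategory.tensorHom_def,
        MonoidalLinear.whiskerLeft_smul, Linear.comp_smul]))
  naturality_left f Y x y := sec_injective (by
    change sec (tensorSec _ _) = sec ((elems _).map _ (tensorSec _ _))
    rw [sec_tensorSec, sec_map, sec_map, sec_tensorSec, ← δ_natural_left_assoc]
    simp [MonoidalCategory.tensorHom_def])
  naturality_right X _ _ g x y := sec_injective (by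
    change sec (tensorSec _ _) = sec ((elems _).map _ (tensorSec _ _))
    rw [sec_tensorSec, sec_map, sec_map, sec_tensorSec, ← δ_natural_right_assoc]
    simp [MonoidalCategory.tensorHom_def'])

theorem tensorBimor_app {X Y : T} (x : El M.obj X) (y : El N.obj Y) :
    (tensorBimor M N).app X Y x y = tensorSec x y := rfl

theorem act_tensorHom {X Y : T} (f : M ⟶ M') (g : N ⟶ N') (x : El M.obj X) (y : El N.obj Y) :
    (act (f ⊗ₘ g)).app _ (tensorSec x y) = tensorSec ((act f).app X x) ((act g).app Y y) :=
  sec_injective (by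
    rw [sec_act, sec_tensorSec, sec_tensorSec, sec_act, sec_act, Category.assoc,
      tensorHom_comp_tensorHom])

theorem act_whiskerRight {X Y : T} (f : M ⟶ M') (x : El M.obj X) (y : El N.obj Y) :
    (act (f ▷ N)).app _ (tensorSec x y) = tensorSec ((act f).app X x) y := by
  rw [← tensorHom_id, act_tensorHom, act_id]

theorem act_whiskerLeft {X Y : T} (g : N ⟶ N') (x : El M.obj X) (y : El N.obj Y) :
    (act (M ◁ g)).app _ (tensorSec x y) = tensorSec x ((act g).app Y y) := by
  rw [← id_tensorHom, act_tensorHom, act_id]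

theorem act_associator {X Y Z : T} (x : El M.obj X) (y : El N.obj Y) (z : El P.obj Z) :
    (act (α_ M N P).hom).app _ (tensorSec (tensorSec x y) z) =
      (elems _).map (α_ X Y Z).hom (tensorSec x (tensorSec y z)) :=
  sec_injective (by
    rw [sec_act, sec_map, sec_tensorSec, sec_tensorSec, sec_tensorSec, sec_tensorSec]
    have h1 : (δ (tFunctor F F' T) X Y ≫ (sec x ⊗ₘ sec y)) ⊗ₘ sec z =
        δ (tFunctor F F' T) X Y ▷ _ ≫ ((sec x ⊗ₘ sec y) ⊗ₘ sec z) := by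
      rw [← tensorHom_id, tensorHom_comp_tensorHom, Category.id_comp]
    have h2 : sec x ⊗ₘ (δ (tFunctor F F' T) Y Z ≫ (sec y ⊗ₘ sec z)) =
        _ ◁ δ (tFunctor F F' T) Y Z ≫ (sec x ⊗ₘ (sec y ⊗ₘ sec z)) := by
      rw [← id_tensorHom, tensorHom_comp_tensorHom, Category.id_comp]
    rw [h1, h2, Category.assoc, Category.assoc, associator_naturality]
    simpa only [Category.assoc] using congrArg (· ≫ (sec x ⊗ₘ (sec y ⊗ₘ sec z)))
      (Functor.OplaxMonoidal.associativity (F := tFunctor F F' T) X Y Z))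

theorem act_braiding {X Y : T} (x : El M.obj X) (y : El N.obj Y) :
    (act (β_ M N).hom).app _ (tensorSec x y) =
      (elems _).map (β_ X Y).hom (tensorSec y x) :=
  sec_injective (by
    rw [sec_act, sec_map, sec_tensorSec, sec_tensorSec, Category.assoc,
      BraidedCategory.braiding_naturality, ← Category.assoc, ← Category.assoc]
    congr 1
    rw [← cancel_mono (μ (tFunctor F F' T) Y X), Category.assoc, ← Functor.LaxBraided.braided,
      Category.assoc, Functor.Monoidal.δ_μ_assoc, Functor.Monoidal.δ_μ, Category.comp_id])

variable (F F' T) in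
/-- The tautological section of the unit. -/
def oneSec : El (𝟙_ (ScalarExt F F' T)).obj (𝟙_ T) :=
  (act (η (tFunctor F F' T))).app _ (tUnit (𝟙_ T))

theorem sec_oneSec : sec (oneSec F F' T) = η (tFunctor F F' T) := sec_act_tUnit _

theorem act_leftUnitor {Y : T} (y : El N.obj Y) :
    (act (λ_ N).hom).app _ (tensorSec (oneSec F F' T) y) = (elems _).map (λ_ Y).hom y :=
  sec_injective (by
    rw [sec_act, sec_map, sec_tensorSec, sec_oneSec, MonoidalCategory.tensorHom_def, Category.assoc,
      Category.assoc, leftUnitor_naturality, ← Functor.OplaxMonoidal.left_unitality_hom_assoc])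

theorem act_rightUnitor {Y : T} (y : El N.obj Y) :
    (act (ρ_ N).hom).app _ (tensorSec y (oneSec F F' T)) = (elems _).map (ρ_ Y).hom y :=
  sec_injective (by
    rw [sec_act, sec_map, sec_tensorSec, sec_oneSec, MonoidalCategory.tensorHom_def', Category.assoc,
      Category.assoc, rightUnitor_naturality, ← Functor.OplaxMonoidal.right_unitality_hom_assoc])

theorem tensorSec_tUnit (X Y : T) :
    tensorSec (tUnit (F := F) (F' := F') X) (tUnit Y) =
      (act (δ (tFunctor F F' T) X Y)).app _ (tUnit (X ⊗ Y)) :=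
  sec_injective (by
    have h (Z : T) : sec (tUnit (F := F) (F' := F') Z) = 𝟙 _ :=
      tFunctor_hom_ext (by rw [act_sec_tUnit, act_id])
    rw [sec_tensorSec, sec_act, h, h, h, id_tensorHom_id, Category.comp_id, Category.id_comp])

/-- The tensor constraint of `t` identifies the product with `t(X ⊗ Y)` and the pure tensor of the
tautological sections with the tautological section. -/
theorem tensorBimor_isUniversal_t (X Y : T) :
    (tensorBimor ((tFunctor F F' T).obj X) ((tFunctor F F' T).obj Y)).IsUniversal := by
  have h : ((tensorBimor _ _).comp (act (μ (tFunctor F F' T) X Y))).IsUniversal :=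
    isUniversal_of_gen _ (by
      change (act _).app _ (tensorSec (tUnit X) (tUnit Y)) = tUnit (X ⊗ Y)
      rw [tensorSec_tUnit, ← act_comp, Functor.Monoidal.δ_μ, act_id])
  have h' := h.comp_iso (act (δ (tFunctor F F' T) X Y)) (act (μ (tFunctor F F' T) X Y))
    (fun Z z => by rw [← act_comp, Functor.Monoidal.δ_μ, act_id])
    (fun Z z => by rw [← act_comp, Functor.Monoidal.μ_δ, act_id])
  have heq : ((tensorBimor _ _).comp (act (μ (tFunctor F F' T) X Y))).comp
      (act (δ (tFunctor F F' T) X Y)) = tensorBimor _ _ := Bimor.ext_apply fun Z W z w => by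
    rw [Bimor.comp_app, Bimor.comp_app, ← act_comp, Functor.Monoidal.μ_δ, act_id]
  exact heq ▸ h'

/-- The given tensor product is right exact, so a presentation of `M` stays right exact after
tensoring, and universality passes to cokernels. -/
theorem tensorBimor_isUniversal_of_t (N : ScalarExt F F' T)
    (h : ∀ X, (tensorBimor ((tFunctor F F' T).obj X) N).IsUniversal) (M : ScalarExt F F' T) :
    (tensorBimor M N).IsUniversal := by
  obtain ⟨X₁, X₀, φ, p, w, ⟨hp⟩⟩ := exists_presentation_scalarExt M
  have := RightExactTensor.tensorRight N
  have hc := isColimitCoforkMapOfIsColimit' (tensorRight N) w hp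
  exact (rightExact_act φ p w hp).isUniversal (rightExact_act _ _ _ hc) (h X₁) (h X₀) _
    (fun X Y x y => act_whiskerRight φ x y) (fun X Y x y => act_whiskerRight p x y)

/-- Presentations are used in each variable, with the symmetry exchanging them. As a result,
morphisms out of `M ⊗ N` may be defined and compared on pure tensors, whichever structure was given.
-/
theorem tensorBimor_isUniversal (M N : ScalarExt F F' T) : (tensorBimor M N).IsUniversal := by
  refine tensorBimor_isUniversal_of_t N (fun X => ?_) M
  have h := (tensorBimor_isUniversal_of_t ((tFunctor F F' T).obj X)
    (fun Y => tensorBimor_isUniversal_t Y X) N).swap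
  have h' := h.comp_iso (act (β_ N ((tFunctor F F' T).obj X)).hom)
    (act (β_ N ((tFunctor F F' T).obj X)).inv)
    (fun Z z => by rw [← act_comp, Iso.hom_inv_id, act_id])
    (fun Z z => by rw [← act_comp, Iso.inv_hom_id, act_id])
  have heq : (tensorBimor N ((tFunctor F F' T).obj X)).swap.comp
      (act (β_ N ((tFunctor F F' T).obj X)).hom) = tensorBimor _ N :=
    Bimor.ext_apply fun Z W z w => by
      rw [Bimor.comp_app, Bimor.swap_app, Hom.naturality, tensorBimor_app, tensorBimor_app,
        act_braiding, ← LexPresheaf.map_comp, SymmetricCategory.symmetry, LexPresheaf.map_id]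
  exact heq ▸ h'

theorem tensor_lex_ext {H : LexPresheaf F F' T} {α α' : (elems (M ⊗ N).obj).Hom H}
    (h : ∀ X Y (x : El M.obj X) (y : El N.obj Y),
      α.app _ (tensorSec x y) = α'.app _ (tensorSec x y)) : α = α' :=
  (tensorBimor_isUniversal M N).hom_ext h

end PureTensor

end ScalarExtension

end

/-! ### Extension of a fibre functor to `ScalarExt`: construction and right exactness. -/

noncomputable section
namespace ScalarExtension

open MonoidalCategory

set_option linter.unusedSectionVars false

attribute [local instance] indPreadditive indLinear LexPresheaf.baseModule

section Closed

variable {K : Type v} [CommRing K] {A B V : ModuleCat.{v} K}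

theorem curry_add (f g : A ⊗ B ⟶ V) :
    MonoidalClosed.curry (f + g) = MonoidalClosed.curry f + MonoidalClosed.curry g := rfl

theorem curry_smul (a : K) (f : A ⊗ B ⟶ V) :
    MonoidalClosed.curry (a • f) = a • MonoidalClosed.curry f := rfl

end Closed

attribute [local instance] FibreFunctor.braided FibreFunctor.faithful FibreFunctor.additive
  FibreFunctor.leftExact FibreFunctor.rightExact FibreFunctor.finite

variable {F F' : Type v} [Field F] [Field F'] [Algebra F F']
variable {T : Type u} [Category.{v} T] [Abelian T] [Linear F T]
variable [MonoidalCategory T] [SymmetricCategory T] [HasDualObjects T] [MonoidalPreadditive T]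
  [MonoidalLinear F T]
variable {K : Type v} [Field K] [Algebra F K] [Algebra F' K] [IsScalarTower F F' K]
  (ω : FibreFunctor F T K)

section DualPresheaf

variable (F') in
/-- The presheaf `X ↦ Hom(ω(X), V)`. -/
def dualPresheaf (V : ModuleCat.{v} K) : LexPresheaf F F' T where
  obj X := ω.functor.obj X ⟶ V
  module _ := Module.compHom _ (algebraMap F' K)
  map f :=
    letI (X : T) : Module F' (ω.functor.obj X ⟶ V) := Module.compHom _ (algebraMap F' K)
    { toFun x := ω.functor.map f ≫ x
      map_add' x y := Preadditive.comp_add _ _ _ _ _ _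
      map_smul' a x := Linear.comp_smul _ _ _ (ω.functor.map f) (algebraMap F' K a) x }
  map_id x := by
    change ω.functor.map _ ≫ x = x
    rw [ω.functor.map_id, Category.id_comp]
  map_comp f g x := by
    change ω.functor.map _ ≫ x = ω.functor.map _ ≫ ω.functor.map _ ≫ x
    rw [ω.functor.map_comp, Category.assoc]
  map_add f g x := by
    change ω.functor.map _ ≫ x = ω.functor.map _ ≫ x + ω.functor.map _ ≫ x
    rw [ω.functor.map_add, Preadditive.add_comp]
  map_smul a f x := by
    change ω.functor.map _ ≫ x = algebraMap F' K (algebraMap F F' a) • (ω.functor.map _ ≫ x)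
    rw [ω.map_smul, Linear.smul_comp, ← IsScalarTower.algebraMap_apply]
  sep e _ y h := by
    change ω.functor.map e ≫ y = 0 at h
    exact (cancel_epi (ω.functor.map e)).1 (h.trans comp_zero.symm)
  glue {X Y} e _ x h := by
    have hc := isColimitCoforkMapOfIsColimit' ω.functor (kernel.condition e)
      (Abelian.epiIsCokernelOfKernel _ (limit.isLimit (parallelPair e 0)))
    obtain ⟨y, hy⟩ := CokernelCofork.IsColimit.desc' hc x (h _ (kernel.ι e) (kernel.condition e))
    exact ⟨y, hy⟩

variable {ω} {V W : ModuleCat.{v} K} {M N : LexPresheaf F F' T}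

/-- The values of a morphism to `X ↦ Hom(ω(X), V)`. -/
def evalAt (u : M.Hom (dualPresheaf F' ω V)) {X : T} (x : M.obj X) : ω.functor.obj X ⟶ V :=
  u.app X x

theorem evalAt_map (u : M.Hom (dualPresheaf F' ω V)) {X Y : T} (f : X ⟶ Y) (y : M.obj Y) :
    evalAt u (M.map f y) = ω.functor.map f ≫ evalAt u y := u.naturality f y

theorem evalAt_add (u : M.Hom (dualPresheaf F' ω V)) {X : T} (x y : M.obj X) :
    evalAt u (x + y) = evalAt u x + evalAt u y := (u.app X).map_add x y

theorem evalAt_zero (u : M.Hom (dualPresheaf F' ω V)) {X : T} :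
    evalAt u (0 : M.obj X) = 0 := (u.app X).map_zero

theorem evalAt_smul (u : M.Hom (dualPresheaf F' ω V)) {X : T} (a : F') (x : M.obj X) :
    evalAt u (a • x) = algebraMap F' K a • evalAt u x := (u.app X).map_smul a x

theorem hom_ext_evalAt {u u' : M.Hom (dualPresheaf F' ω V)}
    (h : ∀ (X : T) (x : M.obj X), evalAt u x = evalAt u' x) : u = u' :=
  LexPresheaf.Hom.ext_apply h

/-- Construction of a morphism to `X ↦ Hom(ω(X), V)`. -/
def mkDual (θ : ∀ {X : T}, M.obj X → (ω.functor.obj X ⟶ V))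
    (add : ∀ {X : T} (x y : M.obj X), θ (x + y) = θ x + θ y)
    (smul : ∀ {X : T} (a : F') (x : M.obj X), θ (a • x) = algebraMap F' K a • θ x)
    (nat : ∀ {X Y : T} (f : X ⟶ Y) (y : M.obj Y), θ (M.map f y) = ω.functor.map f ≫ θ y) :
    M.Hom (dualPresheaf F' ω V) where
  app _ :=
    { toFun := θ
      map_add' := add
      map_smul' := smul }
  naturality := nat

/-- Composition with a morphism of vector spaces. -/
def postDual (u : M.Hom (dualPresheaf F' ω V)) (g : V ⟶ W) : M.Hom (dualPresheaf F' ω W) :=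
  mkDual (fun x => evalAt u x ≫ g)
    (fun x y => by rw [evalAt_add, Preadditive.add_comp])
    (fun a x => by rw [evalAt_smul, Linear.smul_comp])
    (fun f y => by rw [evalAt_map, Category.assoc])

theorem evalAt_comp (α : N.Hom M) (u : M.Hom (dualPresheaf F' ω V)) {X : T} (x : N.obj X) :
    evalAt (α.comp u) x = evalAt u (α.app X x) := rfl

/-- `V`, with `u`, represents the morphisms from `M` to the presheaves `X ↦ Hom(ω(X), W)`. -/
def IsRep (u : M.Hom (dualPresheaf F' ω V)) : Prop :=
  ∀ (W : ModuleCat.{v} K) (γ : M.Hom (dualPresheaf F' ω W)),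
    ∃! g : V ⟶ W, ∀ (X : T) (x : M.obj X), evalAt u x ≫ g = evalAt γ x

theorem IsRep.hom_ext {u : M.Hom (dualPresheaf F' ω V)} (hu : IsRep u) {f g : V ⟶ W}
    (h : ∀ (X : T) (x : M.obj X), evalAt u x ≫ f = evalAt u x ≫ g) : f = g :=
  (hu W (postDual u g)).unique h (fun _ _ => rfl)

/-- Morphisms from `t(X)` to `Hom(ω(-), W)` are elements of `Hom(ω(X), W)`, so `ω(X)` represents
them. -/
theorem isRep_t (X : T) :
    IsRep (ω := ω) (tDesc (H := dualPresheaf F' ω (ω.functor.obj X)) (X := X)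
      (𝟙 (ω.functor.obj X))) := by
  intro W γ
  let u : (elems (tObj F F' X)).Hom (dualPresheaf F' ω (ω.functor.obj X)) :=
    tDesc (X := X) (𝟙 (ω.functor.obj X))
  have hu : evalAt u (gen F F' X) = 𝟙 _ := tDesc_gen (H := dualPresheaf F' ω _) _
  refine ⟨evalAt γ (gen F F' X), ?_, fun g hg => ?_⟩
  · have : postDual u (evalAt γ (gen F F' X)) = γ := t_hom_ext (by
      change evalAt u _ ≫ _ = evalAt γ _
      rw [hu, Category.id_comp])
    intro Y y
    exact congrArg (fun κ => evalAt κ y) this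
  · have := hg X (gen F F' X)
    change evalAt u _ ≫ _ = _ at this
    rwa [hu, Category.id_comp] at this

/-- A morphism from `M` is a morphism from `M₀` that kills `M₁`, so the cokernel of the induced map
of representing spaces represents it. -/
theorem exists_isRep_of_rightExact {M₁ M₀ M : LexPresheaf F F' T} {φ : M₁.Hom M₀} {p : M₀.Hom M}
    (h : LexPresheaf.RightExact φ p) {V₁ V₀ : ModuleCat.{v} K}
    {u₁ : M₁.Hom (dualPresheaf F' ω V₁)} {u₀ : M₀.Hom (dualPresheaf F' ω V₀)}
    (h₁ : IsRep u₁) (h₀ : IsRep u₀) :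
    ∃ (V : ModuleCat.{v} K) (u : M.Hom (dualPresheaf F' ω V)), IsRep u := by
  obtain ⟨ψ, hψ, -⟩ := h₁ V₀ (φ.comp u₀)
  obtain ⟨u, hu⟩ := LexPresheaf.exists_desc h.locSurj (postDual u₀ (cokernel.π ψ))
    (fun X x hx => h.eq_zero _ (fun X x => by
      change evalAt u₀ _ ≫ _ = 0
      rw [← evalAt_comp, ← hψ, Category.assoc, cokernel.condition, comp_zero]) x hx)
  have hup : ∀ (X : T) (x : M₀.obj X), evalAt u (p.app X x) = evalAt u₀ x ≫ cokernel.π ψ :=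
    fun X x => congrArg (fun κ => evalAt κ x) hu
  refine ⟨cokernel ψ, u, fun W γ => ?_⟩
  obtain ⟨g₀, hg₀, -⟩ := h₀ W (p.comp γ)
  have hz : ψ ≫ g₀ = 0 := h₁.hom_ext fun X x => by
    rw [← Category.assoc, hψ, evalAt_comp, hg₀, evalAt_comp, h.zero, evalAt_zero, comp_zero]
  refine ⟨cokernel.desc ψ g₀ hz, fun X x => ?_, fun g hg => ?_⟩
  · have : postDual u (cokernel.desc ψ g₀ hz) = γ :=
      LexPresheaf.Hom.eq_of_locSurj h.locSurj (hom_ext_evalAt fun X x => by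
        rw [evalAt_comp, evalAt_comp]
        change evalAt u _ ≫ _ = _
        rw [hup, Category.assoc, cokernel.π_desc, hg₀, evalAt_comp])
    exact congrArg (fun κ => evalAt κ x) this
  · rw [← cancel_epi (cokernel.π ψ), cokernel.π_desc]
    refine h₀.hom_ext fun X x => ?_
    rw [← Category.assoc, ← hup, hg, hg₀, evalAt_comp]

theorem exists_isRep [IsFiniteScalarExt F F' T] (ω : FibreFunctor F T K) (M : ScalarExt F F' T) :
    ∃ (V : ModuleCat.{v} K) (u : (elems M.obj).Hom (dualPresheaf F' ω V)), IsRep u := by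
  obtain ⟨X₁, X₀, φ, p, w, ⟨hp⟩⟩ := exists_presentation_scalarExt M
  exact exists_isRep_of_rightExact (rightExact_act φ p w hp) (isRep_t X₁) (isRep_t X₀)

end DualPresheaf

section Fibre

variable [IsFiniteScalarExt F F' T]

/-- The value at `M` of the extension of `ω` to the scalar extension. -/
def fibreObj (M : ScalarExt F F' T) : ModuleCat.{v} K := (exists_isRep ω M).choose

/-- The universal morphism from `M`. -/
def fibreUniv (M : ScalarExt F F' T) : (elems M.obj).Hom (dualPresheaf F' ω (fibreObj ω M)) :=
  (exists_isRep ω M).choose_spec.choose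

theorem fibreUniv_isRep (M : ScalarExt F F' T) : IsRep (fibreUniv ω M) :=
  (exists_isRep ω M).choose_spec.choose_spec

variable {M N P : ScalarExt F F' T} {V W : ModuleCat.{v} K}

variable (F') in
/-- The extension of `ω` to the scalar extension. -/
def fibre : ScalarExt F F' T ⥤ ModuleCat.{v} K where
  obj := fibreObj ω
  map {M N} f := (fibreUniv_isRep ω M _ ((act f).comp (fibreUniv ω N))).choose
  map_id M := (fibreUniv_isRep ω M).hom_ext fun X x => by
    rw [(fibreUniv_isRep ω M _ _).choose_spec.1, evalAt_comp, act_id, Category.comp_id]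
  map_comp {M N P} f g := (fibreUniv_isRep ω M).hom_ext fun X x => by
    rw [(fibreUniv_isRep ω M _ _).choose_spec.1, ← Category.assoc,
      (fibreUniv_isRep ω M _ _).choose_spec.1, evalAt_comp, evalAt_comp,
      (fibreUniv_isRep ω N _ _).choose_spec.1, act_comp, evalAt_comp]

/-- The morphism `ω(X) ⟶ Ω(M)` defined by a section of `M`. -/
def brk {X : T} (x : El M.obj X) : ω.functor.obj X ⟶ (fibre F' ω).obj M :=
  evalAt (fibreUniv ω M) x

theorem brk_map {X Y : T} (f : X ⟶ Y) (y : El M.obj Y) :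
    brk ω ((elems M.obj).map f y) = ω.functor.map f ≫ brk ω y := evalAt_map _ _ _

theorem brk_add {X : T} (x y : El M.obj X) : brk ω (x + y) = brk ω x + brk ω y :=
  evalAt_add _ _ _

theorem brk_smul {X : T} (a : F') (x : El M.obj X) :
    brk ω (a • x) = algebraMap F' K a • brk ω x := evalAt_smul _ _ _

theorem fibre_hom_ext {f g : (fibre F' ω).obj M ⟶ V}
    (h : ∀ (X : T) (x : El M.obj X), brk ω x ≫ f = brk ω x ≫ g) : f = g :=
  (fibreUniv_isRep ω M).hom_ext h

variable {ω} in
/-- The morphism from `Ω(M)` defined by a morphism to `X ↦ Hom(ω(X), V)`. -/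
def fibreDesc (γ : (elems M.obj).Hom (dualPresheaf F' ω V)) : (fibre F' ω).obj M ⟶ V :=
  (fibreUniv_isRep ω M V γ).choose

@[simp]
theorem brk_fibreDesc (γ : (elems M.obj).Hom (dualPresheaf F' ω V)) {X : T} (x : El M.obj X) :
    brk ω x ≫ fibreDesc γ = evalAt γ x := (fibreUniv_isRep ω M V γ).choose_spec.1 X x

theorem brk_fibre_map (f : M ⟶ N) {X : T} (x : El M.obj X) :
    brk ω x ≫ (fibre F' ω).map f = brk ω ((act f).app X x) :=
  (fibreUniv_isRep ω M _ ((act f).comp (fibreUniv ω N))).choose_spec.1 X x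

theorem brk_fibre_map_assoc (f : M ⟶ N) {X : T} (x : El M.obj X) (g : (fibre F' ω).obj N ⟶ V) :
    brk ω x ≫ (fibre F' ω).map f ≫ g = brk ω ((act f).app X x) ≫ g := by
  rw [← Category.assoc, brk_fibre_map]

instance fibre_additive : (fibre F' ω).Additive where
  map_add {M N f g} := fibre_hom_ext ω fun X x => by
    rw [brk_fibre_map, Preadditive.comp_add, brk_fibre_map, brk_fibre_map, act_add, brk_add]

theorem fibre_map_smul (a : F') (f : M ⟶ N) :
    (fibre F' ω).map (a • f) = algebraMap F' K a • (fibre F' ω).map f :=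
  fibre_hom_ext ω fun X x => by
    rw [brk_fibre_map, Linear.comp_smul, brk_fibre_map, act_smul, brk_smul]

/-- A linear map out of the value at `M₀` that kills the image of `M₁` corresponds to a morphism of
presheaves from `M₀` that kills `M₁`, and this descends to the cokernel. -/
theorem fibre_preservesFiniteColimits : PreservesFiniteColimits (fibre F' ω) := by
  have key : ∀ {M₁ M₀ : ScalarExt F F' T} (φ : M₁ ⟶ M₀),
      PreservesColimit (parallelPair φ 0) (fibre F' ω) := by
    intro M₁ M₀ φ
    have h := rightExact_act φ (cokernel.π φ) (cokernel.condition φ) (cokernelIsCokernel φ)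
    refine preservesColimit_of_preserves_colimit_cocone (cokernelIsCokernel φ) ?_
    refine (CokernelCofork.isColimitMapCoconeEquiv _ _).symm ?_
    have hepi : Epi ((fibre F' ω).map (cokernel.π φ)) := ⟨fun {Q} f g hfg => by
      have h' : ∀ (X : T) (x : El M₀.obj X), brk ω ((act (cokernel.π φ)).app X x) ≫ f =
          brk ω ((act (cokernel.π φ)).app X x) ≫ g := fun X x => by
        rw [← brk_fibre_map_assoc, ← brk_fibre_map_assoc, hfg]
      refine fibre_hom_ext ω fun X x => ?_
      obtain ⟨Z, e, _, x', hx'⟩ := h.locSurj X x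
      rw [← cancel_epi (ω.functor.map e), ← Category.assoc, ← Category.assoc, ← brk_map, ← hx', h']⟩
    refine CokernelCofork.IsColimit.ofπ' _ (((fibre F' ω).map_comp _ _).symm.trans
      ((congrArg _ (cokernel.condition φ)).trans (Functor.map_zero _ _ _))) fun {Q} g hg => ?_
    refine Nonempty.some ?_
    obtain ⟨γ, hγ⟩ := LexPresheaf.exists_desc h.locSurj (postDual (fibreUniv ω M₀) g)
      fun X x hx => h.eq_zero _ (fun X x => by
        change brk ω _ ≫ g = 0
        rw [← brk_fibre_map_assoc, hg, comp_zero]) x hx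
    refine ⟨fibreDesc γ, fibre_hom_ext ω fun X x => ?_⟩
    rw [brk_fibre_map_assoc, brk_fibreDesc]
    exact congrArg (fun κ => evalAt κ x) hγ
  exact Functor.preservesFiniteColimits_of_preservesCokernels _

/-- `t(X)` is generated by its tautological section, so `ω(X)` maps onto the value at `t(X)`. This
bounds all values of the extension by those of `ω`. -/
theorem epi_brk_tUnit (X : T) : Epi (brk ω (tUnit (F := F) (F' := F') X)) :=
  ⟨fun f g hfg => fibre_hom_ext ω fun Y y => by
    have : postDual (fibreUniv ω ((tFunctor F F' T).obj X)) f = postDual (fibreUniv ω _) g :=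
      tFunctor_lex_ext hfg
    exact congrArg (fun κ => evalAt κ y) this⟩

instance fibre_finite (M : ScalarExt F F' T) : Module.Finite K ((fibre F' ω).obj M) := by
  have := fibre_preservesFiniteColimits (F' := F') ω
  obtain ⟨X, p, _⟩ := exists_epi_tFunctor M
  have := epi_brk_tUnit (F' := F') ω X
  have h : Epi (brk ω (tUnit (F := F) (F' := F') X) ≫ (fibre F' ω).map p) := epi_comp _ _
  exact Module.Finite.of_surjective (ModuleCat.Hom.hom _) ((ModuleCat.epi_iff_surjective _).1 h)

end Fibre

end ScalarExtension

end

/-! ### The tensor structure of the extended fibre functor. -/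

noncomputable section
namespace ScalarExtension

open MonoidalCategory

set_option linter.unusedSectionVars false

attribute [local instance] indPreadditive indLinear LexPresheaf.baseModule

section JointlyEpi

variable {C : Type*} [Category* C]

/-- A family of morphisms with a common target is jointly epic. -/
def JointlyEpi {ι : Type*} {S : ι → C} {A : C} (e : ∀ i, S i ⟶ A) : Prop :=
  ∀ ⦃V : C⦄ ⦃f g : A ⟶ V⦄, (∀ i, e i ≫ f = e i ≫ g) → f = g

theorem jointlyEpi_of_epi {S A : C} (e : S ⟶ A) [Epi e] :
    JointlyEpi (fun _ : Unit => e) := fun _ _ _ h => (cancel_epi e).1 (h ())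

variable [MonoidalCategory C] [SymmetricCategory C] [MonoidalClosed C]

/-- In a closed category tensoring is a left adjoint, and currying transfers the cancellation
property. -/
theorem JointlyEpi.whiskerLeft {ι : Type*} {S : ι → C} {A : C} {e : ∀ i, S i ⟶ A}
    (he : JointlyEpi e) (B : C) : JointlyEpi (fun i => B ◁ e i) := fun V f g h =>
  MonoidalClosed.curry_injective (he fun i => by
    rw [← MonoidalClosed.curry_natural_left, ← MonoidalClosed.curry_natural_left, h])

theorem JointlyEpi.whiskerRight {ι : Type*} {S : ι → C} {A : C} {e : ∀ i, S i ⟶ A}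
    (he : JointlyEpi e) (B : C) : JointlyEpi (fun i => e i ▷ B) := fun V f g h => by
  rw [← cancel_epi (β_ B A).hom]
  refine he.whiskerLeft B fun i => ?_
  rw [BraidedCategory.braiding_naturality_right_assoc,
    BraidedCategory.braiding_naturality_right_assoc, h]

theorem JointlyEpi.tensor {ι κ : Type*} {S : ι → C} {A : C} {e : ∀ i, S i ⟶ A} {S' : κ → C} {B : C}
    {e' : ∀ i, S' i ⟶ B} (he : JointlyEpi e) (he' : JointlyEpi e') :
    JointlyEpi (fun i : ι × κ => e i.1 ⊗ₘ e' i.2) := fun V f g h =>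
  he.whiskerRight B fun i => he'.whiskerLeft (S i) fun j => by
    have : (e i ⊗ₘ e' j) ≫ f = (e i ⊗ₘ e' j) ≫ g := h (i, j)
    rwa [MonoidalCategory.tensorHom_def', Category.assoc, Category.assoc] at this

end JointlyEpi

attribute [local instance] FibreFunctor.braided FibreFunctor.faithful FibreFunctor.additive
  FibreFunctor.leftExact FibreFunctor.rightExact FibreFunctor.finite

variable {F F' : Type v} [Field F] [Field F'] [Algebra F F']
variable {T : Type u} [Category.{v} T] [Abelian T] [Linear F T]
variable [MonoidalCategory T] [SymmetricCategory T] [HasDualObjects T] [MonoidalPreadditive T]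
  [MonoidalLinear F T]
variable {K : Type v} [Field K] [Algebra F K] [Algebra F' K] [IsScalarTower F F' K]
  (ω : FibreFunctor F T K)
variable [IsFiniteScalarExt F F' T]

open Functor.LaxMonoidal Functor.OplaxMonoidal

variable {M N P M' N' : ScalarExt F F' T} {V W : ModuleCat.{v} K}

/-- The family of all morphisms `ω(X) ⟶ Ω(M)` defined by sections. -/
abbrev brkFamily (M : ScalarExt F F' T) (i : Σ X : T, El M.obj X) :
    ω.functor.obj i.1 ⟶ (fibre F' ω).obj M := brk ω i.2

theorem jointlyEpi_brk (M : ScalarExt F F' T) : JointlyEpi (brkFamily ω M) :=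
  fun _ _ _ h => fibre_hom_ext ω fun X x => h ⟨X, x⟩

/-- Currying turns the family into a morphism from `M` to the presheaf `Hom(ω(-), Hom(W, V))`, to
which the defining property of the extension applies. -/
theorem exists_whiskerLeft_desc (θ : ∀ {X : T}, El M.obj X → (W ⊗ ω.functor.obj X ⟶ V))
    (add : ∀ {X : T} (x y : El M.obj X), θ (x + y) = θ x + θ y)
    (smul : ∀ {X : T} (a : F') (x : El M.obj X), θ (a • x) = algebraMap F' K a • θ x)
    (nat : ∀ {X Y : T} (f : X ⟶ Y) (y : El M.obj Y),
      θ ((elems M.obj).map f y) = W ◁ ω.functor.map f ≫ θ y) :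
    ∃ b : W ⊗ (fibre F' ω).obj M ⟶ V, ∀ (X : T) (x : El M.obj X), W ◁ brk ω x ≫ b = θ x := by
  let γ : (elems M.obj).Hom (dualPresheaf F' ω ((ihom W).obj V)) :=
    mkDual (fun x => MonoidalClosed.curry (θ x)) (fun x y => by rw [add, curry_add])
      (fun a x => by rw [smul, curry_smul])
      (fun f y => by rw [nat, MonoidalClosed.curry_natural_left])
  refine ⟨MonoidalClosed.uncurry (fibreDesc γ), fun X x => ?_⟩
  rw [← MonoidalClosed.uncurry_natural_left, brk_fibreDesc]
  exact MonoidalClosed.uncurry_curry _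

theorem exists_whiskerRight_desc (θ : ∀ {X : T}, El M.obj X → (ω.functor.obj X ⊗ W ⟶ V))
    (add : ∀ {X : T} (x y : El M.obj X), θ (x + y) = θ x + θ y)
    (smul : ∀ {X : T} (a : F') (x : El M.obj X), θ (a • x) = algebraMap F' K a • θ x)
    (nat : ∀ {X Y : T} (f : X ⟶ Y) (y : El M.obj Y),
      θ ((elems M.obj).map f y) = ω.functor.map f ▷ W ≫ θ y) :
    ∃ b : (fibre F' ω).obj M ⊗ W ⟶ V, ∀ (X : T) (x : El M.obj X), brk ω x ▷ W ≫ b = θ x := by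
  obtain ⟨b, hb⟩ := exists_whiskerLeft_desc ω (W := W) (V := V)
    (fun {X} x => (β_ W (ω.functor.obj X)).hom ≫ θ x)
    (fun x y => by rw [add, Preadditive.comp_add]) (fun a x => by rw [smul, Linear.comp_smul])
    (fun f y => by rw [nat, BraidedCategory.braiding_naturality_right_assoc])
  refine ⟨(β_ _ _).inv ≫ b, fun X x => ?_⟩
  rw [← cancel_epi (β_ W (ω.functor.obj X)).hom, ← hb,
    ← BraidedCategory.braiding_naturality_right_assoc, Iso.hom_inv_id_assoc]

/-- A bimorphism to `X ↦ Hom(ω(X), V)` defines a morphism on the tensor product. -/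
theorem exists_tensor_desc (β : LexPresheaf.Bimor (elems M.obj) (elems N.obj) (dualPresheaf F' ω V)) :
    ∃ b : (fibre F' ω).obj M ⊗ (fibre F' ω).obj N ⟶ V, ∀ (X Y : T) (x : El M.obj X)
      (y : El N.obj Y), (brk ω x ⊗ₘ brk ω y) ≫ b =
        μ ω.functor X Y ≫ (show ω.functor.obj (X ⊗ Y) ⟶ V from β.app X Y x y) := by
  let θ {X Y : T} (x : El M.obj X) (y : El N.obj Y) : ω.functor.obj (X ⊗ Y) ⟶ V := β.app X Y x y
  have θ_add_left {X Y : T} (x x' : El M.obj X) (y : El N.obj Y) : θ (x + x') y = θ x y + θ x' y :=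
    LinearMap.map_add₂ (β.app X Y) x x' y
  have θ_add_right {X Y : T} (x : El M.obj X) (y y' : El N.obj Y) : θ x (y + y') = θ x y + θ x y' :=
    (β.app X Y x).map_add y y'
  have θ_smul_left {X Y : T} (a : F') (x : El M.obj X) (y : El N.obj Y) :
      θ (a • x) y = algebraMap F' K a • θ x y := LinearMap.map_smul₂ (β.app X Y) a x y
  have θ_smul_right {X Y : T} (a : F') (x : El M.obj X) (y : El N.obj Y) :
      θ x (a • y) = algebraMap F' K a • θ x y := (β.app X Y x).map_smul a y
  have θ_left {X X' Y : T} (f : X ⟶ X') (x : El M.obj X') (y : El N.obj Y) :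
      θ ((elems M.obj).map f x) y = ω.functor.map (f ▷ Y) ≫ θ x y := β.naturality_left f Y x y
  have θ_right {X Y Y' : T} (g : Y ⟶ Y') (x : El M.obj X) (y : El N.obj Y') :
      θ x ((elems N.obj).map g y) = ω.functor.map (X ◁ g) ≫ θ x y := β.naturality_right X g x y
  -- The two variables are treated in turn: first `y` is fixed and the section of `M` varies, then
  -- the resulting morphisms are assembled over the sections of `N`. Linearity and naturality in `y`
  -- are checked on the jointly epic family of `M`.
  have key {Y : T} (y : El N.obj Y) := exists_whiskerRight_desc ω (M := M)
    (W := ω.functor.obj Y) (V := V)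
    (fun {X} x => μ ω.functor X Y ≫ θ x y)
    (fun x x' => by rw [θ_add_left, Preadditive.comp_add])
    (fun a x => by rw [θ_smul_left, Linear.comp_smul])
    (fun f x => by rw [θ_left, μ_natural_left_assoc])
  choose b hb using @key
  have hext {Y : T} {f g : (fibre F' ω).obj M ⊗ ω.functor.obj Y ⟶ V}
      (h : ∀ (X : T) (x : El M.obj X), brk ω x ▷ _ ≫ f = brk ω x ▷ _ ≫ g) : f = g :=
    (jointlyEpi_brk ω M).whiskerRight _ fun i => h i.1 i.2
  obtain ⟨c, hc⟩ := exists_whiskerLeft_desc ω (M := N) (W := (fibre F' ω).obj M) (V := V)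
    (fun {Y} y => b y)
    (fun y y' => hext fun X x => by
      rw [Preadditive.comp_add, hb, hb, hb, θ_add_right, Preadditive.comp_add])
    (fun a y => hext fun X x => by
      rw [Linear.comp_smul, hb, hb, θ_smul_right, Linear.comp_smul])
    (fun g y => hext fun X x => by
      rw [← whisker_exchange_assoc, hb, hb, θ_right, μ_natural_right_assoc])
  refine ⟨c, fun X Y x y => ?_⟩
  rw [MonoidalCategory.tensorHom_def, Category.assoc, hc, hb]

variable [MonoidalCategory (ScalarExt F F' T)] [SymmetricCategory (ScalarExt F F' T)]
  [MonoidalPreadditive (ScalarExt F F' T)] [MonoidalLinear F' (ScalarExt F F' T)]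
  [RightExactTensor (ScalarExt F F' T)] [(tFunctor F F' T).Braided]

theorem tensor_fibre_hom_ext {f g : (fibre F' ω).obj M ⊗ (fibre F' ω).obj N ⟶ V}
    (h : ∀ (X Y : T) (x : El M.obj X) (y : El N.obj Y),
      (brk ω x ⊗ₘ brk ω y) ≫ f = (brk ω x ⊗ₘ brk ω y) ≫ g) : f = g :=
  (jointlyEpi_brk ω M).tensor (jointlyEpi_brk ω N) fun i => h _ _ i.1.2 i.2.2

theorem tensor_fibre_hom_ext₃
    {f g : ((fibre F' ω).obj M ⊗ (fibre F' ω).obj N) ⊗ (fibre F' ω).obj P ⟶ V}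
    (h : ∀ (X Y Z : T) (x : El M.obj X) (y : El N.obj Y) (z : El P.obj Z),
      ((brk ω x ⊗ₘ brk ω y) ⊗ₘ brk ω z) ≫ f = ((brk ω x ⊗ₘ brk ω y) ⊗ₘ brk ω z) ≫ g) : f = g :=
  ((jointlyEpi_brk ω M).tensor (jointlyEpi_brk ω N)).tensor (jointlyEpi_brk ω P) fun i =>
    h _ _ _ i.1.1.2 i.1.2.2 i.2.2

/-- Maps out of the value at `M ⊗ N` correspond to morphisms of presheaves from `M ⊗ N`, and these
are determined on pure tensors. -/
theorem fibre_tensor_hom_ext {f g : (fibre F' ω).obj (M ⊗ N) ⟶ V}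
    (h : ∀ (X Y : T) (x : El M.obj X) (y : El N.obj Y),
      brk ω (tensorSec x y) ≫ f = brk ω (tensorSec x y) ≫ g) : f = g :=
  fibre_hom_ext ω fun Z z => by
    have : postDual (fibreUniv ω (M ⊗ N)) f = postDual (fibreUniv ω (M ⊗ N)) g :=
      tensor_lex_ext h
    exact congrArg (fun κ => evalAt κ z) this

variable (M N) in
theorem exists_fibreMu : ∃ b : (fibre F' ω).obj M ⊗ (fibre F' ω).obj N ⟶ (fibre F' ω).obj (M ⊗ N),
    ∀ (X Y : T) (x : El M.obj X) (y : El N.obj Y),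
      (brk ω x ⊗ₘ brk ω y) ≫ b = μ ω.functor X Y ≫ brk ω (tensorSec x y) :=
  exists_tensor_desc ω ((tensorBimor M N).comp (fibreUniv ω (M ⊗ N)))

variable (M N) in
/-- The bimorphism which defines the inverse of the tensor constraint. -/
def fibreBimor : LexPresheaf.Bimor (elems M.obj) (elems N.obj)
    (dualPresheaf F' ω ((fibre F' ω).obj M ⊗ (fibre F' ω).obj N)) where
  app X Y := LinearMap.mk₂ F'
    (fun x y => (δ ω.functor X Y ≫ (brk ω x ⊗ₘ brk ω y) :
      ω.functor.obj (X ⊗ Y) ⟶ (fibre F' ω).obj M ⊗ (fibre F' ω).obj N))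
    (fun x x' y => by
      rw [brk_add, MonoidalPreadditive.add_tensor, Preadditive.comp_add]
      rfl)
    (fun a x y => by
      rw [brk_smul, MonoidalCategory.tensorHom_def, MonoidalLinear.smul_whiskerRight,
        Linear.smul_comp, Linear.comp_smul, ← MonoidalCategory.tensorHom_def]
      rfl)
    (fun x y y' => by
      rw [brk_add, MonoidalPreadditive.tensor_add, Preadditive.comp_add]
      rfl)
    (fun a x y => by
      rw [brk_smul, MonoidalCategory.tensorHom_def, MonoidalLinear.whiskerLeft_smul,
        Linear.comp_smul, Linear.comp_smul, ← MonoidalCategory.tensorHom_def]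
      rfl)
  naturality_left f Y x y := by
    change δ _ _ _ ≫ (brk ω _ ⊗ₘ brk ω _) = ω.functor.map _ ≫ δ _ _ _ ≫ (brk ω _ ⊗ₘ brk ω _)
    rw [brk_map, ← δ_natural_left_assoc]
    simp [MonoidalCategory.tensorHom_def]
  naturality_right X _ _ g x y := by
    change δ _ _ _ ≫ (brk ω _ ⊗ₘ brk ω _) = ω.functor.map _ ≫ δ _ _ _ ≫ (brk ω _ ⊗ₘ brk ω _)
    rw [brk_map, ← δ_natural_right_assoc]
    simp [MonoidalCategory.tensorHom_def']

variable (M N) in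
-- Universality of the pure tensor bimorphism gives the inverse of the constraint, while
-- `exists_fibreMu` only needs that pure tensors are bilinear and natural.
theorem exists_fibreDelta :
    ∃ b : (fibre F' ω).obj (M ⊗ N) ⟶ (fibre F' ω).obj M ⊗ (fibre F' ω).obj N,
      ∀ (X Y : T) (x : El M.obj X) (y : El N.obj Y),
        brk ω (tensorSec x y) ≫ b = δ ω.functor X Y ≫ (brk ω x ⊗ₘ brk ω y) :=
  ⟨fibreDesc ((tensorBimor_isUniversal M N).desc (fibreBimor ω M N)), fun X Y x y => by
    rw [brk_fibreDesc]
    exact (tensorBimor_isUniversal M N).desc_app (fibreBimor ω M N) x y⟩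

variable (M N) in
/-- The tensor constraint of the extended fibre functor. -/
def fibreMu : (fibre F' ω).obj M ⊗ (fibre F' ω).obj N ≅ (fibre F' ω).obj (M ⊗ N) where
  hom := (exists_fibreMu ω M N).choose
  inv := (exists_fibreDelta ω M N).choose
  hom_inv_id := tensor_fibre_hom_ext ω fun X Y x y => by
    rw [← Category.assoc, (exists_fibreMu ω M N).choose_spec, Category.assoc,
      (exists_fibreDelta ω M N).choose_spec, Functor.Monoidal.μ_δ_assoc, Category.comp_id]
  inv_hom_id := fibre_tensor_hom_ext ω fun X Y x y => by
    rw [← Category.assoc, (exists_fibreDelta ω M N).choose_spec, Category.assoc,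
      (exists_fibreMu ω M N).choose_spec, Functor.Monoidal.δ_μ_assoc, Category.comp_id]

theorem tensor_brk_fibreMu {X Y : T} (x : El M.obj X) (y : El N.obj Y) :
    (brk ω x ⊗ₘ brk ω y) ≫ (fibreMu ω M N).hom = μ ω.functor X Y ≫ brk ω (tensorSec x y) :=
  (exists_fibreMu ω M N).choose_spec X Y x y

theorem tensor_brk_fibreMu_assoc {X Y : T} (x : El M.obj X) (y : El N.obj Y)
    (f : (fibre F' ω).obj (M ⊗ N) ⟶ V) :
    (brk ω x ⊗ₘ brk ω y) ≫ (fibreMu ω M N).hom ≫ f =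
      μ ω.functor X Y ≫ brk ω (tensorSec x y) ≫ f := by
  rw [← Category.assoc, tensor_brk_fibreMu, Category.assoc]

theorem fibre_unit_hom_ext {f g : (fibre F' ω).obj (𝟙_ (ScalarExt F F' T)) ⟶ V}
    (h : brk ω (oneSec F F' T) ≫ f = brk ω (oneSec F F' T) ≫ g) : f = g := by
  rw [← cancel_epi ((fibre F' ω).map (tUnitIso F F' T).inv)]
  have := epi_brk_tUnit (F' := F') ω (𝟙_ T)
  rw [← cancel_epi (brk ω (tUnit (F := F) (F' := F') (𝟙_ T))), brk_fibre_map_assoc,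
    brk_fibre_map_assoc]
  exact h

variable (F F' T) in
/-- The morphism from `t(𝟙)` which defines the inverse of the unit constraint. -/
def fibreUnitInv : (fibre F' ω).obj ((tFunctor F F' T).obj (𝟙_ T)) ⟶ 𝟙_ (ModuleCat.{v} K) :=
  fibreDesc (M := (tFunctor F F' T).obj (𝟙_ T))
    (tDesc (H := dualPresheaf F' ω (𝟙_ (ModuleCat.{v} K))) (X := 𝟙_ T) (η ω.functor))

theorem brk_fibreUnitInv :
    brk ω (tUnit (F := F) (F' := F') (𝟙_ T)) ≫ fibreUnitInv F F' T ω = η ω.functor :=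
  (brk_fibreDesc ω _ _).trans (tDesc_gen (H := dualPresheaf F' ω _) _)

theorem act_tUnitIso_hom_oneSec :
    (act (tUnitIso F F' T).hom).app (𝟙_ T) (oneSec F F' T) = tUnit (𝟙_ T) := by
  change (act (tUnitIso F F' T).hom).app (𝟙_ T) ((act (tUnitIso F F' T).inv).app (𝟙_ T) _) = _
  rw [← act_comp, Iso.inv_hom_id, act_id]

/-- The unit constraint of the extended fibre functor. -/
def fibreUnit : 𝟙_ (ModuleCat.{v} K) ≅ (fibre F' ω).obj (𝟙_ (ScalarExt F F' T)) where
  hom := ε ω.functor ≫ brk ω (oneSec F F' T)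
  inv := (fibre F' ω).map (tUnitIso F F' T).hom ≫ fibreUnitInv F F' T ω
  hom_inv_id := by
    rw [Category.assoc, brk_fibre_map_assoc, act_tUnitIso_hom_oneSec]
    exact (congrArg _ (brk_fibreUnitInv ω)).trans (Functor.Monoidal.ε_η _)
  inv_hom_id := fibre_unit_hom_ext ω (by
    rw [Category.assoc, brk_fibre_map_assoc, act_tUnitIso_hom_oneSec]
    refine (Category.assoc _ _ _).symm.trans ((congrArg (· ≫ _) (brk_fibreUnitInv ω)).trans ?_)
    rw [Functor.Monoidal.η_ε_assoc, Category.comp_id])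

section

variable {C : Type*} [Category* C] [MonoidalCategory C] {A A' B B' D E : C}

theorem whiskerLeft_comp_whiskerRight (f : A ⟶ A') (g : A' ⟶ B) (h : D ⟶ E) :
    A ◁ h ≫ (f ≫ g) ▷ E = f ▷ D ≫ (g ⊗ₘ h) := by
  rw [comp_whiskerRight, whisker_exchange_assoc, MonoidalCategory.tensorHom_def']

theorem whiskerRight_comp_whiskerLeft (f : A ⟶ A') (g : A' ⟶ B) (h : D ⟶ E) :
    h ▷ A ≫ E ◁ (f ≫ g) = D ◁ f ≫ (h ⊗ₘ g) := by
  rw [whiskerLeft_comp, ← whisker_exchange_assoc, MonoidalCategory.tensorHom_def]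

end

/-- The extended fibre functor is a tensor functor. -/
def fibreCoreMonoidal : (fibre F' ω).CoreMonoidal where
  εIso := fibreUnit ω
  μIso M N := fibreMu ω M N
  μIso_hom_natural_left {M M'} f N := tensor_fibre_hom_ext ω fun X Y x y => by
    rw [← tensorHom_id, tensorHom_comp_tensorHom_assoc, brk_fibre_map, Category.comp_id,
      tensor_brk_fibreMu, tensor_brk_fibreMu_assoc, brk_fibre_map, act_whiskerRight]
  μIso_hom_natural_right {M M'} N f := tensor_fibre_hom_ext ω fun X Y x y => by
    rw [← id_tensorHom, tensorHom_comp_tensorHom_assoc, brk_fibre_map, Category.comp_id,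
      tensor_brk_fibreMu, tensor_brk_fibreMu_assoc, brk_fibre_map, act_whiskerLeft]
  associativity M N P := tensor_fibre_hom_ext₃ ω fun X Y Z x y z => by
    rw [← tensorHom_id, tensorHom_comp_tensorHom_assoc, tensor_brk_fibreMu, Category.comp_id,
      associator_naturality_assoc, ← id_tensorHom, tensorHom_comp_tensorHom_assoc,
      tensor_brk_fibreMu, Category.comp_id]
    have h1 : (μ ω.functor X Y ≫ brk ω (tensorSec x y)) ⊗ₘ brk ω z =
        μ ω.functor X Y ▷ _ ≫ (brk ω (tensorSec x y) ⊗ₘ brk ω z) := by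
      rw [← tensorHom_id, tensorHom_comp_tensorHom, Category.id_comp]
    have h2 : brk ω x ⊗ₘ (μ ω.functor Y Z ≫ brk ω (tensorSec y z)) =
        _ ◁ μ ω.functor Y Z ≫ (brk ω x ⊗ₘ brk ω (tensorSec y z)) := by
      rw [← id_tensorHom, tensorHom_comp_tensorHom, Category.id_comp]
    rw [h1, h2, Category.assoc, Category.assoc, tensor_brk_fibreMu_assoc, brk_fibre_map,
      act_associator, brk_map, tensor_brk_fibreMu]
    simpa only [Category.assoc] using congrArg (· ≫ brk ω (tensorSec x (tensorSec y z)))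
      (Functor.LaxMonoidal.associativity (F := ω.functor) X Y Z)
  left_unitality M := by
    refine (jointlyEpi_brk ω M).whiskerLeft _ fun i => ?_
    rw [leftUnitor_naturality]
    refine .trans ?_ (Category.assoc _ _ _)
    refine .trans ?_ (congrArg (· ≫ _) (whiskerLeft_comp_whiskerRight (ε ω.functor)
      (brk ω (oneSec F F' T)) (brk ω i.2)).symm)
    rw [Category.assoc, tensor_brk_fibreMu_assoc, brk_fibre_map, act_leftUnitor, brk_map,
      Functor.LaxMonoidal.left_unitality (F := ω.functor), Category.assoc, Category.assoc]
  right_unitality M := by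
    refine (jointlyEpi_brk ω M).whiskerRight _ fun i => ?_
    rw [rightUnitor_naturality]
    refine .trans ?_ (Category.assoc _ _ _)
    refine .trans ?_ (congrArg (· ≫ _) (whiskerRight_comp_whiskerLeft (ε ω.functor)
      (brk ω (oneSec F F' T)) (brk ω i.2)).symm)
    rw [Category.assoc, tensor_brk_fibreMu_assoc, brk_fibre_map, act_rightUnitor, brk_map,
      Functor.LaxMonoidal.right_unitality (F := ω.functor), Category.assoc, Category.assoc]

/-- The extended fibre functor is a symmetric tensor functor. -/
@[reducible]
def fibreBraided : (fibre F' ω).Braided where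
  toMonoidal := (fibreCoreMonoidal ω).toMonoidal
  braided M N := tensor_fibre_hom_ext ω fun X Y x y => by
    change _ ≫ (fibreMu ω M N).hom ≫ _ = _ ≫ _ ≫ (fibreMu ω N M).hom
    rw [tensor_brk_fibreMu_assoc, brk_fibre_map, act_braiding, brk_map,
      BraidedCategory.braiding_naturality_assoc, tensor_brk_fibreMu,
      Functor.LaxBraided.braided_assoc]

end ScalarExtension

end

/-! ### Left exactness and faithfulness of right exact tensor functors on rigid categories. -/

noncomputable section
namespace ScalarExtension

open MonoidalCategory

set_option linter.unusedSectionVars false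

attribute [local instance] indPreadditive indLinear LexPresheaf.baseModule

section

open Functor.LaxMonoidal Functor.OplaxMonoidal

variable {C D : Type*} [Category* C] [Category* D] [MonoidalCategory C] [MonoidalCategory D]

section

variable [Preadditive C] [MonoidalPreadditive C]

theorem eq_zero_of_whiskerLeft_evaluation {W X Y : C} [ExactPairing X Y] (f : W ⟶ X)
    (h : Y ◁ f ≫ ExactPairing.evaluation X Y = 0) : f = 0 := by
  have h1 : f = (λ_ W).inv ≫ ExactPairing.coevaluation X Y ▷ W ≫ (α_ X Y W).hom ≫
      X ◁ (Y ◁ f ≫ ExactPairing.evaluation X Y) ≫ (ρ_ X).hom := by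
    rw [whiskerLeft_comp, Category.assoc, ← associator_naturality_right_assoc,
      ← whisker_exchange_assoc, ExactPairing.evaluation_coevaluation_assoc, Iso.inv_hom_id,
      Category.comp_id, leftUnitor_naturality, Iso.inv_hom_id_assoc]
  rw [h1, h, MonoidalPreadditive.whiskerLeft_zero, zero_comp, comp_zero, comp_zero, comp_zero]

theorem eq_zero_of_coevaluation_whiskerLeft {W X Y : C} [ExactPairing X Y] (f : Y ⟶ W)
    (h : ExactPairing.coevaluation X Y ≫ X ◁ f = 0) : f = 0 := by
  have h1 : f = (ρ_ Y).inv ≫ Y ◁ (ExactPairing.coevaluation X Y ≫ X ◁ f) ≫ (α_ Y X W).inv ≫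
      ExactPairing.evaluation X Y ▷ W ≫ (λ_ W).hom := by
    rw [whiskerLeft_comp, Category.assoc, associator_inv_naturality_right_assoc,
      whisker_exchange_assoc, ExactPairing.coevaluation_evaluation_assoc, Iso.inv_hom_id_assoc,
      leftUnitor_naturality, Iso.inv_hom_id_assoc]
  rw [h1, h, MonoidalPreadditive.whiskerLeft_zero, zero_comp, comp_zero]

end

variable [Abelian C] [Abelian D] [MonoidalPreadditive C] [MonoidalPreadditive D]
  [SymmetricCategory C] [SymmetricCategory D] [MonoidalClosed D]

/-- A morphism `g` from the dual of `A` to `W` corresponds to a morphism `𝟙 ⟶ A ⊗ W`. If the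
transpose of `i` followed by `g` is zero, this morphism becomes zero after the monomorphism `i ▷ W`,
so it is already zero. -/
theorem epi_rightAdjointMate (hC : ∀ X : C, Dualisable X) {A B : C} [HasRightDual A]
    [HasRightDual B] (i : A ⟶ B) [Mono i] : Epi (rightAdjointMate i) :=
  Preadditive.epi_of_cancel_zero _ fun {W} g hg => by
    have := (hC W).mono_whiskerRight i
    refine eq_zero_of_coevaluation_whiskerLeft (X := A) g ?_
    rw [← cancel_mono (i ▷ W), zero_comp, Category.assoc, whisker_exchange,
      ← Category.assoc, ← coevaluation_comp_rightAdjointMate, Category.assoc, ← whiskerLeft_comp,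
      hg, MonoidalPreadditive.whiskerLeft_zero, comp_zero]

variable (G : C ⥤ D) [G.Monoidal] [G.Additive] [PreservesFiniteColimits G]

/-- The transpose of a monomorphism `i` is epi, and a right exact functor keeps it so. If `h` is
killed by `G.map i`, its pairing with the dual vanishes on the image of that epimorphism, hence
everywhere, and `h` is zero by the zigzag identity. -/
theorem preservesMonomorphisms_of_dualisable (hC : ∀ X : C, Dualisable X) :
    G.PreservesMonomorphisms where
  preserves {A B} i _ := by
    obtain ⟨A', ⟨hA⟩⟩ := hC A
    obtain ⟨B', ⟨hB⟩⟩ := hC B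
    let _ : HasRightDual A := ⟨A'⟩
    let _ : HasRightDual B := ⟨B'⟩
    have := epi_rightAdjointMate hC i
    let _ := mapExactPairing G A Aᘁ
    refine Preadditive.mono_of_cancel_zero _ fun {V} h hh => ?_
    refine eq_zero_of_whiskerLeft_evaluation (X := G.obj A) (Y := G.obj Aᘁ) h ?_
    refine (jointlyEpi_of_epi (G.map (rightAdjointMate i))).whiskerRight V fun _ => ?_
    change _ ≫ _ ≫ μ G _ _ ≫ G.map _ ≫ η G = _
    rw [← whisker_exchange_assoc, μ_natural_left_assoc, ← G.map_comp_assoc,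
      rightAdjointMate_comp_evaluation, G.map_comp_assoc, ← μ_natural_right_assoc,
      ← whiskerLeft_comp_assoc, hh, MonoidalPreadditive.whiskerLeft_zero, zero_comp, comp_zero]

theorem preservesFiniteLimits_of_dualisable (hC : ∀ X : C, Dualisable X) :
    PreservesFiniteLimits G := by
  have := preservesMonomorphisms_of_dualisable G hC
  have : G.PreservesHomology := G.preservesHomology_of_preservesMonos_and_cokernels
  exact G.preservesFiniteLimits_of_preservesHomology

/-- A nonzero `f` corresponds by duality to a nonzero, hence epi, morphism to the simple unit. If
`G` killed `f`, it would send this epimorphism to an epimorphism that is zero, and the image of the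
unit would vanish. -/
theorem faithful_of_dualisable (hC : ∀ X : C, Dualisable X) [Simple (𝟙_ C)]
    (hD : 𝟙 (𝟙_ D) ≠ 0) : G.Faithful := by
  have key : ∀ {M N : C} (f : M ⟶ N), G.map f = 0 → f = 0 := fun {M N} f hf => by
    obtain ⟨N', ⟨_⟩⟩ := (hC N).exists_swap
    refine eq_zero_of_whiskerRight_evaluation (X := N') (Y := N) f ?_
    by_contra hne
    have := epi_of_nonzero_to_simple hne
    have h0 : G.map (f ▷ N' ≫ ExactPairing.evaluation N' N) = 0 := by
      rw [G.map_comp, Functor.Monoidal.map_whiskerRight, hf, MonoidalPreadditive.zero_whiskerRight,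
        zero_comp, comp_zero, zero_comp]
    have h1 : 𝟙 (G.obj (𝟙_ C)) = 0 := by
      rw [← cancel_epi (G.map (f ▷ N' ≫ ExactPairing.evaluation N' N)), h0, zero_comp, zero_comp]
    apply hD
    rw [← Functor.Monoidal.ε_η (F := G), ← Category.id_comp (η G), h1, zero_comp, comp_zero]
  exact ⟨fun {M N f g} h => sub_eq_zero.1 (key _ (by rw [G.map_sub, h, sub_self]))⟩

end

section

attribute [local instance] FibreFunctor.braided FibreFunctor.faithful FibreFunctor.additive
  FibreFunctor.leftExact FibreFunctor.rightExact FibreFunctor.finite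

variable {F F' : Type v} [Field F] [Field F'] [Algebra F F']
variable {T : Type u} [Category.{v} T] [Abelian T] [Linear F T]
variable [MonoidalCategory T] [SymmetricCategory T] [HasDualObjects T] [MonoidalPreadditive T]
  [MonoidalLinear F T]
variable {K : Type v} [Field K] [Algebra F K] [Algebra F' K] [IsScalarTower F F' K]
  (ω : FibreFunctor F T K)
variable [IsFiniteScalarExt F F' T]
variable [MonoidalCategory (ScalarExt F F' T)] [SymmetricCategory (ScalarExt F F' T)]
  [MonoidalPreadditive (ScalarExt F F' T)] [MonoidalLinear F' (ScalarExt F F' T)]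
  [RightExactTensor (ScalarExt F F' T)] [(tFunctor F F' T).Braided]

/-- The fibre functor of the scalar extension defined by a fibre functor over an extension
of `F'`. -/
def fibreFunctor (hT : IsPreTannakian F T) (h : IsPreTannakian F' (ScalarExt F F' T)) :
    FibreFunctor F' (ScalarExt F F' T) K :=
  letI := fibreBraided ω (F' := F')
  haveI := fibre_preservesFiniteColimits (F' := F') ω
  { functor := fibre F' ω
    braided := fibreBraided ω
    faithful := by
      have : Simple (𝟙_ (ScalarExt F F' T)) :=
        simple_unit_scalarExt_of_fibreFunctor hT ω
      refine faithful_of_dualisable _ h.dualisable fun h0 => ?_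
      have := congrArg (fun f => ModuleCat.Hom.hom f (1 : K)) h0
      exact one_ne_zero (α := K) this
    additive := inferInstance
    map_smul := fibre_map_smul ω
    leftExact := preservesFiniteLimits_of_dualisable _ h.dualisable
    rightExact := inferInstance
    finite := fibre_finite ω
    projective := fun _ => inferInstance }

end

end ScalarExtension

end

/-! ### Base change of fibre functors along field homomorphisms. -/

noncomputable section
namespace ScalarExtension

open MonoidalCategory TensorProduct

section

open Functor.LaxMonoidal Functor.OplaxMonoidal

section

variable {R S : Type v} [CommRing R] [CommRing S] (f : R →+* S)

/-- Morphisms out of an extension of scalars are determined on the original module by adjunction, so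
the compatibility is checked on pure tensors. -/
instance extendScalarsBraided : (ModuleCat.extendScalars.{v, v, v} f).Braided where
  braided M N := by
    rw [← cancel_epi (δ (ModuleCat.extendScalars f) M N), Functor.Monoidal.δ_μ_assoc,
      ← cancel_mono (δ (ModuleCat.extendScalars f) N M)]
    simp only [Category.assoc, Functor.Monoidal.μ_δ, Category.comp_id]
    exact ((ModuleCat.extendRestrictScalarsAdj f).homEquiv _ _).injective
      (ModuleCat.MonoidalCategory.tensor_ext (fun _ _ ↦ rfl))

instance extendScalars_additive : (ModuleCat.extendScalars.{v, v, v} f).Additive where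
  map_add {M N g h} := ((ModuleCat.extendRestrictScalarsAdj f).homEquiv _ _).injective 
    (ModuleCat.hom_ext (LinearMap.ext fun m => by
      let := f.toAlgebra
      exact TensorProduct.tmul_add (1 : S) (g m) (h m)))

theorem extendScalars_map_smul {M N : ModuleCat.{v} R} (a : R) (g : M ⟶ N) :
    (ModuleCat.extendScalars.{v, v, v} f).map (a • g) =
      f a • (ModuleCat.extendScalars.{v, v, v} f).map g :=
  ((ModuleCat.extendRestrictScalarsAdj f).homEquiv _ _).injective (ModuleCat.hom_ext (LinearMap.ext fun m => by
    let := f.toAlgebra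
    change (1 : S) ⊗ₜ[R] (a • g m) = (f a * 1) ⊗ₜ[R] g m
    rw [← TensorProduct.smul_tmul]
    rfl))

end

variable {R S : Type v} [Field R] [Field S] (f : R →+* S)

theorem extendScalars_faithful : (ModuleCat.extendScalars.{v, v, v} f).Faithful where
  map_injective {M N g h} hgh := by
    let := f.toAlgebra
    ext m
    have : (1 : S) ⊗ₜ[R] (g m) = (1 : S) ⊗ₜ[R] (h m) :=
      LinearMap.congr_fun (congrArg ModuleCat.Hom.hom hgh) ((1 : S) ⊗ₜ[R] m)
    rw [← sub_eq_zero, ← TensorProduct.tmul_sub] at this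
    exact sub_eq_zero.1 ((Module.FaithfullyFlat.one_tmul_eq_zero_iff R _ _).1 this)

theorem extendScalars_preservesFiniteLimits :
    PreservesFiniteLimits (ModuleCat.extendScalars.{v, v, v} f) := by
  let := f.toAlgebra
  exact ModuleCat.preservesFiniteLimits_extendScalars_of_flat (inferInstanceAs (Module.Flat R S))

theorem extendScalars_finite (M : ModuleCat.{v} R) [Module.Finite R M] :
    Module.Finite S ((ModuleCat.extendScalars.{v, v, v} f).obj M) := by
  let := f.toAlgebra
  exact inferInstanceAs (Module.Finite S (S ⊗[R] M))

end

attribute [local instance] FibreFunctor.braided FibreFunctor.faithful FibreFunctor.additive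
  FibreFunctor.leftExact FibreFunctor.rightExact FibreFunctor.finite

/-- Extension of scalars of a fibre functor along a homomorphism of fields. -/
def FibreFunctor.baseChange {F : Type v} [Field F] {T : Type u} [Category.{v} T] [Preadditive T]
    [Linear F T] [MonoidalCategory T] [SymmetricCategory T] {L K : Type v} [Field L] [Field K]
    [Algebra F L] [Algebra F K] (ω : FibreFunctor F T L) (f : L →ₐ[F] K) :
    FibreFunctor F T K where
  functor := ω.functor ⋙ ModuleCat.extendScalars f.toRingHom
  braided := inferInstance
  faithful :=
    have := extendScalars_faithful f.toRingHom
    inferInstance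
  additive := inferInstance
  map_smul a g := by
    rw [Functor.comp_map, ω.map_smul, extendScalars_map_smul]
    exact congrArg (· • _) (f.commutes a)
  leftExact :=
    have := extendScalars_preservesFiniteLimits f.toRingHom
    comp_preservesFiniteLimits _ _
  rightExact :=
    have := (ModuleCat.extendRestrictScalarsAdj f.toRingHom).leftAdjoint_preservesColimits
    comp_preservesFiniteColimits _ _
  finite X := extendScalars_finite f.toRingHom (ω.functor.obj X)
  projective _ := inferInstance

/-- The field is a residue field of the nonzero ring `F' ⊗ L` over `F`. -/
theorem exists_field_extension (F F' L : Type v) [Field F] [Field F'] [Field L] [Algebra F F']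
    [Algebra F L] : ∃ (K : Type v) (_ : Field K) (_ : Algebra F K) (_ : Algebra F' K),
    IsScalarTower F F' K ∧ Nonempty (L →ₐ[F] K) := by
  obtain ⟨m, hm⟩ := Ideal.exists_maximal (F' ⊗[F] L)
  let _ : Field (F' ⊗[F] L ⧸ m) := Ideal.Quotient.field m
  exact ⟨F' ⊗[F] L ⧸ m, inferInstance, inferInstance, inferInstance, inferInstance,
    ⟨(Ideal.Quotient.mkₐ F m).comp Algebra.TensorProduct.includeRight⟩⟩

end ScalarExtension

end

theorem mainTheorem9 (F F' : Type v) [Field F] [Field F'] [Algebra F F']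
    (T : Type u) [Category.{v} T] [Abelian T] [Linear F T]
    [MonoidalCategory T] [SymmetricCategory T]
    (hT : ScalarExtension.IsTannakian F T) :
    ∃ ht : ∀ X : T, ScalarExtension.isFiniteLength (ScalarExtension.IndModule F F' T)
        ((ScalarExtension.toIndModule F F' T).obj X),
      (∃ (_ : MonoidalCategory (ScalarExtension.ScalarExt F F' T))
        (_ : SymmetricCategory (ScalarExtension.ScalarExt F F' T)),
        ScalarExtension.IsScalarExtTensor ht) ∧
      ∀ [MonoidalCategory (ScalarExtension.ScalarExt F F' T)]
        [SymmetricCategory (ScalarExtension.ScalarExt F F' T)],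
        ScalarExtension.IsScalarExtTensor ht →
          ScalarExtension.IsTannakian F' (ScalarExtension.ScalarExt F F' T) ∧
          (Nonempty (ScalarExtension.FibreFunctor F T F') →
            ScalarExtension.IsNeutralTannakian F' (ScalarExtension.ScalarExt F F' T)) := by
  have hpre := hT.preTannakian
  have := hpre.toMonoidalPreadditive
  have := hpre.toMonoidalLinear
  have : ScalarExtension.HasDualObjects T := ⟨hpre.dualisable⟩
  have ht (X : T) : ScalarExtension.isFiniteLength (ScalarExtension.IndModule F F' T)
      ((ScalarExtension.toIndModule F F' T).obj X) :=
    ScalarExtension.isFiniteLength_tObj hpre.finite_length hpre.finite_end X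
  have : ScalarExtension.IsFiniteScalarExt F F' T := ⟨ht⟩
  obtain ⟨L, _, _, ⟨ω⟩⟩ := hT.exists_fibreFunctor
  refine ⟨ht, ⟨ScalarExtension.ScalarExt.monoidal, ScalarExtension.ScalarExt.symmetric,
    ScalarExtension.ScalarExt.isScalarExtTensor ht⟩, fun h => ?_⟩
  have := h.toMonoidalPreadditive
  have := h.toMonoidalLinear
  have : ScalarExtension.RightExactTensor (ScalarExtension.ScalarExt F F' T) :=
    ⟨h.tensorLeft_rightExact, h.tensorRight_rightExact⟩
  obtain ⟨hb⟩ := h.braided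
  let _ : (ScalarExtension.tFunctor F F' T).Braided := hb
  have hS := ScalarExtension.isPreTannakian_scalarExt (F' := F') hpre ω
  have hTan : ScalarExtension.IsTannakian F' (ScalarExtension.ScalarExt F F' T) := by
    -- The field `L` of the given fibre functor need not contain `F'`, so the functor is first
    -- extended to a field over both.
    obtain ⟨K, _, _, _, _, ⟨f⟩⟩ := ScalarExtension.exists_field_extension F F' L
    exact ⟨hS, K, inferInstance, inferInstance,
      ⟨ScalarExtension.fibreFunctor (ω.baseChange f) hpre hS⟩⟩
  -- A fibre functor over `F'` extends with `K = F'`, so the extended functor has values over the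
  -- base field itself.
  exact ⟨hTan, fun ⟨ω'⟩ => ⟨hTan, ⟨ScalarExtension.fibreFunctor ω' hpre hS⟩⟩⟩
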